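/- Let $A=(1,3,8,4,9,16,15,2,14,12,6,7,13,5,10)$ and $B=(1,11,16)(2,10,14)(3,12,13)(4,9,15)(5,7,8)$, permutations of $\{1,\dots,16\}$ in cycle notation, and let $(K3)_{16}$ be the abstract simplicial complex on the vertex set $V=\{1,\dots,16\}$ whose facets are the sets in the orbits of $\{1,2,3,8,12\}$ and of $\{1,2,5,8,14\}$ under the group $\langle A,B\rangle$; this is a $16$-vertex triangulation of the $K3$ surface. Let $M$ be its geometric realization. A function $f:M\to\mathbb{R}$ is called regular simplexwise linear (rsl) if it is linear (i.e. affine) on every simplex of the triangulation and $f(v)\neq f(w)$ for any two distinct vertices $v,w$. For a field $F$ and $0\le i\le 4$, the number of critical points of $f$ of index $i$ (counted with multiplicity) is $$\mu_i(f,F):=\sum_{v\in V}\dim_F H_i\bigl(M_v,\,M_v\setminus\{v\};F\bigr),\qquad M_v:=\{y\in M: f(y)\le f(v)\},$$ where $H_*$ denotes singular homology, and the total number of critical points is $\mu(f,F):=\sum_{i=0}^4\mu_i(f,F)$. **Proposition.** For every field $F$ and every rsl function $f:M\to\mathbb{R}$, the total number of critical points is $\mu(f,F)=24$. More precisely, $\mu_0(f,F)=\mu_4(f,F)=1$,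 $\mu_1(f,F)=\mu_3(f,F)=0$ and $\mu_2(f,F)=22$. -/

import Mathlib

universe u

/-! ### Geometric realization of a finite abstract simplicial complex -/

section Realization

variable {V : Type} [Fintype V]

/-- The closed geometric simplex spanned by the standard basis vectors `e_v`, `v ∈ s`, in `ℝ^V`:
the points with non-negative coordinates of sum `1` that vanish outside `s`. -/
def geomSimplex (s : Finset V) : Set (V → ℝ) :=
  {x | x ∈ stdSimplex ℝ V ∧ ∀ v, v ∉ s → x v = 0}

/-- The geometric realization of `K` as a subset of `ℝ^V`; as a type it carries the subspace
topology. -/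
def AbstractSimplicialComplex.realization (K : AbstractSimplicialComplex V) : Set (V → ℝ) :=
  ⋃ s ∈ K.faces, geomSimplex s

variable [DecidableEq V]

theorem single_mem_realization (K : AbstractSimplicialComplex V) (v : V) :
    (Pi.single v 1 : V → ℝ) ∈ K.realization := by
  refine Set.mem_biUnion (K.singleton_mem v) ⟨single_mem_stdSimplex ℝ v, fun w hw => ?_⟩
  exact Pi.single_eq_of_ne (by simpa using hw) _

/-- The vertex `v`, as a point of the geometric realization. -/
def AbstractSimplicialComplex.vertexPoint (K : AbstractSimplicialComplex V) (v : V) :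
    K.realization :=
  ⟨Pi.single v 1, single_mem_realization K v⟩

/-- Regular simplexwise linear functions `f : |K| → ℝ`: the restriction of `f` to every simplex is
the restriction of an affine map, and `f` takes distinct values at distinct vertices. -/
structure IsRSL (K : AbstractSimplicialComplex V) (f : K.realization → ℝ) : Prop where
  linear : ∀ s ∈ K.faces, ∃ g : (V → ℝ) →ᵃ[ℝ] ℝ,
    ∀ x : K.realization, x.1 ∈ geomSimplex s → f x = g x.1
  regular : ∀ v w : V, v ≠ w → f (K.vertexPoint v) ≠ f (K.vertexPoint w)

end Realization

/-! ### Relative singular homology with coefficients in a field -/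

/-- The relative singular chain complex `S(X; F) / S(A; F)` of a pair `(X, A)` of topological
spaces. -/
noncomputable def relSingularChainComplex (F : Type u) [Field F] (P : TopPair.{0}) :
    ChainComplex (ModuleCat.{u} F) ℕ :=
  CategoryTheory.Limits.cokernel (((AlgebraicTopology.singularChainComplexFunctor.{0} (ModuleCat.{u} F)).obj
    (ModuleCat.of F F)).map P.map)

/-- The relative singular homology `H_i(X, A; F)` of a pair `(X, A)` of topological spaces. -/
noncomputable def relSingularHomology (F : Type u) [Field F] (P : TopPair.{0}) (i : ℕ) :
    ModuleCat.{u} F :=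
  (relSingularChainComplex F P).homology i

/-! ### Critical points of functions on a topological space -/

section Critical

variable {X : Type} [TopologicalSpace X]

/-- The pair `(X_x, X_x \ {x})`, where `X_x = {y | f y ≤ f x}`. -/
def sublevelPair (f : X → ℝ) (x : X) : TopPair.{0} :=
  TopPair.ofSubset (X := TopCat.of {y : X // f y ≤ f x}) {y | y.1 ≠ x}

/-- `dim H_i(X_x, X_x \ {x}; F)`, as a cardinal. -/
noncomputable def critMultiplicity (F : Type u) [Field F] (f : X → ℝ) (x : X) (i : ℕ) :
    Cardinal.{u} :=
  Module.rank F (relSingularHomology F (sublevelPair f x) i)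

end Critical

section Counting

variable {V : Type} [Fintype V] [DecidableEq V]

/-- The number `μ_i(f, F)` of critical points of index `i`: the sum of the multiplicities of index
`i` over the vertices. -/
noncomputable def numCritical (F : Type u) [Field F] (K : AbstractSimplicialComplex V)
    (f : K.realization → ℝ) (i : ℕ) : Cardinal.{u} :=
  ∑ v : V, critMultiplicity F f (K.vertexPoint v) i

/-- The number `μ(f, F)` of critical points of `f` on a `d`-dimensional complex: the sum of the
`μ_i(f, F)` for `0 ≤ i ≤ d`. -/
noncomputable def totalCritical (F : Type u) [Field F] (K : AbstractSimplicialComplex V) (d : ℕ)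
    (f : K.realization → ℝ) : Cardinal.{u} :=
  ∑ i ∈ Finset.range (d + 1), numCritical F K f i

end Counting

/-! ### The 16-vertex triangulation of the K3 surface -/

namespace K3

/-- The first generator, a 15-cycle. The vertices `1, …, 16` are the elements of `Fin 16`; the
numeral `16` denotes the element `0`. -/
def genA : Equiv.Perm (Fin 16) :=
  [1, 3, 8, 4, 9, 16, 15, 2, 14, 12, 6, 7, 13, 5, 10].formPerm

/-- The second generator, a product of five disjoint 3-cycles. -/
def genB : Equiv.Perm (Fin 16) :=
  [1, 11, 16].formPerm * [2, 10, 14].formPerm * [3, 12, 13].formPerm *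
    [4, 9, 15].formPerm * [5, 7, 8].formPerm

/-- The permutation group generated by the two generators. -/
def symGroup : Subgroup (Equiv.Perm (Fin 16)) :=
  Subgroup.closure {genA, genB}

/-- The facets: the union of the orbits of `{1, 2, 3, 8, 12}` and of `{1, 2, 5, 8, 14}`. -/
def facets : Set (Finset (Fin 16)) :=
  {t | ∃ g ∈ symGroup, t = ({1, 2, 3, 8, 12} : Finset (Fin 16)).image g ∨
    t = ({1, 2, 5, 8, 14} : Finset (Fin 16)).image g}

theorem exists_mem_symGroup (v : Fin 16) : ∃ g ∈ symGroup, g 1 = v := by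
  have hA : genA ∈ symGroup := Subgroup.subset_closure (by simp)
  have hB : genB ∈ symGroup := Subgroup.subset_closure (by simp)
  by_cases hv : v = 11
  · exact ⟨genB, hB, by subst hv; decide⟩
  · have h : ∀ w : Fin 16, w ≠ 11 → ∃ k : Fin 15, (genA ^ (k : ℕ)) 1 = w := by decide +kernel
    obtain ⟨k, hk⟩ := h v hv
    exact ⟨_, pow_mem hA _, hk⟩

/-- The 16-vertex triangulation `(K3)₁₆`: the faces are the non-empty subsets of the facets. -/
def complex : AbstractSimplicialComplex (Fin 16) where
  faces := {s | s.Nonempty ∧ ∃ t ∈ facets, s ⊆ t}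
  isRelLowerSet_faces := by
    rintro s ⟨hs, t, ht, hst⟩
    exact ⟨hs, fun r hr hr' => ⟨hr', t, ht, hr.trans hst⟩⟩
  singleton_mem v := by
    obtain ⟨g, hg, rfl⟩ := exists_mem_symGroup v
    exact ⟨Finset.singleton_nonempty _, _, ⟨g, hg, Or.inl rfl⟩, by simp⟩

end K3

/-!
The multiplicity of a vertex `v` is the dimension of a relative simplicial homology group: the pair
`(M_v, M_v \ {v})` may be replaced by the complex of the faces all of whose vertices `u` satisfy
`f u ≤ f v` (the *low* faces), relative to those that avoid `v`. These groups are computed from four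
properties of the triangulation, and the Euler characteristic gives the last one.

*From singular to simplicial homology* (`critMultiplicity_eq_rank`). No homology theory is available
for this step, so it is done on the chain level. The cokernel of Mathlib's singular chain complexes
is identified with a quotient of chains of singular simplices of `ℝ^V`
(`rank_relSingularHomology`). Radial projection from `v` deforms the punctured sublevel set, which is
not closed, into the complement of the open star of `v` (`nonempty_equiv_starComplement`). After
sufficiently many barycentric subdivisions all singular simplices are small, and a small singular
simplex is approximated by an affine one: each point `x` of the sublevel set is labelled by a low
vertex whose barycentric coordinate is positive near `x` (`exists_lowVertex_near`). Mapping a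
singular simplex to the tuple of the labels of its vertices is inverse, up to chain homotopy, to
realizing an oriented simplex (`nonempty_low_equiv_starComplement`). The homotopies are prisms and
cones. All chain complexes are graded by the number of vertices and augmented by the empty simplex.

*The homology of low faces.* Let `H_i` be the group in dimension `i` at the vertex `v`. The
hypotheses on the triangulation are collected in `IsNeighborlyManifold`.
* If some vertex `u` is lower than `v`, coning with apex `u` shows `H_0 = H_1 = 0`, since all sets of
  at most three vertices are faces (`finrank_lowHomology_of_lt`).
* A 4-chain that is a relative cycle is a multiple of the fundamental cycle in the star of `v`, since
  links of edges are strongly connected and every triple of vertices lies in a facet. So `H_4 = 0`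
  unless `v` is the highest vertex (`finrank_lowHomology_four_of_lt`).
* A relative 3-cycle bounds in the full star, because the link of `v` without a facet collapses to a
  graph. At the edges from `v` to higher vertices, the bounding chain is a cycle, hence a multiple of
  the fundamental cycle; subtracting this multiple, it becomes a chain of low faces. So `H_3 = 0`
  (`finrank_lowHomology_three`).
* Every face is counted at its highest vertex, so the alternating sum of all multiplicities is the
  Euler characteristic `16 - 120 + 560 - 720 + 288 = 24`. The lowest and the highest vertex account
  for `μ_0 = μ_4 = 1`, and `μ_2 = 22` remains (`sum_finrank_lowHomology_two`).

*The triangulation.* Sets of vertices are encoded by binary numbers, and the list of the 288 facets,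
the signs of the fundamental cycle, and a collapse of the link of the vertex `11` are verified by
computation. The group acts transitively on the vertices, so the properties of the star of `11` hold
at all vertices (`K3.isNeighborlyManifold`).
-/

/-! ### Chains of tuples -/

section TupleChains

variable (F : Type*) [Field F] {D D' D'' : Type*}

/-- The free module on the `n`-tuples of elements of `D`: the ordered simplicial chains of the full
simplex on `D`. Chains are graded by the number of vertices, so that the complex is augmented by
the empty tuple in degree `0`. -/
abbrev TupleChain (D : Type*) (n : ℕ) := (Fin n → D) →₀ F

variable {F}

theorem Finsupp.lhom_ext_one {α M : Type*} [AddCommGroup M] [Module F M]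
    {f g : (α →₀ F) →ₗ[F] M} (h : ∀ a, f (Finsupp.single a 1) = g (Finsupp.single a 1)) :
    f = g :=
  Finsupp.lhom_ext' fun a => LinearMap.ext_ring (h a)

variable (F)

/-- The alternating sum of the faces of a tuple. -/
noncomputable def tupleBoundary (n : ℕ) : TupleChain F D (n + 1) →ₗ[F] TupleChain F D n :=
  Finsupp.linearCombination F fun τ =>
    ∑ i : Fin (n + 1), (-1 : F) ^ (i : ℕ) • Finsupp.single (fun j => τ (i.succAbove j)) 1

/-- Prepending the vertex `b` to a tuple. -/
noncomputable def tupleCone (b : D) (n : ℕ) : TupleChain F D n →ₗ[F] TupleChain F D (n + 1) :=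
  Finsupp.lmapDomain F F fun τ => (Fin.cons b τ : Fin (n + 1) → D)

/-- The map of tuple chains induced by a map of vertices. -/
noncomputable def tupleMap (γ : D → D') (n : ℕ) : TupleChain F D n →ₗ[F] TupleChain F D' n :=
  Finsupp.lmapDomain F F fun τ => γ ∘ τ

variable {F}

@[simp]
theorem tupleBoundary_single {n : ℕ} (τ : Fin (n + 1) → D) :
    tupleBoundary F n (Finsupp.single τ 1) =
      ∑ i : Fin (n + 1), (-1 : F) ^ (i : ℕ) • Finsupp.single (fun j => τ (i.succAbove j)) 1 := by
  simp [tupleBoundary]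

@[simp]
theorem tupleCone_single (b : D) {n : ℕ} (τ : Fin n → D) (a : F) :
    tupleCone F b n (Finsupp.single τ a) = Finsupp.single (Fin.cons b τ : Fin (n + 1) → D) a := by
  simp [tupleCone]

@[simp]
theorem tupleMap_single (γ : D → D') {n : ℕ} (τ : Fin n → D) (a : F) :
    tupleMap F γ n (Finsupp.single τ a) = Finsupp.single (γ ∘ τ) a := by
  simp [tupleMap]

theorem tupleBoundary_cone_zero (b : D) (x : TupleChain F D 0) :
    tupleBoundary F 0 (tupleCone F b 0 x) = x := by
  suffices h : tupleBoundary F 0 ∘ₗ tupleCone F b 0 = LinearMap.id from LinearMap.congr_fun h x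
  refine Finsupp.lhom_ext_one fun τ => ?_
  simp [Subsingleton.elim _ τ]

theorem tupleBoundary_cone (b : D) {n : ℕ} (x : TupleChain F D (n + 1)) :
    tupleBoundary F (n + 1) (tupleCone F b (n + 1) x) =
      x - tupleCone F b n (tupleBoundary F n x) := by
  suffices h : tupleBoundary F (n + 1) ∘ₗ tupleCone F b (n + 1) =
      LinearMap.id - tupleCone F b n ∘ₗ tupleBoundary F n from LinearMap.congr_fun h x
  refine Finsupp.lhom_ext_one fun τ => ?_
  have h (i : Fin (n + 1)) : (fun j => (Fin.cons b τ : Fin (n + 2) → D) (i.succ.succAbove j)) =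
      Fin.cons b fun j => τ (i.succAbove j) := by
    ext j
    cases j using Fin.cases <;> simp
  rw [LinearMap.comp_apply, tupleCone_single, tupleBoundary_single, Fin.sum_univ_succ]
  simp only [h]
  simp [pow_succ, sub_eq_add_neg]

theorem tupleBoundary_tupleBoundary {n : ℕ} (x : TupleChain F D (n + 2)) :
    tupleBoundary F n (tupleBoundary F (n + 1) x) = 0 := by
  suffices h : tupleBoundary F n ∘ₗ tupleBoundary F (n + 1) =
      (0 : TupleChain F D (n + 2) →ₗ[F] _) from LinearMap.congr_fun h x
  refine Finsupp.lhom_ext_one fun τ => ?_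
  induction n with
  | zero =>
    rw [← Fin.cons_self_tail τ, ← tupleCone_single]
    simp [tupleBoundary_cone, tupleBoundary_cone_zero, -tupleCone_single]
  | succ n ih =>
    rw [← Fin.cons_self_tail τ, ← tupleCone_single]
    have := ih 0 (Fin.tail τ)
    simp only [LinearMap.comp_apply] at this ⊢
    simp only [tupleBoundary_cone, map_sub, this]
    simp

theorem tupleMap_cone (γ : D → D') (b : D) {n : ℕ} (x : TupleChain F D n) :
    tupleMap F γ (n + 1) (tupleCone F b n x) = tupleCone F (γ b) n (tupleMap F γ n x) := by
  suffices h : tupleMap F γ (n + 1) ∘ₗ tupleCone F b n = tupleCone F (γ b) n ∘ₗ tupleMap F γ n from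
    LinearMap.congr_fun h x
  refine Finsupp.lhom_ext_one fun τ => ?_
  simp only [LinearMap.comp_apply, tupleCone_single, tupleMap_single]
  congr 1
  ext j
  cases j using Fin.cases <;> simp

theorem tupleMap_boundary (γ : D → D') {n : ℕ} (x : TupleChain F D (n + 1)) :
    tupleMap F γ n (tupleBoundary F n x) = tupleBoundary F n (tupleMap F γ (n + 1) x) := by
  suffices h : tupleMap F γ n ∘ₗ tupleBoundary F n = tupleBoundary F n ∘ₗ tupleMap F γ (n + 1) from
    LinearMap.congr_fun h x
  refine Finsupp.lhom_ext_one fun τ => ?_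
  simp [Function.comp_def]

variable (F) in
/-- The chains all of whose vertices lie in `s`. -/
def tuplesIn (s : Set D) (n : ℕ) : Submodule F (TupleChain F D n) :=
  Finsupp.supported F F {τ | ∀ i, τ i ∈ s}

theorem Finsupp.map_mem_of_single {α M : Type*} [AddCommGroup M] [Module F M]
    (f : (α →₀ F) →ₗ[F] M) {s : Set α} {N : Submodule F M}
    (h : ∀ a ∈ s, f (Finsupp.single a 1) ∈ N) {x : α →₀ F} (hx : x ∈ Finsupp.supported F F s) :
    f x ∈ N := by
  rw [← Finsupp.sum_single x, Finsupp.sum, map_sum]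
  refine N.sum_mem fun a ha => ?_
  rw [← mul_one (x a), ← smul_eq_mul, ← Finsupp.smul_single, map_smul]
  exact N.smul_mem _ (h a (hx ha))

theorem single_mem_tuplesIn {s : Set D} {n : ℕ} {τ : Fin n → D} (h : ∀ i, τ i ∈ s) (a : F) :
    Finsupp.single τ a ∈ tuplesIn F s n :=
  Finsupp.single_mem_supported F a h

theorem tupleCone_mem {s : Set D} {b : D} (hb : b ∈ s) {n : ℕ} {x : TupleChain F D n}
    (hx : x ∈ tuplesIn F s n) : tupleCone F b n x ∈ tuplesIn F s (n + 1) := by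
  refine Finsupp.map_mem_of_single _ (fun τ hτ => ?_) hx
  rw [tupleCone_single]
  refine single_mem_tuplesIn (fun i => ?_) 1
  cases i using Fin.cases with
  | zero => exact hb
  | succ i => exact hτ i

theorem tupleBoundary_mem {s : Set D} {n : ℕ} {x : TupleChain F D (n + 1)}
    (hx : x ∈ tuplesIn F s (n + 1)) : tupleBoundary F n x ∈ tuplesIn F s n := by
  refine Finsupp.map_mem_of_single _ (fun τ hτ => ?_) hx
  rw [tupleBoundary_single]
  exact Submodule.sum_mem _ fun i _ => Submodule.smul_mem _ _ (single_mem_tuplesIn (fun j => hτ _) 1)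

/-! ### Chain homotopies by coning -/

/-- The homotopy between two chain maps `α`, `β` of tuple chains that is forced by coning: the
target is contractible, and the value at a tuple is chosen to be a cone whose apex depends on the
first vertex only. -/
noncomputable def coneHomotopy (α β : ∀ n, TupleChain F D n →ₗ[F] TupleChain F D' n) (a : D → D') :
    ∀ n, TupleChain F D n →ₗ[F] TupleChain F D' (n + 1)
  | 0 => 0
  | n + 1 => Finsupp.linearCombination F fun τ => tupleCone F (a (τ 0)) (n + 1)
      (α (n + 1) (Finsupp.single τ 1) - β (n + 1) (Finsupp.single τ 1) -
        coneHomotopy α β a n (tupleBoundary F n (Finsupp.single τ 1)))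

variable {α β : ∀ n, TupleChain F D n →ₗ[F] TupleChain F D' n} {a : D → D'}

theorem coneHomotopy_single {n : ℕ} (τ : Fin (n + 1) → D) :
    coneHomotopy α β a (n + 1) (Finsupp.single τ 1) = tupleCone F (a (τ 0)) (n + 1)
      (α (n + 1) (Finsupp.single τ 1) - β (n + 1) (Finsupp.single τ 1) -
        coneHomotopy α β a n (tupleBoundary F n (Finsupp.single τ 1))) := by
  simp [coneHomotopy]

theorem tupleBoundary_coneHomotopy (h0 : α 0 = β 0)
    (hα : ∀ n x, tupleBoundary F n (α (n + 1) x) = α n (tupleBoundary F n x))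
    (hβ : ∀ n x, tupleBoundary F n (β (n + 1) x) = β n (tupleBoundary F n x))
    {n : ℕ} (x : TupleChain F D (n + 1)) :
    tupleBoundary F (n + 1) (coneHomotopy α β a (n + 1) x) +
      coneHomotopy α β a n (tupleBoundary F n x) = α (n + 1) x - β (n + 1) x := by
  induction n with
  | zero =>
    suffices h : tupleBoundary F 1 ∘ₗ coneHomotopy α β a 1 = α 1 - β 1 by
      simpa [coneHomotopy] using LinearMap.congr_fun h x
    refine Finsupp.lhom_ext_one fun τ => ?_
    rw [LinearMap.comp_apply, coneHomotopy_single, tupleBoundary_cone]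
    simp only [map_sub, hα, hβ, h0]
    simp [coneHomotopy]
  | succ n ih =>
    suffices h : tupleBoundary F (n + 2) ∘ₗ coneHomotopy α β a (n + 2) +
        coneHomotopy α β a (n + 1) ∘ₗ tupleBoundary F (n + 1) = α (n + 2) - β (n + 2) from
      LinearMap.congr_fun h x
    refine Finsupp.lhom_ext_one fun τ => ?_
    have key := ih (tupleBoundary F (n + 1) (Finsupp.single τ 1))
    rw [tupleBoundary_tupleBoundary, map_zero, add_zero] at key
    rw [LinearMap.add_apply, LinearMap.comp_apply, coneHomotopy_single, tupleBoundary_cone]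
    simp only [map_sub, hα, hβ, key, LinearMap.comp_apply, LinearMap.sub_apply]
    simp

theorem coneHomotopy_mem {s : Set D} {s' : Set D'} (ha : ∀ x ∈ s, a x ∈ s')
    (hα : ∀ n, ∀ x ∈ tuplesIn F s n, α n x ∈ tuplesIn F s' n)
    (hβ : ∀ n, ∀ x ∈ tuplesIn F s n, β n x ∈ tuplesIn F s' n) {n : ℕ} {x : TupleChain F D n}
    (hx : x ∈ tuplesIn F s n) : coneHomotopy α β a n x ∈ tuplesIn F s' (n + 1) := by
  induction n with
  | zero => exact Submodule.zero_mem _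
  | succ n ih =>
    refine Finsupp.map_mem_of_single _ (fun τ hτ => ?_) hx
    rw [coneHomotopy_single]
    have h1 := single_mem_tuplesIn (F := F) hτ 1
    exact tupleCone_mem (ha _ (hτ 0)) (Submodule.sub_mem _ (Submodule.sub_mem _ (hα _ _ h1)
      (hβ _ _ h1)) (ih (tupleBoundary_mem h1)))

theorem tupleMap_coneHomotopy {E E' : Type*}
    {α' β' : ∀ n, TupleChain F E n →ₗ[F] TupleChain F E' n} {a' : E → E'}
    (γ : D → E) (γ' : D' → E') (ha : ∀ x, a' (γ x) = γ' (a x))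
    (hα : ∀ n x, tupleMap F γ' n (α n x) = α' n (tupleMap F γ n x))
    (hβ : ∀ n x, tupleMap F γ' n (β n x) = β' n (tupleMap F γ n x))
    {n : ℕ} (x : TupleChain F D n) :
    tupleMap F γ' (n + 1) (coneHomotopy α β a n x) =
      coneHomotopy α' β' a' n (tupleMap F γ n x) := by
  induction n with
  | zero => simp [coneHomotopy]
  | succ n ih =>
    suffices h : tupleMap F γ' (n + 2) ∘ₗ coneHomotopy α β a (n + 1) =
      coneHomotopy α' β' a' (n + 1) ∘ₗ tupleMap F γ (n + 1) from LinearMap.congr_fun h x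
    refine Finsupp.lhom_ext_one fun τ => ?_
    simp only [LinearMap.comp_apply, tupleMap_single, coneHomotopy_single, tupleMap_cone, map_sub,
      hα, hβ, ih, tupleMap_boundary, Function.comp_apply, ha]

end TupleChains

/-! ### Convex combinations and barycentric subdivision of tuples -/

section Subdivision

/-- Spaces in which finite tuples have continuous convex combinations: `comb τ` is the affine
simplex with vertices `τ`. The second axiom is what compatibility with faces amounts to. -/
class ConvexComb (D : Type*) [TopologicalSpace D] where
  /-- The affine simplex with given vertices. -/
  comb {n : ℕ} (τ : Fin n → D) : C(stdSimplex ℝ (Fin n), D)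
  comb_map {m n : ℕ} (τ : Fin n → D) (g : Fin m → Fin n) (p : stdSimplex ℝ (Fin m)) :
    comb τ (stdSimplex.map g p) = comb (τ ∘ g) p

open ConvexComb

theorem stdSimplex.sum_map_smul {M : Type*} [AddCommGroup M] [Module ℝ M] {m n : ℕ}
    (g : Fin m → Fin n) (p : stdSimplex ℝ (Fin m)) (c : Fin n → M) :
    ∑ j, stdSimplex.map g p j • c j = ∑ i, p i • c (g i) := by
  simp only [stdSimplex.map_coe, FunOnFinite.linearMap_apply_apply, Finset.sum_smul]
  rw [← Finset.sum_fiberwise Finset.univ g]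
  refine Finset.sum_congr rfl fun j _ => Finset.sum_congr rfl fun i hi => ?_
  rw [(Finset.mem_filter.mp hi).2]

theorem stdSimplex.continuous_sum_smul {M : Type*} [AddCommGroup M] [Module ℝ M]
    [TopologicalSpace M] [ContinuousAdd M] [ContinuousSMul ℝ M] {n : ℕ} (c : Fin n → M) :
    Continuous fun p : stdSimplex ℝ (Fin n) => ∑ i, p i • c i :=
  continuous_finsetSum _ fun i _ =>
    ((continuous_apply i).comp continuous_subtype_val).smul continuous_const

instance {m : ℕ} : ConvexComb (stdSimplex ℝ (Fin m)) where
  comb τ :=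
    { toFun p := ⟨∑ i, p i • (τ i).1, (convex_stdSimplex ℝ (Fin m)).sum_mem (fun i _ => p.2.1 i)
        p.2.2 fun i _ => (τ i).2⟩
      continuous_toFun := (stdSimplex.continuous_sum_smul _).subtype_mk _ }
  comb_map τ g p := Subtype.ext (stdSimplex.sum_map_smul g p fun j => (τ j).1)

instance : ConvexComb unitInterval where
  comb τ :=
    { toFun p := ⟨∑ i, p i • (τ i).1, (convex_Icc (0 : ℝ) 1).sum_mem (fun i _ => p.2.1 i)
        p.2.2 fun i _ => (τ i).2⟩
      continuous_toFun := (stdSimplex.continuous_sum_smul _).subtype_mk _ }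
  comb_map τ g p := Subtype.ext (stdSimplex.sum_map_smul g p fun j => (τ j).1)

instance {D D' : Type*} [TopologicalSpace D] [TopologicalSpace D'] [ConvexComb D]
    [ConvexComb D'] : ConvexComb (D × D') where
  comb τ := (comb (Prod.fst ∘ τ)).prodMk (comb (Prod.snd ∘ τ))
  comb_map _ g p := Prod.ext (comb_map _ g p) (comb_map _ g p)

variable (F : Type*) [Field F] {D D' : Type*} [TopologicalSpace D] [ConvexComb D]
  [TopologicalSpace D'] [ConvexComb D']

/-- Barycentric subdivision of tuple chains: the boundary is subdivided first, and then coned off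
from the barycenter. -/
noncomputable def subdivision : ∀ n, TupleChain F D n →ₗ[F] TupleChain F D n
  | 0 => LinearMap.id
  | n + 1 => Finsupp.linearCombination F fun τ => tupleCone F (comb τ stdSimplex.barycenter) n
      (subdivision n (tupleBoundary F n (Finsupp.single τ 1)))

variable {F}

theorem subdivision_single {n : ℕ} (τ : Fin (n + 1) → D) :
    subdivision F (n + 1) (Finsupp.single τ 1) = tupleCone F (comb τ stdSimplex.barycenter) n
      (subdivision F n (tupleBoundary F n (Finsupp.single τ 1))) := by
  simp [subdivision]

theorem tupleBoundary_subdivision {n : ℕ} (x : TupleChain F D (n + 1)) :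
    tupleBoundary F n (subdivision F (n + 1) x) = subdivision F n (tupleBoundary F n x) := by
  suffices h : tupleBoundary F n ∘ₗ subdivision F (n + 1) =
      (subdivision F n ∘ₗ tupleBoundary F n : TupleChain F D (n + 1) →ₗ[F] _) from
    LinearMap.congr_fun h x
  clear x
  induction n with
  | zero =>
    refine Finsupp.lhom_ext_one fun τ => ?_
    rw [LinearMap.comp_apply, subdivision_single, tupleBoundary_cone_zero, LinearMap.comp_apply]
  | succ n ih =>
    refine Finsupp.lhom_ext_one fun τ => ?_
    have key := LinearMap.congr_fun ih (tupleBoundary F (n + 1) (Finsupp.single τ 1))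
    rw [LinearMap.comp_apply, LinearMap.comp_apply, tupleBoundary_tupleBoundary, map_zero] at key
    rw [LinearMap.comp_apply, subdivision_single, tupleBoundary_cone, key, map_zero, sub_zero,
      LinearMap.comp_apply]

theorem tupleMap_subdivision (γ : D → D')
    (hγ : ∀ n (τ : Fin n → D) p, γ (comb τ p) = comb (γ ∘ τ) p) {n : ℕ} (x : TupleChain F D n) :
    tupleMap F γ n (subdivision F n x) = subdivision F n (tupleMap F γ n x) := by
  induction n with
  | zero => rfl
  | succ n ih =>
    suffices h : tupleMap F γ (n + 1) ∘ₗ subdivision F (n + 1) =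
      subdivision F (n + 1) ∘ₗ tupleMap F γ (n + 1) from LinearMap.congr_fun h x
    refine Finsupp.lhom_ext_one fun τ => ?_
    simp only [LinearMap.comp_apply, tupleMap_single, subdivision_single, tupleMap_cone, hγ, ih,
      tupleMap_boundary]

theorem subdivision_mem {s : Set D}
    (hs : ∀ n (τ : Fin n → D) p, (∀ i, τ i ∈ s) → comb τ p ∈ s) {n : ℕ} {x : TupleChain F D n}
    (hx : x ∈ tuplesIn F s n) : subdivision F n x ∈ tuplesIn F s n := by
  induction n with
  | zero => exact hx
  | succ n ih =>
    refine Finsupp.map_mem_of_single _ (fun τ hτ => ?_) hx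
    rw [subdivision_single]
    exact tupleCone_mem (hs _ _ _ hτ) (ih (tupleBoundary_mem (single_mem_tuplesIn hτ 1)))

theorem tupleBoundary_subdivision_pow (N : ℕ) {n : ℕ} (x : TupleChain F D (n + 1)) :
    tupleBoundary F n ((subdivision F (n + 1) ^ N) x) =
      (subdivision F n ^ N) (tupleBoundary F n x) := by
  induction N generalizing x with
  | zero => rfl
  | succ N ih => rw [pow_succ, pow_succ, Module.End.mul_apply, Module.End.mul_apply, ih,
      tupleBoundary_subdivision]

theorem tupleMap_subdivision_pow (γ : D → D')
    (hγ : ∀ n (τ : Fin n → D) p, γ (comb τ p) = comb (γ ∘ τ) p) (N : ℕ) {n : ℕ}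
    (x : TupleChain F D n) :
    tupleMap F γ n ((subdivision F n ^ N) x) = (subdivision F n ^ N) (tupleMap F γ n x) := by
  induction N generalizing x with
  | zero => rfl
  | succ N ih => rw [pow_succ, pow_succ, Module.End.mul_apply, Module.End.mul_apply, ih,
      tupleMap_subdivision γ hγ]

theorem subdivision_pow_zero (N : ℕ) : subdivision F 0 ^ N = (1 : Module.End F (TupleChain F D 0)) :=
  one_pow N

/-! ### The mesh of the subdivision -/

theorem dist_comb_le {m n : ℕ} {τ : Fin n → stdSimplex ℝ (Fin m)} {y : stdSimplex ℝ (Fin m)}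
    {w : Fin n → ℝ} (p : stdSimplex ℝ (Fin n)) (h : ∀ i, dist y (τ i) ≤ w i) :
    dist y (comb τ p) ≤ ∑ i, p i * w i := by
  have h0 : 0 ≤ ∑ i, p i * w i :=
    Finset.sum_nonneg fun i _ => mul_nonneg (p.2.1 i) (dist_nonneg.trans (h i))
  rw [Subtype.dist_eq, dist_pi_le_iff h0]
  intro k
  have hk (i : Fin n) : |y.1 k - (τ i).1 k| ≤ w i := by
    rw [← Real.dist_eq]
    exact (dist_le_pi_dist _ _ k).trans (h i)
  have hc : (comb τ p).1 k = ∑ i, p i * (τ i).1 k := by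
    change (∑ i, p i • (τ i).1) k = _
    simp
  have hy : y.1 k = ∑ i, p i * y.1 k := by rw [← Finset.sum_mul, stdSimplex.sum_eq_one p, one_mul]
  rw [Real.dist_eq, hc, hy, ← Finset.sum_sub_distrib]
  refine (Finset.abs_sum_le_sum_abs _ _).trans (Finset.sum_le_sum fun i _ => ?_)
  rw [← mul_sub, abs_mul, abs_of_nonneg (stdSimplex.zero_le p i)]
  exact mul_le_mul_of_nonneg_left (hk i) (p.2.1 i)

theorem dist_comb_le_of_forall {m n : ℕ} {τ : Fin n → stdSimplex ℝ (Fin m)}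
    {y : stdSimplex ℝ (Fin m)} {r : ℝ} (p : stdSimplex ℝ (Fin n)) (h : ∀ i, dist y (τ i) ≤ r) :
    dist y (comb τ p) ≤ r := by
  refine (dist_comb_le p h).trans_eq ?_
  rw [← Finset.sum_mul, stdSimplex.sum_eq_one p, one_mul]

theorem dist_comb_barycenter_le {m n : ℕ} {τ : Fin (n + 1) → stdSimplex ℝ (Fin m)} {d : ℝ}
    (h : ∀ i j, dist (τ i) (τ j) ≤ d) (j : Fin (n + 1)) :
    dist (τ j) (comb τ stdSimplex.barycenter) ≤ n / (n + 1) * d := by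
  -- The vertex itself contributes nothing to the average of the distances.
  refine (dist_comb_le (w := fun i => if i = j then 0 else d) _ fun i => ?_).trans_eq ?_
  · split_ifs with hij
    · simp [hij]
    · exact h j i
  · have hb (i : Fin (n + 1)) :
        (stdSimplex.barycenter : stdSimplex ℝ (Fin (n + 1))) i = ((n : ℝ) + 1)⁻¹ := by
      change ((Fintype.card (Fin (n + 1)) : ℝ))⁻¹ = _
      simp
    simp only [hb, ← Finset.mul_sum, Finset.sum_ite, Finset.sum_const, Finset.filter_ne']
    simp
    ring

variable (F) in
/-- The chains spanned by tuples with pairwise distances at most `d`. -/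
def meshLE (m n : ℕ) (d : ℝ) : Submodule F (TupleChain F (stdSimplex ℝ (Fin m)) n) :=
  Finsupp.supported F F {τ | ∀ i j, dist (τ i) (τ j) ≤ d}

theorem subdivision_single_mem_meshLE {m n : ℕ} {τ : Fin (n + 1) → stdSimplex ℝ (Fin m)} {d : ℝ}
    (h : ∀ i j, dist (τ i) (τ j) ≤ d) :
    subdivision F (n + 1) (Finsupp.single τ 1) ∈ meshLE F m (n + 1) (n / (n + 1) * d) := by
  have hd : 0 ≤ d := dist_nonneg.trans (h 0 0)
  induction n with
  | zero =>
    rw [subdivision_single]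
    refine Finsupp.map_mem_of_single (s := Set.univ) _ (fun τ' _ => ?_) (by simp)
    rw [tupleCone_single]
    refine Finsupp.single_mem_supported F _ fun i j => ?_
    rw [Subsingleton.elim (α := Fin 1) i j, dist_self]
    positivity
  | succ n ih =>
    -- The points that lie in every closed ball containing the vertices of `τ`.
    let H : Set (stdSimplex ℝ (Fin m)) := {q | ∀ y r, (∀ i, dist y (τ i) ≤ r) → dist y q ≤ r}
    have hH : ∀ k (σ : Fin k → stdSimplex ℝ (Fin m)) p, (∀ i, σ i ∈ H) → comb σ p ∈ H :=
      fun k σ p hσ y r hy => dist_comb_le_of_forall p fun i => hσ i y r hy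
    have hc : ((n : ℝ)) / (n + 1) * d ≤ ((n + 1 : ℕ) : ℝ) / ((n + 1 : ℕ) + 1) * d := by
      refine mul_le_mul_of_nonneg_right ?_ hd
      rw [div_le_div_iff₀ (by positivity) (by positivity)]
      push_cast
      nlinarith
    rw [subdivision_single]
    have key : subdivision F (n + 1) (tupleBoundary F (n + 1) (Finsupp.single τ 1)) ∈
        meshLE F m (n + 1) (n / (n + 1) * d) ⊓ tuplesIn F H (n + 1) := by
      rw [tupleBoundary_single, map_sum]
      refine Submodule.sum_mem _ fun i _ => ?_
      rw [map_smul]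
      refine Submodule.smul_mem _ _ ⟨ih fun i j => h _ _, subdivision_mem hH ?_⟩
      exact single_mem_tuplesIn (fun j y r hy => hy _) 1
    rw [meshLE, tuplesIn, ← Finsupp.supported_inter] at key
    refine Finsupp.map_mem_of_single _ (fun τ' hτ' => ?_) key
    rw [tupleCone_single]
    have hb (j : Fin (n + 1)) : dist (comb τ stdSimplex.barycenter) (τ' j) ≤
        ((n + 1 : ℕ) : ℝ) / ((n + 1 : ℕ) + 1) * d := by
      refine hτ'.2 j _ _ fun i => ?_
      rw [dist_comm]
      exact dist_comb_barycenter_le h i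
    refine Finsupp.single_mem_supported F _ fun i j => ?_
    cases i using Fin.cases with
    | zero =>
      cases j using Fin.cases with
      | zero =>
        rw [dist_self]
        positivity
      | succ j => simpa using hb j
    | succ i =>
      cases j using Fin.cases with
      | zero => simpa [dist_comm] using hb i
      | succ j => simpa using (hτ'.1 i j).trans hc

theorem subdivision_pow_mem_meshLE {m n : ℕ} {d : ℝ}
    {x : TupleChain F (stdSimplex ℝ (Fin m)) (n + 1)} (hx : x ∈ meshLE F m (n + 1) d) (N : ℕ) :
    (subdivision F (n + 1) ^ N) x ∈ meshLE F m (n + 1) ((n / (n + 1)) ^ N * d) := by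
  induction N with
  | zero => simpa using hx
  | succ N ih =>
    rw [pow_succ' (subdivision F (n + 1)), Module.End.mul_apply, pow_succ', mul_assoc]
    exact Finsupp.map_mem_of_single _ (fun τ hτ => subdivision_single_mem_meshLE hτ) ih

end Subdivision

/-! ### Singular chains -/

section SingularChains

open ConvexComb

/-- Singular simplices with `n` vertices, that is, of dimension `n - 1`. For `n = 0` the source is
empty, so there is exactly one of them: singular chains are augmented in this grading. -/
abbrev SingSimplex (E : Type*) [TopologicalSpace E] (n : ℕ) := C(stdSimplex ℝ (Fin n), E)

/-- Singular chains, graded by the number of vertices. -/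
abbrev SingChain (F : Type*) [Field F] (E : Type*) [TopologicalSpace E] (n : ℕ) :=
  SingSimplex E n →₀ F

/-- The inclusion of the `i`-th face of a standard simplex. -/
noncomputable def faceInc {n : ℕ} (i : Fin (n + 1)) :
    C(stdSimplex ℝ (Fin n), stdSimplex ℝ (Fin (n + 1))) :=
  ⟨stdSimplex.map i.succAbove, stdSimplex.continuous_map _⟩

variable (F : Type*) [Field F] {D D' : Type*} [TopologicalSpace D] [ConvexComb D]
  [TopologicalSpace D'] [ConvexComb D'] {E : Type*} [TopologicalSpace E]

/-- The boundary of singular chains. -/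
noncomputable def singBoundary (n : ℕ) : SingChain F E (n + 1) →ₗ[F] SingChain F E n :=
  Finsupp.linearCombination F fun σ =>
    ∑ i : Fin (n + 1), (-1 : F) ^ (i : ℕ) • Finsupp.single (σ.comp (faceInc i)) 1

/-- A tuple in `D` and a map `D → E` give a singular simplex of `E`, by composition with the affine
simplex spanned by the tuple. -/
noncomputable def push (g : C(D, E)) (n : ℕ) : TupleChain F D n →ₗ[F] SingChain F E n :=
  Finsupp.lmapDomain F F fun τ => g.comp (comb τ)

/-- The vertices of the standard simplex, as a tuple chain: the universal simplex. -/
noncomputable def universalSimplex (n : ℕ) : TupleChain F (stdSimplex ℝ (Fin n)) n :=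
  Finsupp.single stdSimplex.vertex 1

variable {F}

theorem singBoundary_single {n : ℕ} (σ : SingSimplex E (n + 1)) :
    singBoundary F n (Finsupp.single σ 1) =
      ∑ i : Fin (n + 1), (-1 : F) ^ (i : ℕ) • Finsupp.single (σ.comp (faceInc i)) 1 := by
  simp [singBoundary]

@[simp]
theorem push_single (g : C(D, E)) {n : ℕ} (τ : Fin n → D) (a : F) :
    push F g n (Finsupp.single τ a) = Finsupp.single (g.comp (comb τ)) a := by
  simp [push]

theorem comb_comp_faceInc {n : ℕ} (τ : Fin (n + 1) → D) (i : Fin (n + 1)) :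
    (comb τ).comp (faceInc i) = comb fun j => τ (i.succAbove j) :=
  ContinuousMap.ext fun p => comb_map τ _ p

theorem singBoundary_push (g : C(D, E)) {n : ℕ} (x : TupleChain F D (n + 1)) :
    singBoundary F n (push F g (n + 1) x) = push F g n (tupleBoundary F n x) := by
  suffices h : singBoundary F n ∘ₗ push F g (n + 1) = push F g n ∘ₗ tupleBoundary F n from
    LinearMap.congr_fun h x
  refine Finsupp.lhom_ext_one fun τ => ?_
  simp [singBoundary_single, ContinuousMap.comp_assoc, comb_comp_faceInc]

theorem comb_vertex {n : ℕ} :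
    comb (stdSimplex.vertex (S := ℝ)) = ContinuousMap.id (stdSimplex ℝ (Fin n)) := by
  ext p k
  change (∑ i, p i • (Pi.single i 1 : Fin n → ℝ)) k = p k
  simp [Pi.single_apply]

@[simp]
theorem push_universalSimplex {n : ℕ} (σ : SingSimplex E n) :
    push F σ n (universalSimplex F n) = Finsupp.single σ 1 := by
  rw [universalSimplex, push_single, comb_vertex, ContinuousMap.comp_id]

theorem singBoundary_singBoundary {n : ℕ} (x : SingChain F E (n + 2)) :
    singBoundary F n (singBoundary F (n + 1) x) = 0 := by
  suffices h : singBoundary F n ∘ₗ singBoundary F (n + 1) =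
      (0 : SingChain F E (n + 2) →ₗ[F] _) from LinearMap.congr_fun h x
  refine Finsupp.lhom_ext_one fun σ => ?_
  rw [← push_universalSimplex, LinearMap.comp_apply, singBoundary_push, singBoundary_push,
    tupleBoundary_tupleBoundary, map_zero, LinearMap.zero_apply]

theorem push_tupleMap (g : C(D', E)) (γ : C(D, D'))
    (hγ : ∀ n (τ : Fin n → D) p, γ (comb τ p) = comb (γ ∘ τ) p) {n : ℕ} (x : TupleChain F D n) :
    push F g n (tupleMap F γ n x) = push F (g.comp γ) n x := by
  suffices h : push F g n ∘ₗ tupleMap F γ n = push F (g.comp γ) n from LinearMap.congr_fun h x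
  refine Finsupp.lhom_ext_one fun τ => ?_
  rw [LinearMap.comp_apply, tupleMap_single, push_single, push_single]
  congr 1
  ext p
  exact congrArg g (hγ n τ p).symm

theorem faceInc_comb {m : ℕ} (i : Fin (m + 1)) (n : ℕ) (τ : Fin n → stdSimplex ℝ (Fin m))
    (p : stdSimplex ℝ (Fin n)) : faceInc i (comb τ p) = comb (faceInc i ∘ τ) p := by
  apply Subtype.ext
  change FunOnFinite.linearMap ℝ ℝ i.succAbove (∑ j, p j • (τ j).1) =
    ∑ j, p j • FunOnFinite.linearMap ℝ ℝ i.succAbove (τ j).1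
  simp

theorem tupleMap_faceInc_universalSimplex {n : ℕ} (i : Fin (n + 1)) :
    tupleMap F (faceInc i) n (universalSimplex F n) =
      Finsupp.single (fun j => stdSimplex.vertex (i.succAbove j)) 1 := by
  rw [universalSimplex, tupleMap_single]
  congr 1
  funext j
  exact stdSimplex.map_vertex _ _

theorem tupleBoundary_universalSimplex (n : ℕ) :
    tupleBoundary F n (universalSimplex F (n + 1)) = ∑ i : Fin (n + 1), (-1 : F) ^ (i : ℕ) •
      Finsupp.single (fun j => stdSimplex.vertex (i.succAbove j)) 1 :=
  tupleBoundary_single _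

/-- The singular chains whose simplices have images with a given property. -/
def chainsWith (F : Type*) [Field F] (Q : Set E → Prop) (n : ℕ) : Submodule F (SingChain F E n) :=
  Finsupp.supported F F {σ | Q (Set.range σ)}

variable {Q : Set E → Prop}

theorem single_mem_chainsWith {n : ℕ} {σ : SingSimplex E n} (h : Q (Set.range σ)) (a : F) :
    Finsupp.single σ a ∈ chainsWith F Q n :=
  Finsupp.single_mem_supported F a h

theorem push_mem_chainsWith (hQ : ∀ s t, s ⊆ t → Q t → Q s) {g : C(D, E)} (hg : Q (Set.range g))
    {n : ℕ} (x : TupleChain F D n) : push F g n x ∈ chainsWith F Q n := by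
  refine Finsupp.map_mem_of_single (s := Set.univ) _ (fun τ _ => ?_) (by simp)
  rw [push_single]
  exact single_mem_chainsWith (hQ _ _ (Set.range_comp_subset_range (comb τ) g) hg) 1

theorem singBoundary_mem (hQ : ∀ s t, s ⊆ t → Q t → Q s) {n : ℕ} {x : SingChain F E (n + 1)}
    (hx : x ∈ chainsWith F Q (n + 1)) : singBoundary F n x ∈ chainsWith F Q n := by
  refine Finsupp.map_mem_of_single _ (fun σ hσ => ?_) hx
  rw [← push_universalSimplex, singBoundary_push]
  exact push_mem_chainsWith hQ hσ _

/-! ### Subdivision of singular chains -/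

variable (F) in
/-- The `N`-fold barycentric subdivision of singular chains. -/
noncomputable def singSubdivision (N n : ℕ) : SingChain F E n →ₗ[F] SingChain F E n :=
  Finsupp.linearCombination F fun σ => push F σ n ((subdivision F n ^ N) (universalSimplex F n))

variable (F) in
/-- The homotopy between tuple chains and their `N`-fold subdivision. -/
noncomputable def subdivisionHomotopy (N n : ℕ) : TupleChain F D n →ₗ[F] TupleChain F D (n + 1) :=
  coneHomotopy (fun _ => LinearMap.id) (fun n => subdivision F n ^ N) id n

variable (F) in
/-- The homotopy between singular chains and their `N`-fold subdivision. -/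
noncomputable def singSubdivisionHomotopy (N n : ℕ) :
    SingChain F E n →ₗ[F] SingChain F E (n + 1) :=
  Finsupp.linearCombination F fun σ =>
    push F σ (n + 1) (subdivisionHomotopy F N n (universalSimplex F n))

theorem singSubdivision_single (N : ℕ) {n : ℕ} (σ : SingSimplex E n) :
    singSubdivision F N n (Finsupp.single σ 1) =
      push F σ n ((subdivision F n ^ N) (universalSimplex F n)) := by
  simp [singSubdivision]

theorem singSubdivisionHomotopy_single (N : ℕ) {n : ℕ} (σ : SingSimplex E n) :
    singSubdivisionHomotopy F N n (Finsupp.single σ 1) =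
      push F σ (n + 1) (subdivisionHomotopy F N n (universalSimplex F n)) := by
  simp [singSubdivisionHomotopy]

theorem singBoundary_singSubdivision (N : ℕ) {n : ℕ} (x : SingChain F E (n + 1)) :
    singBoundary F n (singSubdivision F N (n + 1) x) =
      singSubdivision F N n (singBoundary F n x) := by
  suffices h : singBoundary F n ∘ₗ singSubdivision F N (n + 1) =
      (singSubdivision F N n ∘ₗ singBoundary F n : SingChain F E (n + 1) →ₗ[F] _) from
    LinearMap.congr_fun h x
  refine Finsupp.lhom_ext_one fun σ => ?_
  simp only [LinearMap.comp_apply, singSubdivision_single, singBoundary_single, map_sum, map_smul,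
    singBoundary_push, tupleBoundary_subdivision_pow]
  simp only [← push_tupleMap σ (faceInc _) (faceInc_comb _),
    tupleMap_subdivision_pow _ (faceInc_comb _), tupleMap_faceInc_universalSimplex,
    tupleBoundary_universalSimplex, map_sum, map_smul]

theorem singSubdivisionHomotopy_spec (N : ℕ) {n : ℕ} (x : SingChain F E (n + 1)) :
    singBoundary F (n + 1) (singSubdivisionHomotopy F N (n + 1) x) +
      singSubdivisionHomotopy F N n (singBoundary F n x) = x - singSubdivision F N (n + 1) x := by
  suffices h : singBoundary F (n + 1) ∘ₗ singSubdivisionHomotopy F N (n + 1) +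
      singSubdivisionHomotopy F N n ∘ₗ singBoundary F n =
      (LinearMap.id - singSubdivision F N (n + 1) : SingChain F E (n + 1) →ₗ[F] _) from
    LinearMap.congr_fun h x
  refine Finsupp.lhom_ext_one fun σ => ?_
  have h1 := tupleBoundary_coneHomotopy (a := id) (α := fun _ => LinearMap.id)
    (β := fun n => subdivision F n ^ N) (subdivision_pow_zero N).symm (fun _ _ => rfl)
    (fun n x => tupleBoundary_subdivision_pow N x) (universalSimplex F (n + 1))
  have h2 (m : ℕ) (i : Fin (m + 1)) (y) := tupleMap_coneHomotopy (a := id) (a' := id) (n := m)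
    (α := fun _ => LinearMap.id) (β := fun n => subdivision F n ^ N) (α' := fun _ => LinearMap.id)
    (β' := fun n => subdivision F n ^ N) (faceInc i) (faceInc i) (fun _ => rfl) (fun _ _ => rfl)
    (fun n x => tupleMap_subdivision_pow _ (faceInc_comb i) N x) y
  have h3 := congrArg (push F σ (n + 1)) h1
  simp only [map_add, map_sub, LinearMap.id_apply, push_universalSimplex] at h3
  simp only [LinearMap.add_apply, LinearMap.sub_apply, LinearMap.id_apply, LinearMap.comp_apply,
    singSubdivision_single, ← h3, singSubdivisionHomotopy_single, singBoundary_push]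
  congr 1
  simp only [singBoundary_single, map_sum, map_smul, singSubdivisionHomotopy_single]
  simp only [← push_tupleMap σ (faceInc _) (faceInc_comb _), subdivisionHomotopy, h2,
    tupleMap_faceInc_universalSimplex, tupleBoundary_universalSimplex, map_sum, map_smul]

theorem singSubdivision_mem (hQ : ∀ s t, s ⊆ t → Q t → Q s) (N : ℕ) {n : ℕ} {x : SingChain F E n}
    (hx : x ∈ chainsWith F Q n) : singSubdivision F N n x ∈ chainsWith F Q n := by
  refine Finsupp.map_mem_of_single _ (fun σ hσ => ?_) hx
  rw [singSubdivision_single]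
  exact push_mem_chainsWith hQ hσ _

theorem singSubdivisionHomotopy_mem (hQ : ∀ s t, s ⊆ t → Q t → Q s) (N : ℕ) {n : ℕ}
    {x : SingChain F E n} (hx : x ∈ chainsWith F Q n) :
    singSubdivisionHomotopy F N n x ∈ chainsWith F Q (n + 1) := by
  refine Finsupp.map_mem_of_single _ (fun σ hσ => ?_) hx
  rw [singSubdivisionHomotopy_single]
  exact push_mem_chainsWith hQ hσ _

/-- Every singular chain consists of small simplices after sufficiently many subdivisions. -/
theorem eventually_singSubdivision_small {E : Type*} [PseudoMetricSpace E] {ε : ℝ} (hε : 0 < ε)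
    {n : ℕ} (x : SingChain F E n) :
    ∀ᶠ N in Filter.atTop, singSubdivision F N n x ∈
      chainsWith F (fun s : Set E => ∀ y ∈ s, ∀ z ∈ s, dist y z < ε) n := by
  induction x using Finsupp.induction_linear with
  | zero => simp
  | add x y hx hy =>
    filter_upwards [hx, hy] with N h1 h2
    rw [map_add]
    exact Submodule.add_mem _ h1 h2
  | single σ a =>
    rw [← mul_one a, ← smul_eq_mul, ← Finsupp.smul_single]
    simp only [map_smul, singSubdivision_single]
    suffices h : ∀ᶠ N in Filter.atTop, push F σ n ((subdivision F n ^ N) (universalSimplex F n)) ∈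
        chainsWith F (fun s : Set E => ∀ y ∈ s, ∀ z ∈ s, dist y z < ε) n from
      h.mono fun N h => Submodule.smul_mem _ _ h
    cases n with
    | zero =>
      refine Filter.Eventually.of_forall fun N => push_mem_chainsWith ?_ ?_ _
      · exact fun s t hst h y hy z hz => h y (hst hy) z (hst hz)
      · rintro _ ⟨p, rfl⟩
        exact absurd p.2.2 (by simp)
    | succ n =>
      obtain ⟨δ, hδ, hσ⟩ := Metric.uniformContinuous_iff.mp
        (CompactSpace.uniformContinuous_of_continuous σ.continuous) ε hε
      have hlim : Filter.Tendsto (fun N : ℕ => ((n : ℝ) / (n + 1)) ^ N * 1) Filter.atTop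
          (nhds (0 * 1)) := by
        refine (tendsto_pow_atTop_nhds_zero_of_lt_one (by positivity) ?_).mul_const 1
        rw [div_lt_one (by positivity)]
        exact lt_add_one _
      rw [zero_mul] at hlim
      filter_upwards [hlim.eventually_lt_const hδ] with N hN
      have hu : universalSimplex F (n + 1) ∈ meshLE F (n + 1) (n + 1) 1 := by
        refine Finsupp.single_mem_supported F _ fun i j => ?_
        exact (Metric.dist_le_diam_of_mem (bounded_stdSimplex (Fin (n + 1)))
          (single_mem_stdSimplex ℝ i) (single_mem_stdSimplex ℝ j)).trans diam_stdSimplex_le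
      refine Finsupp.map_mem_of_single _ (fun τ hτ => ?_) (subdivision_pow_mem_meshLE hu N)
      rw [push_single]
      refine single_mem_chainsWith ?_ 1
      rintro _ ⟨p, rfl⟩ _ ⟨q, rfl⟩
      refine hσ ((dist_comb_le_of_forall q fun j => ?_).trans_lt hN)
      rw [dist_comm]
      refine dist_comb_le_of_forall p fun i => ?_
      exact hτ j i

end SingularChains

/-! ### Straight-line homotopies -/

section Prism

open ConvexComb

variable (F : Type*) [Field F] {E : Type*} [AddCommGroup E] [Module ℝ E] [TopologicalSpace E]
  [ContinuousAdd E] [ContinuousSMul ℝ E]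

/-- The straight-line homotopy between two singular simplices of a vector space. -/
noncomputable def straightLine {n : ℕ} (σ τ : SingSimplex E n) :
    C(stdSimplex ℝ (Fin n) × unitInterval, E) where
  toFun q := (1 - q.2.1) • σ q.1 + q.2.1 • τ q.1
  continuous_toFun := by fun_prop

variable {F} in
theorem push_straightLine_zero {n : ℕ} (σ τ : SingSimplex E n) :
    push F (straightLine σ τ) n (tupleMap F (fun p => (p, 0)) n (universalSimplex F n)) =
      Finsupp.single σ 1 := by
  have h := push_tupleMap (F := F) (straightLine σ τ)
    ((ContinuousMap.id _).prodMk (.const (stdSimplex ℝ (Fin n)) (0 : unitInterval))) ?_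
    (universalSimplex F n)
  · refine h.trans ((push_universalSimplex _).trans ?_)
    congr 1
    ext p
    simp [straightLine]
  · intro m υ p
    refine Prod.ext rfl (Subtype.ext ?_)
    change (0 : ℝ) = ∑ i, p i • (0 : ℝ)
    simp

variable {F} in
theorem push_straightLine_one {n : ℕ} (σ τ : SingSimplex E n) :
    push F (straightLine σ τ) n (tupleMap F (fun p => (p, 1)) n (universalSimplex F n)) =
      Finsupp.single τ 1 := by
  have h := push_tupleMap (F := F) (straightLine σ τ)
    ((ContinuousMap.id _).prodMk (.const (stdSimplex ℝ (Fin n)) (1 : unitInterval))) ?_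
    (universalSimplex F n)
  · refine h.trans ((push_universalSimplex _).trans ?_)
    congr 1
    ext p
    simp [straightLine]
  · intro m υ p
    refine Prod.ext rfl (Subtype.ext ?_)
    change (1 : ℝ) = ∑ i, p i • (1 : ℝ)
    simp [stdSimplex.sum_eq_one p]

/-- The prism over tuples in `D`, as a chain in `D × [0, 1]`. -/
noncomputable def tuplePrism (D : Type*) (n : ℕ) :
    TupleChain F D n →ₗ[F] TupleChain F (D × unitInterval) (n + 1) :=
  coneHomotopy (fun n => tupleMap F (fun p => (p, 0)) n) (fun n => tupleMap F (fun p => (p, 1)) n)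
    (fun p => (p, 0)) n

/-- The chain of the straight-line homotopy between two singular simplices. -/
noncomputable def prism {n : ℕ} (σ τ : SingSimplex E n) : SingChain F E (n + 1) :=
  push F (straightLine σ τ) (n + 1) (tuplePrism F _ n (universalSimplex F n))

variable {F}

theorem tupleMap_tuplePrism {D D' : Type*} (γ : D → D') {n : ℕ} (x : TupleChain F D n) :
    tupleMap F (Prod.map γ id) (n + 1) (tuplePrism F D n x) =
      tuplePrism F D' n (tupleMap F γ n x) := by
  refine tupleMap_coneHomotopy γ (Prod.map γ id) (fun _ => rfl) (fun n x => ?_) (fun n x => ?_) x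
  all_goals
    rw [← LinearMap.comp_apply, ← LinearMap.comp_apply]
    congr 1
    exact Finsupp.lhom_ext_one fun τ => by simp [Function.comp_def]

theorem straightLine_comp_faceInc {n : ℕ} (σ τ : SingSimplex E (n + 1)) (i : Fin (n + 1)) :
    straightLine (σ.comp (faceInc i)) (τ.comp (faceInc i)) =
      (straightLine σ τ).comp ((faceInc i).prodMap (ContinuousMap.id _)) := rfl

theorem singBoundary_prism {n : ℕ} (σ τ : SingSimplex E (n + 1)) :
    singBoundary F (n + 1) (prism F σ τ) + ∑ i : Fin (n + 1), (-1 : F) ^ (i : ℕ) •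
      prism F (σ.comp (faceInc i)) (τ.comp (faceInc i)) =
      Finsupp.single σ 1 - Finsupp.single τ 1 := by
  have h1 := tupleBoundary_coneHomotopy (D := stdSimplex ℝ (Fin (n + 1)))
    (a := fun p => (p, (0 : unitInterval)))
    (α := fun n => tupleMap F (fun p => (p, 0)) n) (β := fun n => tupleMap F (fun p => (p, 1)) n)
    (Finsupp.lhom_ext_one fun τ => by
      simp only [tupleMap_single]
      congr 1
      exact Subsingleton.elim _ _)
    (fun n x => (tupleMap_boundary _ x).symm) (fun n x => (tupleMap_boundary _ x).symm)
    (universalSimplex F (n + 1))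
  have h3 := congrArg (push F (straightLine σ τ) (n + 1)) h1
  rw [map_add, map_sub, push_straightLine_zero, push_straightLine_one] at h3
  rw [← h3, prism, singBoundary_push]
  congr 1
  have h4 (i : Fin (n + 1)) : prism F (σ.comp (faceInc i)) (τ.comp (faceInc i)) =
      push F (straightLine σ τ) (n + 1) (tuplePrism F _ n
        (Finsupp.single (fun j => stdSimplex.vertex (i.succAbove j)) 1)) := by
    rw [prism, straightLine_comp_faceInc, ← push_tupleMap, ← tupleMap_faceInc_universalSimplex,
      ← tupleMap_tuplePrism]
    · rfl
    · intro m υ p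
      exact Prod.ext (faceInc_comb i m _ p) rfl
  rw [tupleBoundary_universalSimplex]
  simp only [h4, map_sum, map_smul]
  rfl

theorem prism_mem {Q : Set E → Prop} (hQ : ∀ s t, s ⊆ t → Q t → Q s) {n : ℕ} {σ τ : SingSimplex E n}
    (h : Q (⋃ p, segment ℝ (σ p) (τ p))) : prism F σ τ ∈ chainsWith F Q (n + 1) := by
  refine push_mem_chainsWith hQ (hQ _ _ ?_ h) _
  rintro _ ⟨⟨p, t⟩, rfl⟩
  exact Set.mem_iUnion.mpr ⟨p, 1 - t.1, t.1, sub_nonneg.mpr t.2.2, t.2.1, by simp, rfl⟩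

open Classical in
variable (F) in
/-- The chain homotopy made up of the prisms between `σ` and `ρ σ`, for the simplices `σ` in `P`;
on other simplices it is zero. -/
noncomputable def prismHomotopy (P : ∀ n, Set (SingSimplex E n))
    (ρ : ∀ n, SingSimplex E n → SingSimplex E n) (n : ℕ) :
    SingChain F E n →ₗ[F] SingChain F E (n + 1) :=
  Finsupp.linearCombination F fun σ => if σ ∈ P n then prism F σ (ρ n σ) else 0

variable {P : ∀ n, Set (SingSimplex E n)} {ρ : ∀ n, SingSimplex E n → SingSimplex E n}

theorem prismHomotopy_single {n : ℕ} {σ : SingSimplex E n} (h : σ ∈ P n) :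
    prismHomotopy F P ρ n (Finsupp.single σ 1) = prism F σ (ρ n σ) := by
  simp [prismHomotopy, h]

theorem prismHomotopy_single_of_notMem {n : ℕ} {σ : SingSimplex E n} (h : σ ∉ P n) :
    prismHomotopy F P ρ n (Finsupp.single σ 1) = 0 := by
  simp [prismHomotopy, h]

theorem prismHomotopy_spec (hP : ∀ n, ∀ σ ∈ P (n + 1), ∀ i, σ.comp (faceInc i) ∈ P n)
    (hρ : ∀ n, ∀ σ ∈ P (n + 1), ∀ i, ρ n (σ.comp (faceInc i)) = (ρ (n + 1) σ).comp (faceInc i))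
    {n : ℕ} {x : SingChain F E (n + 1)} (hx : x ∈ Finsupp.supported F F (P (n + 1))) :
    singBoundary F (n + 1) (prismHomotopy F P ρ (n + 1) x) +
      prismHomotopy F P ρ n (singBoundary F n x) = x - Finsupp.lmapDomain F F (ρ (n + 1)) x := by
  have h := Finsupp.map_mem_of_single (singBoundary F (n + 1) ∘ₗ prismHomotopy F P ρ (n + 1) +
    prismHomotopy F P ρ n ∘ₗ singBoundary F n - LinearMap.id + Finsupp.lmapDomain F F (ρ (n + 1)))
    (N := ⊥) (fun σ hσ => ?_) hx
  · rw [Submodule.mem_bot] at h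
    rw [← sub_eq_zero, ← sub_add]
    exact h
  · have h1 := singBoundary_prism (F := F) σ (ρ (n + 1) σ)
    rw [Submodule.mem_bot]
    simp only [LinearMap.add_apply, LinearMap.sub_apply, LinearMap.comp_apply, LinearMap.id_apply,
      prismHomotopy_single hσ, singBoundary_single, map_sum, map_smul,
      prismHomotopy_single (hP n σ hσ _), hρ n σ hσ, h1]
    simp

end Prism

/-! ### Oriented simplicial chains -/

section OrientedChains

variable (F : Type*) [Field F] {V : Type*} [LinearOrder V]

/-- The position sign of the vertex `x` relative to `s`: the parity of the number of vertices of
`s` before `x`. -/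
def positionSign (x : V) (s : Finset V) : F := (-1) ^ (s.filter (· < x)).card

/-- The boundary of oriented simplicial chains on the full simplex with vertex set `V`; the
simplices are oriented by the order of `V`, and chains of all degrees are taken together. -/
noncomputable def faceBoundary : (Finset V →₀ F) →ₗ[F] (Finset V →₀ F) :=
  Finsupp.linearCombination F fun s => ∑ x ∈ s, positionSign F x s • Finsupp.single (s.erase x) 1

/-- The cone operator with apex `x`. -/
noncomputable def wedge (x : V) : (Finset V →₀ F) →ₗ[F] (Finset V →₀ F) :=
  Finsupp.linearCombination F fun s =>
    if x ∈ s then 0 else positionSign F x s • Finsupp.single (insert x s) 1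

variable {F}

theorem positionSign_mul_self (x : V) (s : Finset V) :
    positionSign F x s * positionSign F x s = 1 := by
  rw [positionSign, ← mul_pow]
  simp

theorem positionSign_ne_zero (x : V) (s : Finset V) : positionSign F x s ≠ 0 :=
  pow_ne_zero _ (neg_ne_zero.mpr one_ne_zero)

theorem positionSign_insert_self (x : V) (s : Finset V) :
    positionSign F x (insert x s) = positionSign F x s := by
  simp [positionSign, Finset.filter_insert]

theorem positionSign_erase_self (x : V) (s : Finset V) :
    positionSign F x (s.erase x) = positionSign F x s := by
  simp [positionSign, Finset.filter_erase]

theorem positionSign_insert_of_lt {x y : V} (h : y < x) {s : Finset V} (hy : y ∉ s) :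
    positionSign F x (insert y s) = -positionSign F x s := by
  rw [positionSign, Finset.filter_insert, if_pos h, Finset.card_insert_of_notMem (by simp [hy]),
    pow_succ, mul_neg_one, positionSign]

theorem positionSign_insert_of_not_lt {x y : V} (h : ¬y < x) (s : Finset V) :
    positionSign F x (insert y s) = positionSign F x s := by
  rw [positionSign, Finset.filter_insert, if_neg h, positionSign]

theorem positionSign_mul_insert {x y : V} {s : Finset V} (hx : x ∉ s) (hy : y ∈ s) :
    positionSign F x s * positionSign F y (insert x s) =
      -(positionSign F y s * positionSign F x (s.erase y)) := by
  have hs : positionSign F x s = positionSign F x (insert y (s.erase y)) := by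
    rw [Finset.insert_erase hy]
  have hxy : x ≠ y := fun h => hx (h ▸ hy)
  rcases lt_or_gt_of_ne hxy with h | h
  · rw [positionSign_insert_of_lt h hx, hs, positionSign_insert_of_not_lt h.asymm]
    ring
  · rw [positionSign_insert_of_not_lt h.asymm, hs, positionSign_insert_of_lt h (by simp)]
    ring

theorem faceBoundary_single (s : Finset V) : faceBoundary F (Finsupp.single s 1) =
    ∑ x ∈ s, positionSign F x s • Finsupp.single (s.erase x) 1 := by
  simp [faceBoundary]

theorem wedge_single_of_mem {x : V} {s : Finset V} (h : x ∈ s) :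
    wedge F x (Finsupp.single s 1) = 0 := by
  simp [wedge, h]

theorem wedge_single_of_notMem {x : V} {s : Finset V} (h : x ∉ s) :
    wedge F x (Finsupp.single s 1) = positionSign F x s • Finsupp.single (insert x s) 1 := by
  simp [wedge, h]

theorem faceBoundary_wedge (x : V) (c : Finset V →₀ F) :
    faceBoundary F (wedge F x c) = c - wedge F x (faceBoundary F c) := by
  suffices h : faceBoundary F ∘ₗ wedge F x = LinearMap.id - wedge F x ∘ₗ faceBoundary F from
    LinearMap.congr_fun h c
  refine Finsupp.lhom_ext_one fun s => ?_
  rw [LinearMap.comp_apply, LinearMap.sub_apply, LinearMap.comp_apply, LinearMap.id_apply,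
    faceBoundary_single, map_sum]
  simp only [map_smul]
  by_cases hx : x ∈ s
  · rw [wedge_single_of_mem hx, map_zero, Finset.sum_eq_single_of_mem x hx,
      wedge_single_of_notMem (Finset.notMem_erase x s), smul_smul, positionSign_erase_self,
      positionSign_mul_self, Finset.insert_erase hx, one_smul, sub_self]
    intro y _ hy
    rw [wedge_single_of_mem (Finset.mem_erase.mpr ⟨hy.symm, hx⟩), smul_zero]
  · rw [wedge_single_of_notMem hx, map_smul, faceBoundary_single, Finset.sum_insert hx, smul_add,
      smul_smul, positionSign_insert_self, positionSign_mul_self, one_smul,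
      Finset.erase_insert hx, sub_eq_add_neg, ← Finset.sum_neg_distrib, Finset.smul_sum]
    congr 1
    refine Finset.sum_congr rfl fun y hy => ?_
    have hxy : y ≠ x := fun h => hx (h ▸ hy)
    rw [wedge_single_of_notMem fun h => hx (Finset.mem_of_mem_erase h), smul_smul, smul_smul,
      positionSign_mul_insert hx hy, Finset.erase_insert_of_ne hxy.symm, neg_smul]

variable (F) in
/-- The chains supported on simplices with a given property. -/
def facesWith (Q : Finset V → Prop) : Submodule F (Finset V →₀ F) :=
  Finsupp.supported F F {s | Q s}

theorem single_mem_facesWith {V : Type*} {Q : Finset V → Prop} {s : Finset V} (h : Q s) (a : F) :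
    Finsupp.single s a ∈ facesWith F Q :=
  Finsupp.single_mem_supported F a h

theorem faceBoundary_mem {Q Q' : Finset V → Prop} (h : ∀ s, Q s → ∀ x ∈ s, Q' (s.erase x))
    {c : Finset V →₀ F} (hc : c ∈ facesWith F Q) : faceBoundary F c ∈ facesWith F Q' := by
  refine Finsupp.map_mem_of_single _ (fun s hs => ?_) hc
  rw [faceBoundary_single]
  exact Submodule.sum_mem _ fun x hx =>
    Submodule.smul_mem _ _ (single_mem_facesWith (h s hs x hx) 1)

theorem wedge_mem {Q Q' : Finset V → Prop} {x : V} (h : ∀ s, Q s → x ∉ s → Q' (insert x s))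
    {c : Finset V →₀ F} (hc : c ∈ facesWith F Q) : wedge F x c ∈ facesWith F Q' := by
  refine Finsupp.map_mem_of_single _ (fun s hs => ?_) hc
  by_cases hx : x ∈ s
  · rw [wedge_single_of_mem hx]
    exact Submodule.zero_mem _
  · rw [wedge_single_of_notMem hx]
    exact Submodule.smul_mem _ _ (single_mem_facesWith (h s hs hx) 1)

/-! ### Comparison of ordered and oriented chains -/

variable (F) in
/-- The oriented simplex of a tuple; it is zero if the tuple has repetitions. -/
noncomputable def orientedSimplex : ∀ n, (Fin n → V) → (Finset V →₀ F)
  | 0, _ => Finsupp.single ∅ 1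
  | n + 1, τ => wedge F (τ 0) (orientedSimplex n (Fin.tail τ))

variable (F) in
/-- The projection of ordered to oriented chains. -/
noncomputable def orient (n : ℕ) : TupleChain F V n →ₗ[F] (Finset V →₀ F) :=
  Finsupp.linearCombination F (orientedSimplex F n)

theorem orient_cone (b : V) {n : ℕ} (x : TupleChain F V n) :
    orient F (n + 1) (tupleCone F b n x) = wedge F b (orient F n x) := by
  suffices h : orient F (n + 1) ∘ₗ tupleCone F b n = wedge F b ∘ₗ orient F n from
    LinearMap.congr_fun h x
  exact Finsupp.lhom_ext_one fun τ => by simp [orient, orientedSimplex]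

theorem faceBoundary_orient {n : ℕ} (x : TupleChain F V (n + 1)) :
    faceBoundary F (orient F (n + 1) x) = orient F n (tupleBoundary F n x) := by
  suffices h : faceBoundary F ∘ₗ orient F (n + 1) =
      (orient F n ∘ₗ tupleBoundary F n : TupleChain F V (n + 1) →ₗ[F] _) from
    LinearMap.congr_fun h x
  clear x
  induction n with
  | zero =>
    refine Finsupp.lhom_ext_one fun τ => ?_
    rw [← Fin.cons_self_tail τ, ← tupleCone_single, LinearMap.comp_apply, LinearMap.comp_apply,
      orient_cone, tupleBoundary_cone_zero, faceBoundary_wedge]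
    simp [orient, orientedSimplex, faceBoundary_single]
  | succ n ih =>
    refine Finsupp.lhom_ext_one fun τ => ?_
    have key := LinearMap.congr_fun ih (Finsupp.single (Fin.tail τ) 1)
    simp only [LinearMap.comp_apply] at key
    rw [← Fin.cons_self_tail τ, ← tupleCone_single, LinearMap.comp_apply, LinearMap.comp_apply,
      orient_cone, tupleBoundary_cone, faceBoundary_wedge, key, map_sub, orient_cone]

theorem orient_mem {s : Set V} {n : ℕ} {x : TupleChain F V n} (hx : x ∈ tuplesIn F s n) :
    orient F n x ∈ facesWith F fun t : Finset V => ↑t ⊆ s ∧ t.card = n := by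
  induction n with
  | zero =>
    refine Finsupp.map_mem_of_single _ (fun τ _ => ?_) hx
    simpa [orient, orientedSimplex] using single_mem_facesWith (by simp) 1
  | succ n ih =>
    refine Finsupp.map_mem_of_single _ (fun τ hτ => ?_) hx
    rw [← Fin.cons_self_tail τ, ← tupleCone_single, orient_cone]
    refine wedge_mem (fun t ht h0 => ⟨?_, ?_⟩) (ih (single_mem_tuplesIn (fun i => hτ i.succ) 1))
    · rw [Finset.coe_insert]
      exact Set.insert_subset (hτ 0) ht.1
    · rw [Finset.card_insert_of_notMem h0, ht.2]

variable (F) in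
/-- The increasing enumeration of the vertices of a simplex with `n` elements, as an ordered chain;
it is zero on simplices with another number of elements. -/
noncomputable def orderedSimplex : ∀ n, Finset V → TupleChain F V n
  | 0, s => if s = ∅ then Finsupp.single Fin.elim0 1 else 0
  | n + 1, s => if h : s.Nonempty then
      tupleCone F (s.min' h) n (orderedSimplex n (s.erase (s.min' h))) else 0

variable (F) in
/-- The inclusion of oriented chains into ordered chains. -/
noncomputable def enumerate (n : ℕ) : (Finset V →₀ F) →ₗ[F] TupleChain F V n :=
  Finsupp.linearCombination F (orderedSimplex F n)

theorem enumerate_single (n : ℕ) (s : Finset V) :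
    enumerate F n (Finsupp.single s 1) = orderedSimplex F n s := by
  simp [enumerate]

theorem enumerate_wedge {m : V} {n : ℕ} {c : Finset V →₀ F}
    (hc : c ∈ facesWith F fun t => ∀ y ∈ t, m < y) :
    enumerate F (n + 1) (wedge F m c) = tupleCone F m n (enumerate F n c) := by
  have h := Finsupp.map_mem_of_single (enumerate F (n + 1) ∘ₗ wedge F m -
    tupleCone F m n ∘ₗ enumerate F n) (N := ⊥) (fun t ht => ?_) hc
  · exact sub_eq_zero.mp h
  · replace ht : ∀ y ∈ t, m < y := ht
    have hm : m ∉ t := fun h => (ht m h).false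
    have hmin : (insert m t).min' (Finset.insert_nonempty m t) = m :=
      le_antisymm (Finset.min'_le _ _ (Finset.mem_insert_self _ _))
        (Finset.le_min' _ _ _ fun y hy => by
          rcases Finset.mem_insert.mp hy with rfl | hy
          exacts [le_rfl, (ht y hy).le])
    have hs : positionSign F m t = 1 := by
      rw [positionSign, Finset.filter_eq_empty_iff.mpr fun y hy => (ht y hy).asymm]
      simp
    rw [Submodule.mem_bot, LinearMap.sub_apply, LinearMap.comp_apply, LinearMap.comp_apply,
      wedge_single_of_notMem hm, hs, one_smul, enumerate_single, enumerate_single, orderedSimplex,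
      dif_pos (Finset.insert_nonempty m t), hmin, Finset.erase_insert hm, sub_self]

/-- A simplex is the cone over its face opposite to the first vertex. -/
theorem wedge_min_single {s : Finset V} (h : s.Nonempty) :
    wedge F (s.min' h) (Finsupp.single (s.erase (s.min' h)) 1) = Finsupp.single s 1 := by
  rw [wedge_single_of_notMem (Finset.notMem_erase _ _), Finset.insert_erase (s.min'_mem h),
    positionSign, Finset.filter_eq_empty_iff.mpr]
  · simp
  · exact fun y hy => (s.min'_le y (Finset.mem_of_mem_erase hy)).not_gt

theorem single_erase_min_mem {s : Finset V} (h : s.Nonempty) :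
    Finsupp.single (s.erase (s.min' h)) 1 ∈ facesWith F fun t => ∀ y ∈ t, s.min' h < y :=
  single_mem_facesWith (fun _ hy => Finset.min'_lt_of_mem_erase_min' s h hy) 1

theorem tupleBoundary_enumerate {n : ℕ} (c : Finset V →₀ F) :
    tupleBoundary F n (enumerate F (n + 1) c) = enumerate F n (faceBoundary F c) := by
  suffices h : tupleBoundary F n ∘ₗ enumerate F (n + 1) =
      (enumerate F n ∘ₗ faceBoundary F : (Finset V →₀ F) →ₗ[F] _) from LinearMap.congr_fun h c
  clear c
  induction n with
  | zero =>
    refine Finsupp.lhom_ext_one fun s => ?_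
    rcases s.eq_empty_or_nonempty with rfl | hs
    · simp [enumerate_single, orderedSimplex, faceBoundary_single]
    · rw [LinearMap.comp_apply, LinearMap.comp_apply, ← wedge_min_single hs,
        enumerate_wedge (single_erase_min_mem hs), tupleBoundary_cone_zero, faceBoundary_wedge,
        map_sub]
      have h0 (c : Finset V →₀ F) : enumerate F 0 (wedge F (s.min' hs) c) = 0 := by
        suffices h : enumerate F 0 ∘ₗ wedge F (s.min' hs) = 0 from LinearMap.congr_fun h c
        refine Finsupp.lhom_ext_one fun t => ?_
        by_cases ht : s.min' hs ∈ t
        · rw [LinearMap.comp_apply, wedge_single_of_mem ht, map_zero, LinearMap.zero_apply]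
        · rw [LinearMap.comp_apply, wedge_single_of_notMem ht, map_smul, enumerate_single,
            orderedSimplex, if_neg (Finset.insert_ne_empty _ _), smul_zero, LinearMap.zero_apply]
      rw [h0, sub_zero]
  | succ n ih =>
    refine Finsupp.lhom_ext_one fun s => ?_
    rcases s.eq_empty_or_nonempty with rfl | hs
    · simp [enumerate_single, orderedSimplex, faceBoundary_single]
    · have key := LinearMap.congr_fun ih (Finsupp.single (s.erase (s.min' hs)) 1)
      simp only [LinearMap.comp_apply] at key
      have hm : faceBoundary F (Finsupp.single (s.erase (s.min' hs)) 1) ∈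
          facesWith F fun t => ∀ y ∈ t, s.min' hs < y :=
        faceBoundary_mem (fun t ht x _ y hy => ht y (Finset.mem_of_mem_erase hy))
          (single_erase_min_mem hs)
      rw [LinearMap.comp_apply, LinearMap.comp_apply, ← wedge_min_single hs,
        enumerate_wedge (single_erase_min_mem hs), tupleBoundary_cone, faceBoundary_wedge,
        map_sub, key, enumerate_wedge hm]

theorem enumerate_mem {s : Set V} {n : ℕ} {c : Finset V →₀ F}
    (hc : c ∈ facesWith F fun t : Finset V => ↑t ⊆ s) : enumerate F n c ∈ tuplesIn F s n := by
  induction n generalizing c with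
  | zero =>
    refine Finsupp.map_mem_of_single _ (fun t _ => ?_) hc
    rw [enumerate_single, orderedSimplex]
    split_ifs
    exacts [single_mem_tuplesIn (fun i => i.elim0) 1, Submodule.zero_mem _]
  | succ n ih =>
    refine Finsupp.map_mem_of_single _ (fun t ht => ?_) hc
    replace ht : ↑t ⊆ s := ht
    rw [enumerate_single, orderedSimplex]
    split_ifs with h
    · refine tupleCone_mem (ht (t.min'_mem h)) ?_
      rw [← enumerate_single]
      refine ih (single_mem_facesWith ?_ 1)
      exact fun y hy => ht (Finset.mem_of_mem_erase hy)
    · exact Submodule.zero_mem _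

theorem orient_enumerate {n : ℕ} {c : Finset V →₀ F}
    (hc : c ∈ facesWith F fun t : Finset V => t.card = n) :
    orient F n (enumerate F n c) = c := by
  have h := Finsupp.map_mem_of_single (orient F n ∘ₗ enumerate F n - LinearMap.id) (N := ⊥)
    (fun t ht => ?_) hc
  · exact sub_eq_zero.mp h
  · clear hc c
    replace ht : t.card = n := ht
    rw [Submodule.mem_bot, LinearMap.sub_apply, sub_eq_zero, LinearMap.comp_apply,
      LinearMap.id_apply]
    induction n generalizing t with
    | zero =>
      rw [Finset.card_eq_zero] at ht
      subst ht
      simp [enumerate_single, orderedSimplex, orient, orientedSimplex]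
    | succ n ih =>
      have hs : t.Nonempty := Finset.card_pos.mp (by omega)
      rw [← wedge_min_single hs, enumerate_wedge (single_erase_min_mem hs), orient_cone,
        ih _ (by rw [Finset.card_erase_of_mem (t.min'_mem hs), ht, Nat.add_sub_cancel])]

end OrientedChains

/-! ### Relative homology in terms of chains -/

section RelHomology

variable {F : Type*} [Field F] {M M' : ℕ → Type*} [∀ n, AddCommGroup (M n)] [∀ n, Module F (M n)]
  [∀ n, AddCommGroup (M' n)] [∀ n, Module F (M' n)]

/-- The relative cycles of a pair of graded submodules `A ≤ X` of a complex. -/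
def relCycles (d : ∀ n, M (n + 1) →ₗ[F] M n) (X A : ∀ n, Submodule F (M n)) (n : ℕ) :
    Submodule F (M (n + 1)) := X (n + 1) ⊓ (A n).comap (d n)

/-- The relative boundaries of a pair of graded submodules `A ≤ X` of a complex. -/
def relBoundaries (d : ∀ n, M (n + 1) →ₗ[F] M n) (X A : ∀ n, Submodule F (M n)) (n : ℕ) :
    Submodule F (M (n + 1)) := (X (n + 2)).map (d (n + 1)) ⊔ A (n + 1)

/-- The relative homology of a pair of graded submodules `A ≤ X` of a complex graded by the number
of vertices: its index `n` is the dimension, so chains with `n + 1` vertices are involved. -/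
abbrev RelHomology (d : ∀ n, M (n + 1) →ₗ[F] M n) (X A : ∀ n, Submodule F (M n)) (n : ℕ) :=
  relCycles d X A n ⧸ (relBoundaries d X A n).submoduleOf (relCycles d X A n)

variable {d : ∀ n, M (n + 1) →ₗ[F] M n} {X A : ∀ n, Submodule F (M n)}
  {d' : ∀ n, M' (n + 1) →ₗ[F] M' n} {X' A' : ∀ n, Submodule F (M' n)}

theorem mem_relBoundaries {n : ℕ} {x : M (n + 1)} :
    x ∈ relBoundaries d X A n ↔ ∃ y ∈ X (n + 2), x - d (n + 1) y ∈ A (n + 1) := by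
  rw [relBoundaries, Submodule.mem_sup]
  constructor
  · rintro ⟨_, ⟨y, hy, rfl⟩, a, ha, rfl⟩
    exact ⟨y, hy, by simpa using ha⟩
  · rintro ⟨y, hy, h⟩
    exact ⟨_, ⟨y, hy, rfl⟩, _, h, by simp⟩

/-- A chain map that is bijective on relative homology classes induces an isomorphism. -/
theorem nonempty_relHomology_equiv (f : ∀ n, M' n →ₗ[F] M n) {n : ℕ}
    (hf : ∀ x ∈ relCycles d' X' A' n, f (n + 1) x ∈ relCycles d X A n)
    (hinj : ∀ x ∈ relCycles d' X' A' n,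
      f (n + 1) x ∈ relBoundaries d X A n ↔ x ∈ relBoundaries d' X' A' n)
    (hsurj : ∀ z ∈ relCycles d X A n, ∃ x ∈ relCycles d' X' A' n,
      z - f (n + 1) x ∈ relBoundaries d X A n) :
    Nonempty (RelHomology d' X' A' n ≃ₗ[F] RelHomology d X A n) := by
  let g : relCycles d' X' A' n →ₗ[F] RelHomology d X A n :=
    Submodule.mkQ _ ∘ₗ (f (n + 1)).restrict hf
  have hg : LinearMap.ker g = (relBoundaries d' X' A' n).submoduleOf (relCycles d' X' A' n) := by
    ext x
    change _ ↔ x.1 ∈ relBoundaries d' X' A' n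
    rw [LinearMap.mem_ker, ← hinj x x.2, LinearMap.comp_apply, Submodule.mkQ_apply,
      Submodule.Quotient.mk_eq_zero]
    rfl
  have hs : Function.Surjective g := by
    intro q
    obtain ⟨z, rfl⟩ := Submodule.mkQ_surjective _ q
    obtain ⟨x, hx, h⟩ := hsurj z z.2
    refine ⟨⟨x, hx⟩, ?_⟩
    rw [LinearMap.comp_apply, Submodule.mkQ_apply, Submodule.mkQ_apply, eq_comm,
      Submodule.Quotient.eq]
    exact h
  exact ⟨(Submodule.quotEquivOfEq _ _ hg.symm).trans (g.quotKerEquivOfSurjective hs)⟩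

end RelHomology

/-! ### Sublevel sets of simplexwise linear functions -/

section Sublevel

set_option linter.unusedSectionVars false

variable {V : Type} [Fintype V] [LinearOrder V]

/-- The linear function on `ℝ^V` with value `a u` at the basis vector `e_u`. -/
def height (a : V → ℝ) (x : V → ℝ) : ℝ := ∑ u, x u * a u

/-- The points of the realization that are not higher than the vertex `v`. -/
def sublevel (K : AbstractSimplicialComplex V) (a : V → ℝ) (v : V) : Set (V → ℝ) :=
  {x | x ∈ K.realization ∧ height a x ≤ a v}

/-- The sublevel set without the vertex `v` itself. -/
def puncturedSublevel (K : AbstractSimplicialComplex V) (a : V → ℝ) (v : V) : Set (V → ℝ) :=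
  {x | x ∈ sublevel K a v ∧ x ≠ Pi.single v 1}

/-- The part of the sublevel set outside the open star of `v`. -/
def starComplement (K : AbstractSimplicialComplex V) (a : V → ℝ) (v : V) : Set (V → ℝ) :=
  {x | x ∈ sublevel K a v ∧ x v = 0}

/-- The (possibly empty) simplices whose vertices are not higher than `v`. -/
def IsLowFace (K : AbstractSimplicialComplex V) (a : V → ℝ) (v : V) (t : Finset V) : Prop :=
  (t.Nonempty → t ∈ K.faces) ∧ ∀ u ∈ t, a u ≤ a v

variable {K : AbstractSimplicialComplex V} {a : V → ℝ} {v : V} {x y : V → ℝ}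

theorem height_combo (α β : ℝ) (x y : V → ℝ) :
    height a (α • x + β • y) = α * height a x + β * height a y := by
  simp only [height, Finset.mul_sum, ← Finset.sum_add_distrib]
  exact Finset.sum_congr rfl fun u _ => by simp; ring

theorem height_single (v : V) : height a (Pi.single v 1) = a v := by
  simp [height, Pi.single_apply]

theorem mem_realization_iff :
    x ∈ K.realization ↔ x ∈ stdSimplex ℝ V ∧ ∃ s ∈ K.faces, ∀ u, u ∉ s → x u = 0 := by
  simp only [AbstractSimplicialComplex.realization, geomSimplex, Set.mem_iUnion, Set.mem_ofPred_eq]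
  constructor
  · rintro ⟨s, hs, hx, h⟩
    exact ⟨hx, s, hs, h⟩
  · rintro ⟨hx, s, hs, h⟩
    exact ⟨s, hs, hx, h⟩

theorem mem_realization_of_support (hx : x ∈ K.realization) (hy : y ∈ stdSimplex ℝ V)
    (h : ∀ u, x u = 0 → y u = 0) : y ∈ K.realization := by
  obtain ⟨_, s, hs, hxs⟩ := mem_realization_iff.mp hx
  exact mem_realization_iff.mpr ⟨hy, s, hs, fun u hu => h u (hxs u hu)⟩

theorem mem_faces_of_ne_zero (hx : x ∈ K.realization) {t : Finset V} (ht : t.Nonempty)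
    (h : ∀ u ∈ t, x u ≠ 0) : t ∈ K.faces := by
  obtain ⟨_, s, hs, hxs⟩ := mem_realization_iff.mp hx
  refine (K.isRelLowerSet_faces hs).2 (fun u hu => ?_) ht
  by_contra hus
  exact h u hu (hxs u hus)

theorem segment_subset_sublevel (hx : x ∈ sublevel K a v) (hy : y ∈ stdSimplex ℝ V)
    (h : ∀ u, x u = 0 → y u = 0) (hh : height a y ≤ a v) : segment ℝ x y ⊆ sublevel K a v := by
  rintro _ ⟨α, β, hα, hβ, hαβ, rfl⟩
  refine ⟨mem_realization_of_support hx.1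
    (convex_stdSimplex ℝ V (mem_realization_iff.mp hx.1).1 hy hα hβ hαβ) fun u hu => ?_, ?_⟩
  · simp [hu, h u hu]
  · rw [height_combo]
    calc α * height a x + β * height a y ≤ α * a v + β * a v :=
          add_le_add (mul_le_mul_of_nonneg_left hx.2 hα) (mul_le_mul_of_nonneg_left hh hβ)
      _ = a v := by rw [← add_mul, hαβ, one_mul]

theorem segment_subset_starComplement (hx : x ∈ starComplement K a v) (hy : y ∈ stdSimplex ℝ V)
    (h : ∀ u, x u = 0 → y u = 0) (hh : height a y ≤ a v) :
    segment ℝ x y ⊆ starComplement K a v := by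
  refine fun z hz => ⟨segment_subset_sublevel hx.1 hy h hh hz, ?_⟩
  obtain ⟨α, β, _, _, _, rfl⟩ := hz
  simp [hx.2, h v hx.2]

theorem eq_single_of_eq_one (hx : x ∈ stdSimplex ℝ V) (h : x v = 1) : x = Pi.single v 1 := by
  have h0 : ∑ u ∈ Finset.univ.erase v, x u = 0 := by
    have := Finset.add_sum_erase Finset.univ x (Finset.mem_univ v)
    rw [hx.2, h] at this
    linarith
  funext u
  by_cases hu : u = v
  · rw [hu, h, Pi.single_eq_same]
  · rw [Pi.single_eq_of_ne hu]
    exact (Finset.sum_eq_zero_iff_of_nonneg fun w _ => hx.1 w).mp h0 u (by simp [hu])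

theorem starComplement_subset_puncturedSublevel :
    starComplement K a v ⊆ puncturedSublevel K a v := by
  rintro x ⟨hx, h0⟩
  refine ⟨hx, ?_⟩
  rintro rfl
  simp at h0

theorem apply_ne_one_of_mem_puncturedSublevel (hx : x ∈ puncturedSublevel K a v) : x v ≠ 1 :=
  fun h => hx.2 (eq_single_of_eq_one (mem_realization_iff.mp hx.1.1).1 h)

/-- The radial projection from the vertex `v` to the opposite faces. -/
noncomputable def radialProjection (v : V) (x : V → ℝ) : V → ℝ :=
  (1 - x v)⁻¹ • (x - x v • Pi.single v 1)

theorem radialProjection_apply_self : radialProjection v x v = 0 := by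
  simp [radialProjection]

theorem radialProjection_apply_of_ne {u : V} (hu : u ≠ v) :
    radialProjection v x u = (1 - x v)⁻¹ * x u := by
  simp [radialProjection, Pi.single_eq_of_ne hu]

theorem radialProjection_mem_stdSimplex (hx : x ∈ stdSimplex ℝ V) (h : x v ≠ 1) :
    radialProjection v x ∈ stdSimplex ℝ V := by
  have h1 : 0 ≤ 1 - x v := sub_nonneg.mpr (mem_Icc_of_mem_stdSimplex hx v).2
  refine ⟨fun u => ?_, ?_⟩
  · by_cases hu : u = v
    · rw [hu, radialProjection_apply_self]
    · rw [radialProjection_apply_of_ne hu]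
      exact mul_nonneg (inv_nonneg.mpr h1) (hx.1 u)
  · have : ∑ u, radialProjection v x u = (1 - x v)⁻¹ * (∑ u, x u - x v) := by
      simp [radialProjection, ← Finset.mul_sum, Finset.sum_sub_distrib, Pi.single_apply]
    rw [this, hx.2, inv_mul_cancel₀ (sub_ne_zero.mpr h.symm)]

theorem radialProjection_eq_zero {u : V} (hu : x u = 0) : radialProjection v x u = 0 := by
  by_cases h : u = v
  · rw [h, radialProjection_apply_self]
  · rw [radialProjection_apply_of_ne h, hu, mul_zero]

theorem height_radialProjection_le (hx : x ∈ stdSimplex ℝ V) (h : x v ≠ 1)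
    (hh : height a x ≤ a v) : height a (radialProjection v x) ≤ a v := by
  have h1 : 0 < 1 - x v :=
    lt_of_le_of_ne (sub_nonneg.mpr (mem_Icc_of_mem_stdSimplex hx v).2) (sub_ne_zero.mpr h.symm).symm
  have h2 : height a (radialProjection v x) = (1 - x v)⁻¹ * (height a x - x v * a v) := by
    have : radialProjection v x =
        (1 - x v)⁻¹ • x + (-((1 - x v)⁻¹ * x v)) • Pi.single v 1 := by
      rw [radialProjection, smul_sub, smul_smul, neg_smul, sub_eq_add_neg]
    rw [this, height_combo, height_single]
    ring
  rw [h2, inv_mul_le_iff₀ h1]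
  linarith

theorem radialProjection_mem_starComplement (hx : x ∈ puncturedSublevel K a v) :
    radialProjection v x ∈ starComplement K a v := by
  have h1 := apply_ne_one_of_mem_puncturedSublevel hx
  have h2 := (mem_realization_iff.mp hx.1.1).1
  exact ⟨⟨mem_realization_of_support hx.1.1 (radialProjection_mem_stdSimplex h2 h1)
    fun _ => radialProjection_eq_zero, height_radialProjection_le h2 h1 hx.1.2⟩,
    radialProjection_apply_self⟩

theorem segment_radialProjection_subset (hx : x ∈ puncturedSublevel K a v) :
    segment ℝ x (radialProjection v x) ⊆ puncturedSublevel K a v := by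
  have h1 := apply_ne_one_of_mem_puncturedSublevel hx
  have h2 := (mem_realization_iff.mp hx.1.1).1
  intro z hz
  refine ⟨segment_subset_sublevel hx.1 (radialProjection_mem_stdSimplex h2 h1)
    (fun _ => radialProjection_eq_zero) (height_radialProjection_le h2 h1 hx.1.2) hz, ?_⟩
  obtain ⟨α, β, hα, hβ, hαβ, rfl⟩ := hz
  intro h
  have h3 : α * x v = 1 := by simpa [radialProjection_apply_self] using congrFun h v
  have h4 := mem_Icc_of_mem_stdSimplex h2 v
  refine h1 (le_antisymm h4.2 ?_)
  rw [← h3]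
  exact mul_le_of_le_one_left h4.1 (by linarith)

theorem isCompact_sublevel : IsCompact (sublevel K a v) := by
  have hK : IsCompact K.realization := by
    refine (Set.toFinite K.faces).isCompact_biUnion fun s _ => ?_
    have : geomSimplex s = stdSimplex ℝ V ∩ ⋂ u, ⋂ (_ : u ∉ s), {x | x u = 0} := by
      ext
      simp [geomSimplex]
    rw [this]
    refine (isCompact_stdSimplex ℝ V).inter_right (isClosed_iInter fun u => isClosed_iInter
      fun _ => isClosed_eq (continuous_apply u) continuous_const)
  have hc : IsClosed {x : V → ℝ | height a x ≤ a v} :=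
    isClosed_le (by unfold height; fun_prop) continuous_const
  exact hK.inter_right hc

/-- On a sufficiently small scale, near every point of the sublevel set some low vertex has
positive barycentric coordinate. -/
theorem exists_lowVertex_near (K : AbstractSimplicialComplex V) (a : V → ℝ) (v : V) :
    ∃ δ > 0, ∃ w : (V → ℝ) → V, ∀ x ∈ sublevel K a v,
      a (w x) ≤ a v ∧ ∀ y, dist y x < δ → 0 < y (w x) := by
  have hcover : sublevel K a v ⊆ ⋃ u : {u : V // a u ≤ a v}, {y : V → ℝ | 0 < y u.1} := by
    intro x hx
    -- If all vertices in the support of `x` were higher than `v`, then so would be `x`.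
    by_contra hcon
    simp only [Set.mem_iUnion, Set.mem_ofPred_eq, Subtype.exists, not_exists, not_lt] at hcon
    have hs := (mem_realization_iff.mp hx.1).1
    have h0 : ∀ u, a u ≤ a v → x u = 0 := fun u hu => le_antisymm (hcon u hu) (hs.1 u)
    have h1 : ∀ u, x u * a v ≤ x u * a u := fun u => by
      rcases le_or_gt (a u) (a v) with hu | hu
      · rw [h0 u hu, zero_mul, zero_mul]
      · exact mul_le_mul_of_nonneg_left hu.le (hs.1 u)
    have h2 : ∃ u, x u * a v < x u * a u := by
      by_contra hall
      push Not at hall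
      have : ∀ u, x u = 0 := fun u => by
        rcases le_or_gt (a u) (a v) with hu | hu
        · exact h0 u hu
        · by_contra hne
          have := mul_lt_mul_of_pos_left hu (lt_of_le_of_ne (hs.1 u) (Ne.symm hne))
          exact (hall u).not_gt this
      have h3 := hs.2
      simp [this] at h3
    obtain ⟨u, hu⟩ := h2
    have h4 : ∑ u, x u * a v < ∑ u, x u * a u :=
      Finset.sum_lt_sum (fun u _ => h1 u) ⟨u, Finset.mem_univ u, hu⟩
    rw [← Finset.sum_mul, hs.2, one_mul] at h4
    exact (hx.2.trans_lt h4).false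
  obtain ⟨δ, hδ, h⟩ := lebesgue_number_lemma_of_metric isCompact_sublevel
    (fun u => isOpen_lt continuous_const (continuous_apply _)) hcover
  have h' : ∀ x, ∃ u, x ∈ sublevel K a v → a u ≤ a v ∧ ∀ y, dist y x < δ → 0 < y u := by
    intro x
    by_cases hx : x ∈ sublevel K a v
    · obtain ⟨u, hu⟩ := h x hx
      exact ⟨u.1, fun _ => ⟨u.2, fun y hy => hu hy⟩⟩
    · exact ⟨v, fun hx' => absurd hx' hx⟩
  choose w hw using h'
  exact ⟨δ, hδ, w, hw⟩

end Sublevel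

/-! ### Comparison of singular and simplicial relative homology -/

section AbstractComparison

variable {F : Type*} [Field F] {M M' : ℕ → Type*} [∀ n, AddCommGroup (M n)] [∀ n, Module F (M n)]
  [∀ n, AddCommGroup (M' n)] [∀ n, Module F (M' n)]
  {d : ∀ n, M (n + 1) →ₗ[F] M n} {d' : ∀ n, M' (n + 1) →ₗ[F] M' n}

/-- If `A` deforms into `B ≤ A` by a homotopy `G` that maps all chains to chains in `A`, then the
pairs `(X, A)` and `(X, B)` have the same relative homology. -/
theorem nonempty_relHomology_equiv_of_deformation {X A B : ∀ n, Submodule F (M n)}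
    (hd : ∀ n x, d n (d (n + 1) x) = 0) (hAX : ∀ n, A n ≤ X n) (hBA : ∀ n, B n ≤ A n)
    (h0 : A 0 ≤ B 0) (hX : ∀ n, ∀ x ∈ X (n + 1), d n x ∈ X n) (hA : ∀ n, ∀ x ∈ A (n + 1), d n x ∈ A n)
    (G : ∀ n, M n →ₗ[F] M (n + 1)) (hGA : ∀ n x, G n x ∈ A (n + 1))
    (hGB : ∀ n, ∀ x ∈ B n, G n x ∈ B (n + 1))
    (hG : ∀ n, ∀ x ∈ A (n + 1), x - (d (n + 1) (G (n + 1) x) + G n (d n x)) ∈ B (n + 1)) (n : ℕ) :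
    Nonempty (RelHomology d X B n ≃ₗ[F] RelHomology d X A n) := by
  refine nonempty_relHomology_equiv (fun n => LinearMap.id) (fun x hx => ⟨hx.1, hBA n hx.2⟩)
    (fun x hx => ⟨fun h => ?_, fun h => ?_⟩) (fun z hz => ?_)
  · obtain ⟨y, hy, h⟩ := mem_relBoundaries.mp h
    rw [LinearMap.id_apply] at h
    refine mem_relBoundaries.mpr ⟨y + G (n + 1) (x - d (n + 1) y),
      Submodule.add_mem _ hy (hAX _ (hGA _ _)), ?_⟩
    have h1 := hG n _ h
    have h2 := hGB n _ hx.2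
    convert! Submodule.add_mem _ h1 h2 using 1
    simp only [map_add, map_sub, hd, map_zero]
    abel
  · obtain ⟨y, hy, h⟩ := mem_relBoundaries.mp h
    exact mem_relBoundaries.mpr ⟨y, hy, hBA _ h⟩
  · have hzA : d n z ∈ A n := hz.2
    refine ⟨z - (d (n + 1) (G (n + 1) z) + G n (d n z)), ⟨?_, ?_⟩, ?_⟩
    · exact Submodule.sub_mem _ hz.1 (Submodule.add_mem _ (hX _ _ (hAX _ (hGA _ _)))
        (hAX _ (hGA _ _)))
    · change d n (z - _) ∈ B n
      rw [map_sub, map_add, hd, zero_add]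
      cases n with
      | zero => exact h0 (Submodule.sub_mem _ hzA (hA _ _ (hGA _ _)))
      | succ n =>
        have h1 := hG n _ hzA
        rwa [hd, map_zero, add_zero] at h1
    · refine mem_relBoundaries.mpr ⟨G (n + 1) z, hAX _ (hGA _ _), ?_⟩
      rw [LinearMap.id_apply, sub_sub_cancel, add_sub_cancel_left]
      exact hGA _ _

/-- Let `Φ` and `Ψ` be chain maps such that `Ψ ∘ Φ` is homotopic to the identity as far as small
chains are concerned, and `Φ ∘ Sd^N ∘ Ψ` is homotopic to the identity. If subdivision makes chains
small and is homotopic to the identity, then `Ψ` is an isomorphism on relative homology. -/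
theorem nonempty_relHomology_equiv_of_small {X A SX SA : ∀ n, Submodule F (M n)}
    {X' A' : ∀ n, Submodule F (M' n)}
    (Ψ : ∀ n, M' n →ₗ[F] M n) (Φ : ∀ n, M n →ₗ[F] M' n)
    (Sd : ℕ → ∀ n, M n →ₗ[F] M n) (T : ℕ → ∀ n, M n →ₗ[F] M (n + 1)) (H : ∀ n, M n →ₗ[F] M (n + 1))
    (H' : ℕ → ∀ n, M' n →ₗ[F] M' (n + 1))
    (hΨ : ∀ n x, d n (Ψ (n + 1) x) = Ψ n (d' n x)) (hΦ : ∀ n x, d' n (Φ (n + 1) x) = Φ n (d n x))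
    (hSd : ∀ N n x, d n (Sd N (n + 1) x) = Sd N n (d n x))
    (hT : ∀ N n x, d (n + 1) (T N (n + 1) x) + T N n (d n x) = x - Sd N (n + 1) x)
    (hH : ∀ n x, d (n + 1) (H (n + 1) x) + H n (d n x) = x - Ψ (n + 1) (Φ (n + 1) x))
    (hH' : ∀ N n, ∀ x ∈ X' (n + 1), d' (n + 1) (H' N (n + 1) x) + H' N n (d' n x) =
      x - Φ (n + 1) (Sd N (n + 1) (Ψ (n + 1) x)))
    (hΨX : ∀ n, ∀ x ∈ X' n, Ψ n x ∈ X n) (hΨA : ∀ n, ∀ x ∈ A' n, Ψ n x ∈ A n)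
    (hΦX : ∀ n, ∀ x ∈ SX n, Φ n x ∈ X' n) (hΦA : ∀ n, ∀ x ∈ SA n, Φ n x ∈ A' n)
    (hTX : ∀ N n, ∀ x ∈ X n, T N n x ∈ X (n + 1)) (hTA : ∀ N n, ∀ x ∈ A n, T N n x ∈ A (n + 1))
    (hHX : ∀ n, ∀ x ∈ SX n, H n x ∈ X (n + 1)) (hHA : ∀ n, ∀ x ∈ SA n, H n x ∈ A (n + 1))
    (hHX' : ∀ N n, ∀ x ∈ X' n, H' N n x ∈ X' (n + 1))
    (hHA' : ∀ N n, ∀ x ∈ A' n, H' N n x ∈ A' (n + 1))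
    (hsX : ∀ n, ∀ x ∈ X n, ∀ᶠ N in Filter.atTop, Sd N n x ∈ SX n)
    (hsA : ∀ n, ∀ x ∈ A n, ∀ᶠ N in Filter.atTop, Sd N n x ∈ SA n) (n : ℕ) :
    Nonempty (RelHomology d' X' A' n ≃ₗ[F] RelHomology d X A n) := by
  refine nonempty_relHomology_equiv Ψ (fun x hx => ⟨hΨX _ _ hx.1, ?_⟩)
    (fun x hx => ⟨fun h => ?_, fun h => ?_⟩) (fun z hz => ?_)
  · change d n _ ∈ A n
    rw [hΨ]
    exact hΨA _ _ hx.2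
  · obtain ⟨y, hy, h⟩ := mem_relBoundaries.mp h
    obtain ⟨N, h1, h2⟩ := ((hsX _ _ hy).and (hsA _ _ h)).exists
    refine mem_relBoundaries.mpr ⟨Φ _ (Sd N _ y) + H' N _ x,
      Submodule.add_mem _ (hΦX _ _ h1) (hHX' _ _ _ hx.1), ?_⟩
    convert! Submodule.add_mem _ (hΦA _ _ h2) (hHA' N _ _ hx.2) using 1
    rw [map_add, hΦ, hSd, map_sub, map_sub]
    have := hH' N n x hx.1
    rw [eq_sub_iff_add_eq] at this
    nth_rw 1 [← this]
    abel
  · obtain ⟨y, hy, h⟩ := mem_relBoundaries.mp h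
    refine mem_relBoundaries.mpr ⟨Ψ _ y, hΨX _ _ hy, ?_⟩
    rw [hΨ, ← map_sub]
    exact hΨA _ _ h
  · obtain ⟨N, h1, h2⟩ := ((hsX _ _ hz.1).and (hsA _ _ hz.2)).exists
    refine ⟨Φ _ (Sd N _ z), ⟨hΦX _ _ h1, ?_⟩, ?_⟩
    · change d' n _ ∈ A' n
      rw [hΦ, hSd]
      exact hΦA _ _ h2
    · refine mem_relBoundaries.mpr ⟨T N _ z + H _ (Sd N _ z),
        Submodule.add_mem _ (hTX _ _ _ hz.1) (hHX _ _ h1), ?_⟩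
      convert! Submodule.add_mem _ (hTA N _ _ hz.2) (hHA _ _ h2) using 1
      have e1 := hT N n z
      have e2 := hH n (Sd N _ z)
      rw [hSd] at e2
      rw [map_add, ← sub_add_sub_cancel z (Sd N (n + 1) z), ← e1, ← e2]
      abel

end AbstractComparison

section Comparison

set_option linter.unusedSectionVars false

open ConvexComb

variable (F : Type*) [Field F] {V : Type} [Fintype V] [LinearOrder V]

noncomputable instance : ConvexComb (V → ℝ) where
  comb τ :=
    { toFun p := ∑ i, p i • τ i
      continuous_toFun := stdSimplex.continuous_sum_smul _ }
  comb_map τ g p := stdSimplex.sum_map_smul g p τ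

/-- The affine singular simplices with given vertices. -/
noncomputable def realizeTuple (n : ℕ) : TupleChain F V n →ₗ[F] SingChain F (V → ℝ) n :=
  push F (ContinuousMap.id _) n ∘ₗ tupleMap F (fun u => Pi.single u 1) n

/-- Simplicial approximation: the tuple of the labels of the vertices of a singular simplex. -/
noncomputable def labelVertices (w : (V → ℝ) → V) (n : ℕ) :
    SingChain F (V → ℝ) n →ₗ[F] TupleChain F V n :=
  Finsupp.lmapDomain F F fun σ i => w (σ (stdSimplex.vertex i))

/-- The affine simplex that approximates a singular simplex. -/
noncomputable def approximate (w : (V → ℝ) → V) (n : ℕ) (σ : SingSimplex (V → ℝ) n) :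
    SingSimplex (V → ℝ) n :=
  comb fun i => (Pi.single (w (σ (stdSimplex.vertex i))) 1 : V → ℝ)

variable {F}

theorem realizeTuple_single {n : ℕ} (τ : Fin n → V) :
    realizeTuple F n (Finsupp.single τ 1) =
      Finsupp.single (comb fun i => (Pi.single (τ i) 1 : V → ℝ)) 1 := by
  simp [realizeTuple, Function.comp_def]

theorem singBoundary_realizeTuple {n : ℕ} (x : TupleChain F V (n + 1)) :
    singBoundary F n (realizeTuple F (n + 1) x) = realizeTuple F n (tupleBoundary F n x) := by
  simp only [realizeTuple, LinearMap.comp_apply, singBoundary_push, tupleMap_boundary]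

theorem labelVertices_single (w : (V → ℝ) → V) {n : ℕ} (σ : SingSimplex (V → ℝ) n) :
    labelVertices F w n (Finsupp.single σ 1) =
      Finsupp.single (fun i => w (σ (stdSimplex.vertex i))) 1 := by
  simp [labelVertices]

theorem tupleBoundary_labelVertices (w : (V → ℝ) → V) {n : ℕ} (x : SingChain F (V → ℝ) (n + 1)) :
    tupleBoundary F n (labelVertices F w (n + 1) x) =
      labelVertices F w n (singBoundary F n x) := by
  suffices h : tupleBoundary F n ∘ₗ labelVertices F w (n + 1) =
      labelVertices F w n ∘ₗ singBoundary F n from LinearMap.congr_fun h x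
  refine Finsupp.lhom_ext_one fun σ => ?_
  simp only [LinearMap.comp_apply, labelVertices_single, tupleBoundary_single, singBoundary_single,
    map_sum, map_smul]
  refine Finset.sum_congr rfl fun i _ => ?_
  congr 2
  funext j
  exact congrArg (fun p => w (σ p)) (stdSimplex.map_vertex _ _).symm

theorem approximate_comp_faceInc (w : (V → ℝ) → V) {n : ℕ} (σ : SingSimplex (V → ℝ) (n + 1))
    (i : Fin (n + 1)) :
    approximate w n (σ.comp (faceInc i)) = (approximate w (n + 1) σ).comp (faceInc i) := by
  rw [approximate, approximate, comb_comp_faceInc]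
  congr 1
  funext j
  congr 2
  exact congrArg σ (stdSimplex.map_vertex _ _)

theorem lmapDomain_approximate (w : (V → ℝ) → V) {n : ℕ} (x : SingChain F (V → ℝ) n) :
    Finsupp.lmapDomain F F (approximate w n) x = realizeTuple F n (labelVertices F w n x) := by
  suffices h : Finsupp.lmapDomain F F (approximate w n) =
      realizeTuple F n ∘ₗ labelVertices F w n from LinearMap.congr_fun h x
  refine Finsupp.lhom_ext_one fun σ => ?_
  rw [LinearMap.comp_apply, labelVertices_single, realizeTuple_single]
  simp [approximate]

variable {K : AbstractSimplicialComplex V} {a : V → ℝ} {v : V}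

theorem comb_single_apply {n : ℕ} (τ : Fin n → V) (p : stdSimplex ℝ (Fin n)) (u : V) :
    comb (fun i => (Pi.single (τ i) 1 : V → ℝ)) p u = ∑ i, p i * (Pi.single (τ i) 1 : V → ℝ) u := by
  change (∑ i, p i • (Pi.single (τ i) 1 : V → ℝ)) u = _
  simp

theorem comb_single_mem_stdSimplex {n : ℕ} (τ : Fin n → V) (p : stdSimplex ℝ (Fin n)) :
    comb (fun i => (Pi.single (τ i) 1 : V → ℝ)) p ∈ stdSimplex ℝ V :=
  (convex_stdSimplex ℝ V).sum_mem (fun i _ => p.2.1 i) p.2.2 fun _ _ => single_mem_stdSimplex ℝ _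

theorem comb_single_eq_zero {n : ℕ} {τ : Fin n → V} {u : V} (h : ∀ i, τ i ≠ u)
    (p : stdSimplex ℝ (Fin n)) : comb (fun i => (Pi.single (τ i) 1 : V → ℝ)) p u = 0 := by
  rw [comb_single_apply]
  exact Finset.sum_eq_zero fun i _ => by rw [Pi.single_eq_of_ne (h i).symm, mul_zero]

theorem height_comb_single_le {n : ℕ} {τ : Fin n → V} (h : ∀ i, a (τ i) ≤ a v)
    (p : stdSimplex ℝ (Fin n)) :
    height a (comb (fun i => (Pi.single (τ i) 1 : V → ℝ)) p) ≤ a v := by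
  have : height a (comb (fun i => (Pi.single (τ i) 1 : V → ℝ)) p) = ∑ i, p i * a (τ i) := by
    simp only [height, comb_single_apply, Finset.sum_mul]
    rw [Finset.sum_comm]
    refine Finset.sum_congr rfl fun i _ => ?_
    simp [Pi.single_apply]
  rw [this]
  calc ∑ i, p i * a (τ i) ≤ ∑ i, p i * a v :=
        Finset.sum_le_sum fun i _ => mul_le_mul_of_nonneg_left (h i) (p.2.1 i)
    _ = a v := by rw [← Finset.sum_mul, stdSimplex.sum_eq_one p, one_mul]

/-- The part of the sublevel set in the closed simplex on `s`. -/
def sublevelOn (K : AbstractSimplicialComplex V) (a : V → ℝ) (v : V) (s : Finset V) :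
    Set (V → ℝ) :=
  {x | x ∈ sublevel K a v ∧ ∀ u, u ∉ s → x u = 0}

theorem realizeTuple_mem {s : Finset V} (hs : IsLowFace K a v s) {n : ℕ} {x : TupleChain F V n}
    (hx : x ∈ tuplesIn F ↑s n) :
    realizeTuple F n x ∈ chainsWith F (fun B => B ⊆ sublevelOn K a v s) n := by
  refine Finsupp.map_mem_of_single _ (fun τ hτ => ?_) hx
  rw [realizeTuple_single]
  refine single_mem_chainsWith ?_ 1
  rintro _ ⟨p, rfl⟩
  have h0 : ∀ u, u ∉ s → comb (fun i => (Pi.single (τ i) 1 : V → ℝ)) p u = 0 := fun u hu =>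
    comb_single_eq_zero (fun i (hi : τ i = u) => hu (hi ▸ hτ i)) p
  refine ⟨⟨mem_realization_iff.mpr ⟨comb_single_mem_stdSimplex τ p, s, hs.1 ?_, h0⟩,
    height_comb_single_le (fun i => hs.2 _ (hτ i)) p⟩, h0⟩
  cases n with
  | zero => exact absurd p.2.2 (by simp)
  | succ n => exact ⟨τ 0, hτ 0⟩

theorem antitone_subset {E : Type*} (B : Set E) : ∀ s t : Set E, s ⊆ t → t ⊆ B → s ⊆ B :=
  fun _ _ h h' => h.trans h'

theorem IsLowFace.mono {s t : Finset V} (hs : IsLowFace K a v s) (h : t ⊆ s) :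
    IsLowFace K a v t :=
  ⟨fun ht => (K.isRelLowerSet_faces (hs.1 (ht.mono h))).2 h ht, fun u hu => hs.2 u (h hu)⟩

/-- The data on which simplicial approximation depends: every point of the sublevel set is labelled
by a low vertex whose open star contains all points at distance less than `δ`. -/
structure IsLabelling (K : AbstractSimplicialComplex V) (a : V → ℝ) (v : V) (δ : ℝ)
    (w : (V → ℝ) → V) : Prop where
  pos : 0 < δ
  low : ∀ x ∈ sublevel K a v, a (w x) ≤ a v
  near : ∀ x ∈ sublevel K a v, ∀ y, dist y x < δ → 0 < y (w x)

/-- The property of a set to be contained in `B` and to have small diameter. -/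
def SmallIn (δ : ℝ) (B : Set (V → ℝ)) (s : Set (V → ℝ)) : Prop :=
  s ⊆ B ∧ ∀ y ∈ s, ∀ z ∈ s, dist y z < δ

variable {δ : ℝ} {w : (V → ℝ) → V}

theorem label_ne_zero (hw : IsLabelling K a v δ w) {n : ℕ} {σ : SingSimplex (V → ℝ) n}
    (hσ : SmallIn δ (sublevel K a v) (Set.range σ)) (p q : stdSimplex ℝ (Fin n)) :
    σ p (w (σ q)) ≠ 0 :=
  (hw.near _ (hσ.1 ⟨q, rfl⟩) _ (hσ.2 _ ⟨p, rfl⟩ _ ⟨q, rfl⟩)).ne'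

theorem label_ne (hw : IsLabelling K a v δ w) {x : V → ℝ} (hx : x ∈ starComplement K a v) :
    w x ≠ v := by
  rintro h
  have := hw.near x hx.1 x (by simpa using hw.pos)
  rw [h, hx.2] at this
  exact this.false

theorem isLowFace_labels (hw : IsLabelling K a v δ w) {n : ℕ} {σ : SingSimplex (V → ℝ) n}
    (hσ : SmallIn δ (sublevel K a v) (Set.range σ)) :
    IsLowFace K a v (Finset.univ.image fun i => w (σ (stdSimplex.vertex i))) := by
  constructor
  · intro h
    obtain ⟨i, -⟩ := Finset.image_nonempty.mp h
    refine mem_faces_of_ne_zero (hσ.1 ⟨stdSimplex.vertex i, rfl⟩).1 h fun u hu => ?_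
    obtain ⟨j, -, rfl⟩ := Finset.mem_image.mp hu
    exact label_ne_zero hw hσ _ _
  · intro u hu
    obtain ⟨j, -, rfl⟩ := Finset.mem_image.mp hu
    exact hw.low _ (hσ.1 ⟨_, rfl⟩)

theorem segment_approximate_subset (hw : IsLabelling K a v δ w) {n : ℕ}
    {σ : SingSimplex (V → ℝ) n} (hσ : SmallIn δ (sublevel K a v) (Set.range σ)) :
    ⋃ p, segment ℝ (σ p) (approximate w n σ p) ⊆ sublevel K a v := by
  refine Set.iUnion_subset fun p => segment_subset_sublevel (hσ.1 ⟨p, rfl⟩)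
    (comb_single_mem_stdSimplex _ p) (fun u hu => comb_single_eq_zero (fun i hi => ?_) p)
    (height_comb_single_le (fun i => hw.low _ (hσ.1 ⟨_, rfl⟩)) p)
  rw [← hi] at hu
  exact label_ne_zero hw hσ _ _ hu

theorem segment_approximate_subset' (hw : IsLabelling K a v δ w) {n : ℕ}
    {σ : SingSimplex (V → ℝ) n} (hσ : SmallIn δ (starComplement K a v) (Set.range σ)) :
    ⋃ p, segment ℝ (σ p) (approximate w n σ p) ⊆ starComplement K a v := by
  have hσ' : SmallIn δ (sublevel K a v) (Set.range σ) :=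
    ⟨fun x hx => (hσ.1 hx).1, hσ.2⟩
  refine Set.iUnion_subset fun p => segment_subset_starComplement (hσ.1 ⟨p, rfl⟩)
    (comb_single_mem_stdSimplex _ p) (fun u hu => comb_single_eq_zero (fun i hi => ?_) p)
    (height_comb_single_le (fun i => hw.low _ (hσ'.1 ⟨_, rfl⟩)) p)
  rw [← hi] at hu
  exact label_ne_zero hw hσ' _ _ hu

variable (F) in
/-- The oriented chains with `n` vertices of the complex of low faces. -/
def lowChains (K : AbstractSimplicialComplex V) (a : V → ℝ) (v : V) (n : ℕ) :
    Submodule F (Finset V →₀ F) :=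
  facesWith F fun t => IsLowFace K a v t ∧ t.card = n

variable (F) in
/-- The oriented chains with `n` vertices of the complex of low faces that do not contain `v`. -/
def lowChainsAway (K : AbstractSimplicialComplex V) (a : V → ℝ) (v : V) (n : ℕ) :
    Submodule F (Finset V →₀ F) :=
  facesWith F fun t => (IsLowFace K a v t ∧ v ∉ t) ∧ t.card = n

end Comparison

section Comparison

set_option linter.unusedSectionVars false

open ConvexComb

variable {F : Type*} [Field F] {V : Type} [Fintype V] [LinearOrder V]
  {K : AbstractSimplicialComplex V} {a : V → ℝ} {v : V} {δ : ℝ} {w : (V → ℝ) → V}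

theorem chainsWith_subset_mono {B B' : Set (V → ℝ)} (h : B ⊆ B') (n : ℕ) :
    chainsWith F (fun s => s ⊆ B) n ≤ chainsWith F (fun s => s ⊆ B') n :=
  Finsupp.supported_mono fun _ hσ => Set.Subset.trans hσ h

theorem sublevelOn_subset_sublevel {s : Finset V} : sublevelOn K a v s ⊆ sublevel K a v :=
  fun _ hx => hx.1

theorem sublevelOn_subset_starComplement {s : Finset V} (hs : v ∉ s) :
    sublevelOn K a v s ⊆ starComplement K a v :=
  fun _ hx => ⟨hx.1, hx.2 v hs⟩

/-! ### Excising the open star -/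

open Classical in
/-- The composition of a singular simplex with the radial projection from `v`, where it makes
sense. -/
noncomputable def projectSimplex (v : V) (n : ℕ) (σ : SingSimplex (V → ℝ) n) :
    SingSimplex (V → ℝ) n :=
  if h : ∀ p, σ p v ≠ 1 then
    { toFun p := radialProjection v (σ p)
      continuous_toFun := by
        have h1 : Continuous fun p => σ p v := (continuous_apply v).comp σ.continuous
        exact ((continuous_const.sub h1).inv₀ fun p => sub_ne_zero.mpr (h p).symm).smul
          (σ.continuous.sub (h1.smul continuous_const)) }
  else σ

theorem projectSimplex_apply {n : ℕ} {σ : SingSimplex (V → ℝ) n}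
    (h : Set.range σ ⊆ puncturedSublevel K a v) (p : stdSimplex ℝ (Fin n)) :
    projectSimplex v n σ p = radialProjection v (σ p) := by
  have h' : ∀ p, σ p v ≠ 1 := fun p => apply_ne_one_of_mem_puncturedSublevel (h ⟨p, rfl⟩)
  rw [projectSimplex, dif_pos h']
  rfl

variable (F K a v) in
/-- The straight-line homotopy from the identity to the radial projection, on the simplices of the
punctured sublevel set. -/
noncomputable def projectionHomotopy (n : ℕ) :
    SingChain F (V → ℝ) n →ₗ[F] SingChain F (V → ℝ) (n + 1) :=
  prismHomotopy F (fun n => {σ : SingSimplex (V → ℝ) n | Set.range σ ⊆ puncturedSublevel K a v})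
    (projectSimplex v) n

theorem projectionHomotopy_mem {n : ℕ} (x : SingChain F (V → ℝ) n) :
    projectionHomotopy F K a v n x ∈
      chainsWith F (fun s => s ⊆ puncturedSublevel K a v) (n + 1) := by
  refine Finsupp.map_mem_of_single (s := Set.univ) _ (fun σ _ => ?_) (by simp)
  by_cases hσ : Set.range σ ⊆ puncturedSublevel K a v
  · rw [projectionHomotopy, prismHomotopy_single hσ]
    refine prism_mem (antitone_subset _) (Set.iUnion_subset fun p => ?_)
    rw [projectSimplex_apply hσ]
    exact segment_radialProjection_subset (hσ ⟨p, rfl⟩)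
  · rw [projectionHomotopy, prismHomotopy_single_of_notMem hσ]
    exact Submodule.zero_mem _

theorem projectionHomotopy_mem_starComplement {n : ℕ} {x : SingChain F (V → ℝ) n}
    (hx : x ∈ chainsWith F (fun s => s ⊆ starComplement K a v) n) :
    projectionHomotopy F K a v n x ∈ chainsWith F (fun s => s ⊆ starComplement K a v) (n + 1) := by
  refine Finsupp.map_mem_of_single _ (fun σ hσ => ?_) hx
  have hσ' : Set.range σ ⊆ puncturedSublevel K a v :=
    Set.Subset.trans hσ starComplement_subset_puncturedSublevel
  rw [projectionHomotopy, prismHomotopy_single hσ']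
  refine prism_mem (antitone_subset _) (Set.iUnion_subset fun p => ?_)
  rw [projectSimplex_apply hσ']
  have h1 := hσ' ⟨p, rfl⟩
  have h2 := radialProjection_mem_starComplement h1
  exact segment_subset_starComplement (hσ ⟨p, rfl⟩) (mem_realization_iff.mp h2.1.1).1
    (fun _ => radialProjection_eq_zero) h2.1.2

theorem sub_projectionHomotopy_mem {n : ℕ} {x : SingChain F (V → ℝ) (n + 1)}
    (hx : x ∈ chainsWith F (fun s => s ⊆ puncturedSublevel K a v) (n + 1)) :
    x - (singBoundary F (n + 1) (projectionHomotopy F K a v (n + 1) x) +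
      projectionHomotopy F K a v n (singBoundary F n x)) ∈
      chainsWith F (fun s => s ⊆ starComplement K a v) (n + 1) := by
  have hface (n : ℕ) (σ : SingSimplex (V → ℝ) (n + 1))
      (hσ : Set.range σ ⊆ puncturedSublevel K a v) (i) :
      Set.range (σ.comp (faceInc i)) ⊆ puncturedSublevel K a v :=
    (Set.range_comp_subset_range (faceInc i) σ).trans hσ
  rw [projectionHomotopy, projectionHomotopy, prismHomotopy_spec hface (fun n σ hσ i => ?_) hx,
    sub_sub_cancel]
  · refine Finsupp.map_mem_of_single _ (fun σ hσ => ?_) hx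
    rw [Finsupp.lmapDomain_apply, Finsupp.mapDomain_single]
    refine single_mem_chainsWith ?_ 1
    rintro _ ⟨p, rfl⟩
    rw [projectSimplex_apply hσ]
    exact radialProjection_mem_starComplement (hσ ⟨p, rfl⟩)
  · ext1 p
    rw [projectSimplex_apply (hface n σ hσ i), ContinuousMap.comp_apply, ContinuousMap.comp_apply,
      projectSimplex_apply hσ]

theorem nonempty_equiv_starComplement (n : ℕ) :
    Nonempty (RelHomology (fun n => singBoundary F n)
        (chainsWith F fun s => s ⊆ sublevel K a v) (chainsWith F fun s => s ⊆ starComplement K a v) n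
      ≃ₗ[F] RelHomology (fun n => singBoundary F n)
        (chainsWith F fun s => s ⊆ sublevel K a v)
        (chainsWith F fun s => s ⊆ puncturedSublevel K a v) n) := by
  have h0 : chainsWith F (fun s => s ⊆ puncturedSublevel K a v) 0 ≤
      chainsWith F (fun s => s ⊆ starComplement K a v) 0 := by
    refine Finsupp.supported_mono fun σ _ => ?_
    rintro _ ⟨p, rfl⟩
    exact absurd p.2.2 (by simp)
  exact nonempty_relHomology_equiv_of_deformation (d := fun n => singBoundary F n)
    (fun n x => singBoundary_singBoundary x)
    (fun n => chainsWith_subset_mono (fun x hx => hx.1) n)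
    (fun n => chainsWith_subset_mono starComplement_subset_puncturedSublevel n) h0
    (fun n x hx => singBoundary_mem (antitone_subset _) hx)
    (fun n x hx => singBoundary_mem (antitone_subset _) hx)
    (projectionHomotopy F K a v) (fun n x => projectionHomotopy_mem x)
    (fun n x hx => projectionHomotopy_mem_starComplement hx)
    (fun n x hx => sub_projectionHomotopy_mem hx) n

/-! ### Simplicial approximation -/

theorem enumerate_orient_zero :
    (LinearMap.id : TupleChain F V 0 →ₗ[F] _) = enumerate F 0 ∘ₗ orient F 0 :=
  Finsupp.lhom_ext_one fun τ => by
    rw [LinearMap.comp_apply, Subsingleton.elim τ Fin.elim0]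
    simp [orient, orientedSimplex, enumerate_single, orderedSimplex]

theorem labelVertices_singSubdivision_zero (w : (V → ℝ) → V) (N : ℕ) :
    (LinearMap.id : TupleChain F V 0 →ₗ[F] _) =
      labelVertices F w 0 ∘ₗ singSubdivision F N 0 ∘ₗ realizeTuple F 0 :=
  Finsupp.lhom_ext_one fun τ => by
    rw [LinearMap.comp_apply, LinearMap.comp_apply, realizeTuple_single, singSubdivision_single,
      subdivision_pow_zero, Module.End.one_apply, push_universalSimplex, labelVertices_single,
      LinearMap.id_apply]
    congr 1
    exact Subsingleton.elim _ _

/-- The homotopy between ordered chains and their sorted antisymmetrizations. -/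
noncomputable def sortHomotopy (n : ℕ) : TupleChain F V n →ₗ[F] TupleChain F V (n + 1) :=
  coneHomotopy (fun _ => LinearMap.id) (fun n => enumerate F n ∘ₗ orient F n) id n

theorem sortHomotopy_spec {n : ℕ} (x : TupleChain F V (n + 1)) :
    tupleBoundary F (n + 1) (sortHomotopy (n + 1) x) + sortHomotopy n (tupleBoundary F n x) =
      x - enumerate F (n + 1) (orient F (n + 1) x) :=
  tupleBoundary_coneHomotopy enumerate_orient_zero (fun _ _ => rfl) (fun n x => by
    simp only [LinearMap.comp_apply, tupleBoundary_enumerate, faceBoundary_orient]) x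

theorem sortHomotopy_mem {s : Set V} {n : ℕ} {x : TupleChain F V n} (hx : x ∈ tuplesIn F s n) :
    sortHomotopy n x ∈ tuplesIn F s (n + 1) :=
  coneHomotopy_mem (fun _ h => h) (fun _ _ h => h) (fun _ _ h => enumerate_mem
    (Finsupp.supported_mono (fun _ ht => ht.1) (orient_mem h))) hx

/-- The homotopy between ordered simplicial chains and the simplicial approximations of the
subdivisions of their realizations. -/
noncomputable def approximationHomotopy (w : (V → ℝ) → V) (N n : ℕ) :
    TupleChain F V n →ₗ[F] TupleChain F V (n + 1) :=
  coneHomotopy (fun _ => LinearMap.id)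
    (fun n => labelVertices F w n ∘ₗ singSubdivision F N n ∘ₗ realizeTuple F n) id n

theorem approximationHomotopy_spec (w : (V → ℝ) → V) (N : ℕ) {n : ℕ}
    (x : TupleChain F V (n + 1)) :
    tupleBoundary F (n + 1) (approximationHomotopy w N (n + 1) x) +
      approximationHomotopy w N n (tupleBoundary F n x) =
      x - labelVertices F w _ (singSubdivision F N _ (realizeTuple F _ x)) :=
  tupleBoundary_coneHomotopy (labelVertices_singSubdivision_zero w N) (fun _ _ => rfl) (fun n x => by
    simp only [LinearMap.comp_apply, tupleBoundary_labelVertices, singBoundary_singSubdivision,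
      singBoundary_realizeTuple]) x

theorem labelVertices_mem (hw : IsLabelling K a v δ w) {s : Finset V} {n : ℕ}
    {x : SingChain F (V → ℝ) n} (hx : x ∈ chainsWith F (fun B => B ⊆ sublevelOn K a v s) n) :
    labelVertices F w n x ∈ tuplesIn F ↑s n := by
  refine Finsupp.map_mem_of_single _ (fun σ hσ => ?_) hx
  rw [labelVertices_single]
  refine single_mem_tuplesIn (fun i => ?_) 1
  have h : σ (stdSimplex.vertex i) ∈ sublevelOn K a v s := hσ ⟨_, rfl⟩
  by_contra hs
  have h1 := hw.near _ h.1 (σ (stdSimplex.vertex i)) (by simpa using hw.pos)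
  rw [h.2 _ hs] at h1
  exact h1.false

theorem approximationHomotopy_mem (hw : IsLabelling K a v δ w) {s : Finset V}
    (hs : IsLowFace K a v s) (N : ℕ) {n : ℕ} {x : TupleChain F V n}
    (hx : x ∈ tuplesIn F ↑s n) : approximationHomotopy w N n x ∈ tuplesIn F ↑s (n + 1) :=
  coneHomotopy_mem (fun _ h => h) (fun _ _ h => h) (fun _ _ h => labelVertices_mem hw
    (singSubdivision_mem (antitone_subset _) N (realizeTuple_mem hs h))) hx

theorem realizeTuple_enumerate_mem {n : ℕ} {c : Finset V →₀ F}
    (hc : c ∈ lowChains F K a v n) :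
    realizeTuple F n (enumerate F n c) ∈ chainsWith F (fun s => s ⊆ sublevel K a v) n := by
  refine Finsupp.map_mem_of_single (realizeTuple F n ∘ₗ enumerate F n) (fun t ht => ?_) hc
  refine chainsWith_subset_mono sublevelOn_subset_sublevel _
    (realizeTuple_mem ht.1 (enumerate_mem (single_mem_facesWith ?_ 1)))
  exact subset_rfl

theorem realizeTuple_enumerate_mem_starComplement {n : ℕ} {c : Finset V →₀ F}
    (hc : c ∈ lowChainsAway F K a v n) :
    realizeTuple F n (enumerate F n c) ∈ chainsWith F (fun s => s ⊆ starComplement K a v) n := by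
  refine Finsupp.map_mem_of_single (realizeTuple F n ∘ₗ enumerate F n) (fun t ht => ?_) hc
  refine chainsWith_subset_mono (sublevelOn_subset_starComplement ht.1.2) _
    (realizeTuple_mem ht.1.1 (enumerate_mem (single_mem_facesWith ?_ 1)))
  exact subset_rfl

theorem labels_mem_tuplesIn {n : ℕ} (σ : SingSimplex (V → ℝ) n) :
    labelVertices F w n (Finsupp.single σ 1) ∈
      tuplesIn F ↑(Finset.univ.image fun i => w (σ (stdSimplex.vertex i))) n := by
  rw [labelVertices_single]
  exact single_mem_tuplesIn (fun i => Finset.mem_coe.mpr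
    (Finset.mem_image_of_mem _ (Finset.mem_univ i))) 1

theorem notMem_labels (hw : IsLabelling K a v δ w) {n : ℕ} {σ : SingSimplex (V → ℝ) n}
    (hσ : SmallIn δ (starComplement K a v) (Set.range σ)) :
    v ∉ Finset.univ.image fun i => w (σ (stdSimplex.vertex i)) := by
  intro h
  obtain ⟨i, -, hi⟩ := Finset.mem_image.mp h
  exact label_ne hw (hσ.1 ⟨_, rfl⟩) hi

theorem SmallIn.of_starComplement {s : Set (V → ℝ)} (h : SmallIn δ (starComplement K a v) s) :
    SmallIn δ (sublevel K a v) s :=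
  ⟨fun _ hx => (h.1 hx).1, h.2⟩

theorem eventually_singSubdivision_smallIn (hδ : 0 < δ) (B : Set (V → ℝ)) {n : ℕ}
    {x : SingChain F (V → ℝ) n} (hx : x ∈ chainsWith F (fun s => s ⊆ B) n) :
    ∀ᶠ N in Filter.atTop, singSubdivision F N n x ∈ chainsWith F (SmallIn δ B) n := by
  filter_upwards [eventually_singSubdivision_small hδ x] with N hN
  have h := Submodule.mem_inf.mpr ⟨singSubdivision_mem (antitone_subset B) N hx, hN⟩
  rw [chainsWith, chainsWith, ← Finsupp.supported_inter] at h
  exact h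

variable (F) in
/-- The homotopy between small singular chains and the realizations of their simplicial
approximations. -/
noncomputable def smallHomotopy (w : (V → ℝ) → V) (n : ℕ) :
    SingChain F (V → ℝ) n →ₗ[F] SingChain F (V → ℝ) (n + 1) :=
  prismHomotopy F (fun _ => Set.univ) (approximate w) n +
    realizeTuple F (n + 1) ∘ₗ sortHomotopy n ∘ₗ labelVertices F w n

theorem smallHomotopy_spec (w : (V → ℝ) → V) {n : ℕ} (x : SingChain F (V → ℝ) (n + 1)) :
    singBoundary F (n + 1) (smallHomotopy F w (n + 1) x) +
      smallHomotopy F w n (singBoundary F n x) =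
      x - realizeTuple F _ (enumerate F _ (orient F _ (labelVertices F w _ x))) := by
  have h1 := prismHomotopy_spec (F := F) (P := fun _ => Set.univ) (ρ := approximate w)
    (fun _ _ _ _ => Set.mem_univ _) (fun n σ _ i => approximate_comp_faceInc w σ i)
    (x := x) (by simp)
  have h2 := congrArg (realizeTuple F (n + 1)) (sortHomotopy_spec (labelVertices F w (n + 1) x))
  rw [lmapDomain_approximate] at h1
  rw [map_add, map_sub] at h2
  simp only [smallHomotopy, LinearMap.add_apply, LinearMap.comp_apply, map_add,
    singBoundary_realizeTuple, ← tupleBoundary_labelVertices]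
  rw [← sub_add_sub_cancel x (realizeTuple F _ (labelVertices F w _ x)), ← h1, ← h2]
  abel

theorem smallHomotopy_mem (hw : IsLabelling K a v δ w) {n : ℕ} {x : SingChain F (V → ℝ) n}
    (hx : x ∈ chainsWith F (SmallIn δ (sublevel K a v)) n) :
    smallHomotopy F w n x ∈ chainsWith F (fun s => s ⊆ sublevel K a v) (n + 1) := by
  refine Finsupp.map_mem_of_single _ (fun σ hσ => ?_) hx
  refine Submodule.add_mem _ ?_ ?_
  · rw [prismHomotopy_single (P := fun _ => Set.univ) (Set.mem_univ σ)]
    exact prism_mem (antitone_subset _) (segment_approximate_subset hw hσ)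
  · exact chainsWith_subset_mono sublevelOn_subset_sublevel _
      (realizeTuple_mem (isLowFace_labels hw hσ) (sortHomotopy_mem (labels_mem_tuplesIn σ)))

theorem smallHomotopy_mem_starComplement (hw : IsLabelling K a v δ w) {n : ℕ}
    {x : SingChain F (V → ℝ) n} (hx : x ∈ chainsWith F (SmallIn δ (starComplement K a v)) n) :
    smallHomotopy F w n x ∈ chainsWith F (fun s => s ⊆ starComplement K a v) (n + 1) := by
  refine Finsupp.map_mem_of_single _ (fun σ hσ => ?_) hx
  refine Submodule.add_mem _ ?_ ?_
  · rw [prismHomotopy_single (P := fun _ => Set.univ) (Set.mem_univ σ)]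
    exact prism_mem (antitone_subset _) (segment_approximate_subset' hw hσ)
  · exact chainsWith_subset_mono (sublevelOn_subset_starComplement (notMem_labels hw hσ)) _
      (realizeTuple_mem (isLowFace_labels hw hσ.of_starComplement)
        (sortHomotopy_mem (labels_mem_tuplesIn σ)))

/-- The relative homology of the sublevel set modulo the complement of the open star of `v` is the
simplicial relative homology of the complex of low faces. -/
theorem nonempty_low_equiv_starComplement (n : ℕ) :
    Nonempty (RelHomology (fun _ => faceBoundary F) (lowChains F K a v) (lowChainsAway F K a v) n
      ≃ₗ[F] RelHomology (fun n => singBoundary F n) (chainsWith F fun s => s ⊆ sublevel K a v)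
        (chainsWith F fun s => s ⊆ starComplement K a v) n) := by
  obtain ⟨δ, hδ, w, h⟩ := exists_lowVertex_near K a v
  have hw : IsLabelling K a v δ w := ⟨hδ, fun x hx => (h x hx).1, fun x hx => (h x hx).2⟩
  refine nonempty_relHomology_equiv_of_small
    (SX := chainsWith F (SmallIn δ (sublevel K a v)))
    (SA := chainsWith F (SmallIn δ (starComplement K a v)))
    (fun n => realizeTuple F n ∘ₗ enumerate F n) (fun n => orient F n ∘ₗ labelVertices F w n)
    (singSubdivision F) (singSubdivisionHomotopy F) (smallHomotopy F w)
    (fun N n => orient F (n + 1) ∘ₗ approximationHomotopy w N n ∘ₗ enumerate F n)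
    (fun n x => ?_) (fun n x => ?_) (fun N n x => singBoundary_singSubdivision N x)
    (fun N n x => singSubdivisionHomotopy_spec N x) (fun n x => smallHomotopy_spec w x)
    (fun N n x hx => ?_) (fun n x => realizeTuple_enumerate_mem)
    (fun n x => realizeTuple_enumerate_mem_starComplement) (fun n x hx => ?_) (fun n x hx => ?_)
    (fun N n x => singSubdivisionHomotopy_mem (antitone_subset _) N)
    (fun N n x => singSubdivisionHomotopy_mem (antitone_subset _) N)
    (fun n x => smallHomotopy_mem hw) (fun n x => smallHomotopy_mem_starComplement hw)
    (fun N n x hx => ?_) (fun N n x hx => ?_)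
    (fun n x => eventually_singSubdivision_smallIn hδ _)
    (fun n x => eventually_singSubdivision_smallIn hδ _) n
  · simp only [LinearMap.comp_apply, singBoundary_realizeTuple, tupleBoundary_enumerate]
  · simp only [LinearMap.comp_apply, faceBoundary_orient, tupleBoundary_labelVertices]
  · have h1 := congrArg (orient F (n + 1))
      (approximationHomotopy_spec w N (enumerate F (n + 1) x))
    rw [map_add, map_sub, orient_enumerate (Finsupp.supported_mono (fun _ ht => ht.2) hx)] at h1
    simp only [LinearMap.comp_apply]
    rw [← h1, faceBoundary_orient, tupleBoundary_enumerate]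
  · refine Finsupp.map_mem_of_single _ (fun σ hσ => ?_) hx
    refine Finsupp.supported_mono (fun t ht => ?_) (orient_mem (labels_mem_tuplesIn σ))
    exact ⟨(isLowFace_labels hw hσ).mono (Finset.coe_subset.mp ht.1), ht.2⟩
  · refine Finsupp.map_mem_of_single _ (fun σ hσ => ?_) hx
    refine Finsupp.supported_mono (fun t ht => ?_) (orient_mem (labels_mem_tuplesIn σ))
    have ht' := Finset.coe_subset.mp ht.1
    exact ⟨⟨(isLowFace_labels hw hσ.of_starComplement).mono ht',
      fun hv => notMem_labels hw hσ (ht' hv)⟩, ht.2⟩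
  · refine Finsupp.map_mem_of_single _ (fun s hs => ?_) hx
    refine Finsupp.supported_mono (fun t ht => ?_) (orient_mem (s := ↑s)
      (approximationHomotopy_mem hw hs.1 N (enumerate_mem (single_mem_facesWith ?_ 1))))
    · exact ⟨hs.1.mono (Finset.coe_subset.mp ht.1), ht.2⟩
    · exact subset_rfl
  · refine Finsupp.map_mem_of_single _ (fun s hs => ?_) hx
    refine Finsupp.supported_mono (fun t ht => ?_) (orient_mem (s := ↑s)
      (approximationHomotopy_mem hw hs.1.1 N (enumerate_mem (single_mem_facesWith ?_ 1))))
    · have ht' := Finset.coe_subset.mp ht.1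
      exact ⟨⟨hs.1.1.mono ht', fun hv => hs.1.2 (ht' hv)⟩, ht.2⟩
    · exact subset_rfl

end Comparison

/-! ### Singular homology as a quotient of modules -/

section Transport

universe w

open CategoryTheory Limits Simplicial

variable (F : Type w) [Field F]

/-- The singular simplices of a topological space `X`, mapped to `E` along `j`. -/
noncomputable def simplexImage {X : TopCat.{0}} {E : Type} [TopologicalSpace E] (j : C(X, E)) (n : ℕ)
    (x : (TopCat.toSSet.obj X) _⦋n⦌) : SingSimplex E (n + 1) :=
  j.comp (TopCat.toSSetObjEquiv X _ x)

/-- The chains of Mathlib's singular chain complex of `X`, mapped to singular chains of `E` along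
`j : X → E`. The number of vertices is one more than the degree. -/
noncomputable def chainImage {X : TopCat.{0}} {E : Type} [TopologicalSpace E] (j : C(X, E)) (n : ℕ) :
    (((TopCat.toSSet.obj X).chainComplex (ModuleCat.of F F)).X n) →ₗ[F] SingChain F E (n + 1) :=
  (((TopCat.toSSet.obj X).isColimitChainComplexXCofan (ModuleCat.of F F) n).desc
    (Cofan.mk (ModuleCat.of F (SingChain F E (n + 1))) fun x =>
      ModuleCat.ofHom (Finsupp.lsingle (simplexImage j n x)))).hom

/-- The basis element of Mathlib's singular chain complex given by a singular simplex. -/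
noncomputable def basisChain {X : TopCat.{0}} {n : ℕ} (x : (TopCat.toSSet.obj X) _⦋n⦌) :
    ((TopCat.toSSet.obj X).chainComplex (ModuleCat.of F F)).X n :=
  ((TopCat.toSSet.obj X).ιChainComplex (R := ModuleCat.of F F) x).hom (1 : F)

variable {F} {X Y : TopCat.{0}} {E : Type} [TopologicalSpace E]

theorem chainImage_basisChain (j : C(X, E)) {n : ℕ} (x : (TopCat.toSSet.obj X) _⦋n⦌) :
    chainImage F j n (basisChain F x) = Finsupp.single (simplexImage j n x) 1 := by
  have h := ((TopCat.toSSet.obj X).isColimitChainComplexXCofan (ModuleCat.of F F) n).fac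
    (Cofan.mk (ModuleCat.of F (SingChain F E (n + 1))) fun x =>
      ModuleCat.ofHom (Finsupp.lsingle (simplexImage j n x))) ⟨x⟩
  exact congrArg (fun f => f.hom (1 : F)) h

theorem chainComplex_lhom_ext {n : ℕ} {M : Type w} [AddCommGroup M] [Module F M]
    {f g : ((TopCat.toSSet.obj X).chainComplex (ModuleCat.of F F)).X n →ₗ[F] M}
    (h : ∀ x, f (basisChain F x) = g (basisChain F x)) : f = g := by
  have : ModuleCat.ofHom f = ModuleCat.ofHom g := by
    refine SSet.chainComplex_hom_ext fun x => ModuleCat.hom_ext (LinearMap.ext_ring ?_)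
    exact h x
  exact congrArg ModuleCat.Hom.hom this

theorem singBoundary_chainImage (j : C(X, E)) (n : ℕ)
    (c : ((TopCat.toSSet.obj X).chainComplex (ModuleCat.of F F)).X (n + 1)) :
    singBoundary F (n + 1) (chainImage F j (n + 1) c) =
      chainImage F j n ((((TopCat.toSSet.obj X).chainComplex (ModuleCat.of F F)).d (n + 1) n).hom c) := by
  suffices h : singBoundary F (n + 1) ∘ₗ chainImage F j (n + 1) = chainImage F j n ∘ₗ
      (((TopCat.toSSet.obj X).chainComplex (ModuleCat.of F F)).d (n + 1) n).hom from
    LinearMap.congr_fun h c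
  refine chainComplex_lhom_ext fun x => ?_
  have h1 : (((TopCat.toSSet.obj X).chainComplex (ModuleCat.of F F)).d (n + 1) n).hom
      (basisChain F x) = ∑ i : Fin (n + 2), (-1 : ℤ) ^ (i : ℕ) •
        basisChain F ((TopCat.toSSet.obj X).δ i x) := by
    refine (congrArg (fun f => f.hom (1 : F))
      (SSet.ιChainComplex_d (TopCat.toSSet.obj X) (ModuleCat.of F F) x)).trans ?_
    rw [ModuleCat.hom_sum, LinearMap.sum_apply]
    rfl
  rw [LinearMap.comp_apply, LinearMap.comp_apply, h1, chainImage_basisChain, singBoundary_single,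
    map_sum]
  refine Finset.sum_congr rfl fun i _ => ?_
  rw [map_zsmul, chainImage_basisChain, ← Int.cast_smul_eq_zsmul F]
  push_cast
  congr 2

theorem chainImage_map (f : X ⟶ Y) (j : C(Y, E)) (n : ℕ)
    (c : ((TopCat.toSSet.obj X).chainComplex (ModuleCat.of F F)).X n) :
    chainImage F j n ((SSet.chainComplexMap (TopCat.toSSet.map f) (ModuleCat.of F F)).f n c) =
      chainImage F (j.comp f.hom) n c := by
  suffices h : chainImage F j n ∘ₗ
      ((SSet.chainComplexMap (TopCat.toSSet.map f) (ModuleCat.of F F)).f n).hom =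
      chainImage F (j.comp f.hom) n from LinearMap.congr_fun h c
  refine chainComplex_lhom_ext fun x => ?_
  have h1 : ((SSet.chainComplexMap (TopCat.toSSet.map f) (ModuleCat.of F F)).f n).hom
      (basisChain F x) = basisChain F ((TopCat.toSSet.map f).app _ x) :=
    congrArg (fun f => f.hom (1 : F))
      (SSet.ι_chainComplexMap_f _ _ (TopCat.toSSet.map f) (ModuleCat.of F F) x)
  rw [LinearMap.comp_apply, h1, chainImage_basisChain, chainImage_basisChain]
  rfl

theorem chainImage_eq_lmapDomain (j : C(X, E)) (n : ℕ) :
    ∃ e : ((TopCat.toSSet.obj X).chainComplex (ModuleCat.of F F)).X n ≃ₗ[F]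
      ((TopCat.toSSet.obj X) _⦋n⦌ →₀ F),
      chainImage F j n = Finsupp.lmapDomain F F (simplexImage j n) ∘ₗ e.toLinearMap := by
  let f : ((TopCat.toSSet.obj X).chainComplex (ModuleCat.of F F)).X n →ₗ[F]
      ((TopCat.toSSet.obj X) _⦋n⦌ →₀ F) :=
    (((TopCat.toSSet.obj X).isColimitChainComplexXCofan (ModuleCat.of F F) n).desc
      (Cofan.mk (ModuleCat.of F ((TopCat.toSSet.obj X) _⦋n⦌ →₀ F)) fun x =>
        ModuleCat.ofHom (Finsupp.lsingle x))).hom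
  have hf (x) : f (basisChain F x) = Finsupp.single x 1 :=
    congrArg (fun f => f.hom (1 : F))
      (((TopCat.toSSet.obj X).isColimitChainComplexXCofan (ModuleCat.of F F) n).fac
        (Cofan.mk (ModuleCat.of F ((TopCat.toSSet.obj X) _⦋n⦌ →₀ F)) fun x =>
          ModuleCat.ofHom (Finsupp.lsingle x)) ⟨x⟩)
  let g := Finsupp.linearCombination F (basisChain F (X := X) (n := n))
  refine ⟨LinearEquiv.ofLinearMap f g ?_ ?_, ?_⟩
  · exact Finsupp.lhom_ext_one fun x => by simp [g, hf]
  · exact chainComplex_lhom_ext fun x => by simp [g, hf]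
  · exact chainComplex_lhom_ext fun x => by simp [hf, chainImage_basisChain]

theorem simplexImage_injective {j : C(X, E)} (hj : Function.Injective j) (n : ℕ) :
    Function.Injective (simplexImage j n) := by
  intro x y h
  refine (TopCat.toSSetObjEquiv X _).injective (ContinuousMap.ext fun p => hj ?_)
  exact congrArg (fun σ : SingSimplex E (n + 1) => σ p) h

theorem chainImage_injective {j : C(X, E)} (hj : Function.Injective j) (n : ℕ) :
    Function.Injective (chainImage F j n) := by
  obtain ⟨e, he⟩ := chainImage_eq_lmapDomain (F := F) j n
  rw [he]
  exact (Finsupp.mapDomain_injective (simplexImage_injective hj n)).comp e.injective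

theorem range_chainImage {j : C(X, E)} (hj : Topology.IsInducing j) (n : ℕ) :
    LinearMap.range (chainImage F j n) = chainsWith F (fun s => s ⊆ Set.range j) (n + 1) := by
  obtain ⟨e, he⟩ := chainImage_eq_lmapDomain (F := F) j n
  rw [he, LinearMap.range_comp, LinearEquiv.range, Submodule.map_top, ← Submodule.map_top,
    ← Finsupp.supported_univ, Finsupp.lmapDomain_supported]
  congr 1
  ext σ
  constructor
  · rintro ⟨x, -, rfl⟩
    rintro _ ⟨p, rfl⟩
    exact ⟨_, rfl⟩
  · intro h
    choose g hg using fun p => h ⟨p, rfl⟩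
    have hc : Continuous g := hj.continuous_iff.mpr (by
      convert! σ.continuous using 1
      exact funext hg)
    refine ⟨(TopCat.toSSetObjEquiv X _).symm ⟨g, hc⟩, trivial, ?_⟩
    rw [simplexImage, Equiv.apply_symm_apply]
    exact ContinuousMap.ext hg

end Transport

section Transport

universe w

open CategoryTheory Limits

variable {F : Type w} [Field F]

/-- If the relative chain complex `A → P → C → 0` is presented by chains `P`, embedded by `α` into
a complex of vector spaces, then the homology of `C` is computed there. -/
theorem rank_homology_eq_rank_relHomology {P C : ChainComplex (ModuleCat.{w} F) ℕ} (π : P ⟶ C)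
    {M : ℕ → Type w} [∀ n, AddCommGroup (M n)] [∀ n, Module F (M n)]
    {d : ∀ n, M (n + 1) →ₗ[F] M n} {X A : ∀ n, Submodule F (M n)}
    (α : ∀ n, P.X n →ₗ[F] M (n + 1))
    (hX : ∀ n, LinearMap.range (α n) = X (n + 1)) (hA0 : A 0 = ⊤)
    (hd : ∀ n c, d (n + 1) (α (n + 1) c) = α n ((P.d (n + 1) n).hom c))
    (hπ : ∀ n, Function.Surjective (π.f n))
    (hker : ∀ n c, π.f n c = 0 ↔ α n c ∈ A (n + 1)) (i : ℕ) :
    Module.rank F (C.homology i) = Module.rank F (RelHomology d X A i) := by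
  have hcomm (k l) (c) : (C.d k l).hom (π.f k c) = π.f l ((P.d k l).hom c) :=
    congrArg (fun f => f.hom c) (π.comm k l)
  let Z : Submodule F (P.X i) := (A i).comap (d i ∘ₗ α i)
  let B : Submodule F Z :=
    ((relBoundaries d X A i).comap (α i)).submoduleOf Z
  -- An element of `C` is a cycle iff its representatives are relative cycles
  have hcyc (c : P.X i) : π.f i c ∈ LinearMap.ker (C.sc i).g.hom ↔ c ∈ Z := by
    change (C.d i _).hom (π.f i c) = 0 ↔ d i (α i c) ∈ A i
    rw [hcomm]
    cases i with
    | zero =>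
      rw [hA0, P.shape 0 _ (by simp)]
      simp
    | succ m =>
      rw [hd, hker, ChainComplex.next_nat_succ]
  have hbd (c : P.X i) : (∃ y, (C.d ((ComplexShape.down ℕ).prev i) i).hom y = π.f i c) ↔
      α i c ∈ relBoundaries d X A i := by
    rw [ChainComplex.prev, mem_relBoundaries]
    constructor
    · rintro ⟨y, hy⟩
      obtain ⟨y, rfl⟩ := hπ _ y
      refine ⟨α (i + 1) y, hX (i + 1) ▸ ⟨y, rfl⟩, ?_⟩
      rw [hd, ← map_sub, ← hker, map_sub, ← hy, hcomm, sub_self]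
    · rintro ⟨y, hy, h⟩
      rw [← hX] at hy
      obtain ⟨y, rfl⟩ := hy
      refine ⟨π.f (i + 1) y, ?_⟩
      rw [hd, ← map_sub, ← hker, map_sub, sub_eq_zero] at h
      rw [hcomm, h]
  let q₁ : Z →ₗ[F] (LinearMap.ker (C.sc i).g.hom ⧸ LinearMap.range (C.sc i).moduleCatToCycles) :=
    Submodule.mkQ _ ∘ₗ LinearMap.codRestrict _ ((π.f i).hom ∘ₗ Z.subtype)
      fun c => (hcyc c).mpr c.2
  have hs₁ : Function.Surjective q₁ := by
    intro q
    obtain ⟨⟨z, hz⟩, rfl⟩ := Submodule.mkQ_surjective _ q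
    obtain ⟨c, rfl⟩ := hπ i z
    exact ⟨⟨c, (hcyc c).mp hz⟩, rfl⟩
  have hk₁ : LinearMap.ker q₁ = B := by
    ext c
    rw [LinearMap.mem_ker, LinearMap.comp_apply, Submodule.mkQ_apply,
      Submodule.Quotient.mk_eq_zero, LinearMap.mem_range]
    refine Iff.trans ?_ (hbd c)
    exact exists_congr fun y => Subtype.ext_iff
  let q₂ : Z →ₗ[F] RelHomology d X A i :=
    Submodule.mkQ _ ∘ₗ LinearMap.codRestrict _ (α i ∘ₗ Z.subtype)
      fun c => ⟨hX i ▸ ⟨c, rfl⟩, c.2⟩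
  have hs₂ : Function.Surjective q₂ := by
    intro q
    obtain ⟨⟨z, hz, hz'⟩, rfl⟩ := Submodule.mkQ_surjective _ q
    change z ∈ X (i + 1) at hz
    rw [← hX] at hz
    obtain ⟨c, rfl⟩ := hz
    exact ⟨⟨c, hz'⟩, rfl⟩
  have hk₂ : LinearMap.ker q₂ = B := by
    ext c
    rw [LinearMap.mem_ker, LinearMap.comp_apply, Submodule.mkQ_apply,
      Submodule.Quotient.mk_eq_zero]
    rfl
  exact ((C.sc i).moduleCatHomologyIso.toLinearEquiv.trans
    ((q₁.quotKerEquivOfSurjective hs₁).symm.trans ((Submodule.quotEquivOfEq _ _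
      (hk₁.trans hk₂.symm)).trans (q₂.quotKerEquivOfSurjective hs₂)))).rank_eq

theorem degreewise_cokernel {P Q : ChainComplex (ModuleCat.{w} F) ℕ} (φ : P ⟶ Q) (n : ℕ) :
    Function.Surjective ((cokernel.π φ).f n) ∧
      ∀ c, (cokernel.π φ).f n c = 0 ↔ c ∈ LinearMap.range (φ.f n).hom := by
  constructor
  · have : Epi ((HomologicalComplex.eval (ModuleCat.{w} F) (ComplexShape.down ℕ) n).map
      (cokernel.π φ)) := inferInstance
    exact (ModuleCat.epi_iff_surjective _).mp this
  · intro c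
    have h := (HomologicalComplex.exact_iff_degreewise_exact _).mp
      (ShortComplex.exact_cokernel φ) n
    rw [ShortComplex.moduleCat_exact_iff_range_eq_ker] at h
    exact (SetLike.ext_iff.mp h c).symm

/-- Relative singular homology of a pair embedded in a space `E`, in terms of the singular chains
of `E` that lie in the images of the two members of the pair. -/
theorem rank_relSingularHomology {P : TopPair.{0}} {E : Type} [TopologicalSpace E]
    {j : C(P.fst, E)} (hj : Topology.IsEmbedding j) (i : ℕ) :
    Module.rank F (relSingularHomology F P i) =
      Module.rank F (RelHomology (fun n => singBoundary F n)
        (chainsWith F fun s : Set E => s ⊆ Set.range j)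
        (chainsWith F fun s : Set E => s ⊆ Set.range (j.comp P.map.hom)) i) := by
  have hsub : Topology.IsEmbedding (j.comp P.map.hom) := hj.comp P.isEmbedding_map
  let φ := SSet.chainComplexMap (TopCat.toSSet.map P.map) (ModuleCat.of F F)
  refine rank_homology_eq_rank_relHomology (cokernel.π φ) (fun n => chainImage F j n)
    (fun n => range_chainImage hj.isInducing n) ?_ ?_ (fun n => (degreewise_cokernel φ n).1)
    (fun n c => ?_) i
  · rw [eq_top_iff]
    intro x _
    refine fun σ _ => ?_
    rintro _ ⟨p, rfl⟩
    have h := p.2.2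
    simp at h
  · intro n c
    exact singBoundary_chainImage j n c
  · rw [(degreewise_cokernel φ n).2, ← range_chainImage hsub.isInducing]
    constructor
    · rintro ⟨y, rfl⟩
      exact ⟨y, (chainImage_map P.map j n y).symm⟩
    · rintro ⟨y, hy⟩
      exact ⟨y, chainImage_injective hj.injective n ((chainImage_map P.map j n y).trans hy)⟩

end Transport

/-! ### Critical multiplicities as dimensions of simplicial homology -/

section Multiplicity

universe w

variable {V : Type} [Fintype V] [LinearOrder V] {K : AbstractSimplicialComplex V}
  {f : K.realization → ℝ}

theorem IsRSL.eq_height (hf : IsRSL K f) (x : K.realization) :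
    f x = height (fun u => f (K.vertexPoint u)) x.1 := by
  obtain ⟨hx, s, hs, hxs⟩ := mem_realization_iff.mp x.2
  obtain ⟨g, hg⟩ := hf.linear s hs
  have hvert (u : V) (hu : u ∈ s) : f (K.vertexPoint u) = g (Pi.single u 1) := by
    refine hg _ ⟨single_mem_stdSimplex ℝ u, fun w hw => Pi.single_eq_of_ne ?_ _⟩
    rintro rfl
    exact hw hu
  have hdecomp (y : V → ℝ) : g y = g.linear y + g 0 := congrFun g.decomp y
  rw [hg x ⟨hx, hxs⟩, hdecomp, height]
  have hlin : g.linear x.1 = ∑ u, x.1 u * g.linear (Pi.single u 1) := by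
    conv_lhs => rw [pi_eq_sum_univ' x.1, map_sum]
    simp only [map_smul, smul_eq_mul]
  have hone : g 0 = ∑ u, x.1 u * g 0 := by rw [← Finset.sum_mul, hx.2, one_mul]
  rw [hlin, hone, ← Finset.sum_add_distrib]
  refine Finset.sum_congr rfl fun u _ => ?_
  by_cases hu : u ∈ s
  · rw [hvert u hu, hdecomp (Pi.single u 1), mul_add]
  · simp [hxs u hu]

/-- The multiplicity of a vertex is the dimension of the simplicial homology of the complex of low
faces modulo those that avoid the vertex. -/
theorem critMultiplicity_eq_rank (F : Type w) [Field F] (hf : IsRSL K f) (v : V) (i : ℕ) :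
    critMultiplicity F f (K.vertexPoint v) i =
      Module.rank F (RelHomology (fun _ => faceBoundary F)
        (lowChains F K (fun u => f (K.vertexPoint u)) v)
        (lowChainsAway F K (fun u => f (K.vertexPoint u)) v) i) := by
  set a : V → ℝ := fun u => f (K.vertexPoint u) with ha
  let j : C((sublevelPair f (K.vertexPoint v)).fst, V → ℝ) :=
    ⟨fun y => y.1.1, continuous_subtype_val.comp continuous_subtype_val⟩
  have hj : Topology.IsEmbedding j :=
    Topology.IsEmbedding.subtypeVal.comp Topology.IsEmbedding.subtypeVal
  have h₁ : Set.range j = sublevel K a v := by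
    ext x
    constructor
    · rintro ⟨y, rfl⟩
      exact ⟨y.1.2, (hf.eq_height y.1).symm.trans_le y.2⟩
    · rintro ⟨hx, h⟩
      exact ⟨⟨⟨x, hx⟩, (hf.eq_height ⟨x, hx⟩).trans_le h⟩, rfl⟩
  have h₂ : Set.range (j.comp (sublevelPair f (K.vertexPoint v)).map.hom) =
      puncturedSublevel K a v := by
    ext x
    constructor
    · rintro ⟨y, rfl⟩
      refine ⟨h₁ ▸ ⟨y.1, rfl⟩, fun h => y.2 (Subtype.ext h)⟩
    · rintro ⟨⟨hx, h⟩, hne⟩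
      exact ⟨⟨⟨⟨x, hx⟩, (hf.eq_height ⟨x, hx⟩).trans_le h⟩, fun h => hne (congrArg Subtype.val h)⟩,
        rfl⟩
  rw [critMultiplicity, rank_relSingularHomology hj, h₁, h₂]
  obtain ⟨e₁⟩ := nonempty_equiv_starComplement (F := F) (K := K) (a := a) (v := v) i
  obtain ⟨e₂⟩ := nonempty_low_equiv_starComplement (F := F) (K := K) (a := a) (v := v) i
  rw [← e₁.rank_eq]
  exact e₂.symm.rank_eq

end Multiplicity

/-! ### Dimensions of the homology of low faces -/

section LowHomology

set_option linter.unusedSectionVars false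

variable {F : Type*} [Field F]

section Boundary

variable {V : Type*} [LinearOrder V]

theorem mem_facesWith {Q : Finset V → Prop} {c : Finset V →₀ F} :
    c ∈ facesWith F Q ↔ ∀ s, c s ≠ 0 → Q s := by
  rw [facesWith, Finsupp.mem_supported]
  exact ⟨fun h s hs => h (Finsupp.mem_support_iff.mpr hs),
    fun h s hs => h s (Finsupp.mem_support_iff.mp hs)⟩

theorem faceBoundary_faceBoundary (c : Finset V →₀ F) : faceBoundary F (faceBoundary F c) = 0 := by
  suffices h : faceBoundary F ∘ₗ faceBoundary F = (0 : (Finset V →₀ F) →ₗ[F] _) from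
    LinearMap.congr_fun h c
  refine Finsupp.lhom_ext_one fun s => ?_
  rw [LinearMap.comp_apply, LinearMap.zero_apply]
  induction s using Finset.induction_on with
  | empty => rw [faceBoundary_single, Finset.sum_empty, map_zero]
  | insert x s hx ih =>
    have h : Finsupp.single (insert x s) 1 =
        positionSign F x s • wedge F x (Finsupp.single s (1 : F)) := by
      rw [wedge_single_of_notMem hx, smul_smul, positionSign_mul_self, one_smul]
    rw [h, map_smul, map_smul, faceBoundary_wedge, map_sub, faceBoundary_wedge, ih]
    simp

/-- The coefficients of a boundary, as a sum over the simplices that have `r` as a face. -/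
theorem faceBoundary_apply [Fintype V] (c : Finset V →₀ F) (r : Finset V) :
    faceBoundary F c r = ∑ x ∈ rᶜ, positionSign F x r * c (insert x r) := by
  suffices h : Finsupp.lapply r ∘ₗ faceBoundary F =
      ∑ x ∈ rᶜ, positionSign F x r • Finsupp.lapply (M := F) (R := F) (insert x r) by
    have := LinearMap.congr_fun h c
    simpa using this
  refine Finsupp.lhom_ext_one fun s => ?_
  rw [LinearMap.comp_apply, faceBoundary_single, map_sum, LinearMap.sum_apply]
  simp only [LinearMap.smul_apply, map_smul, Finsupp.lapply_apply, Finsupp.single_apply,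
    smul_eq_mul, mul_ite, mul_one, mul_zero]
  rw [← Finset.sum_filter, ← Finset.sum_filter]
  have hset : s.filter (fun x => s.erase x = r) = rᶜ.filter fun x => s = insert x r := by
    ext x
    simp only [Finset.mem_filter, Finset.mem_compl]
    constructor
    · rintro ⟨hx, rfl⟩
      exact ⟨Finset.notMem_erase x s, (Finset.insert_erase hx).symm⟩
    · rintro ⟨hx, rfl⟩
      exact ⟨Finset.mem_insert_self x r, Finset.erase_insert hx⟩
  rw [hset]
  refine Finset.sum_congr rfl fun x hx => ?_
  rw [(Finset.mem_filter.mp hx).2, positionSign_insert_self]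

end Boundary

section Dimension

variable {M : ℕ → Type*} [∀ n, AddCommGroup (M n)] [∀ n, Module F (M n)]
  [∀ n, FiniteDimensional F (M n)] {d : ∀ n, M (n + 1) →ₗ[F] M n} {X A : ∀ n, Submodule F (M n)}

theorem finrank_relHomology_add (n : ℕ) (h : relBoundaries d X A n ≤ relCycles d X A n) :
    Module.finrank F (RelHomology d X A n) + Module.finrank F (relBoundaries d X A n) =
      Module.finrank F (relCycles d X A n) := by
  rw [← (Submodule.submoduleOfEquivOfLe h).finrank_eq]
  exact Submodule.finrank_quotient_add_finrank _

theorem finrank_map_mkQ_add {N : Type*} [AddCommGroup N] [Module F N] [FiniteDimensional F N]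
    {A B : Submodule F N} (h : A ≤ B) :
    Module.finrank F (B.map A.mkQ) + Module.finrank F A = Module.finrank F B := by
  have hk := LinearMap.finrank_range_add_finrank_ker (A.mkQ ∘ₗ B.subtype)
  rw [LinearMap.range_comp, Submodule.range_subtype, LinearMap.ker_comp, Submodule.ker_mkQ] at hk
  rw [← hk, ← (Submodule.submoduleOfEquivOfLe h).finrank_eq]
  rfl

/-- The dimension formula for the map `X (n + 1) → M n ⧸ A n` induced by the differential. -/
theorem finrank_relCycles_add (n : ℕ) :
    Module.finrank F (relCycles d X A n) +
        Module.finrank F ((X (n + 1)).map (d n) ⊔ A n : Submodule F (M n)) =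
      Module.finrank F (X (n + 1)) + Module.finrank F (A n) := by
  have hk := LinearMap.finrank_range_add_finrank_ker ((A n).mkQ ∘ₗ d n ∘ₗ (X (n + 1)).subtype)
  have hr : LinearMap.range ((A n).mkQ ∘ₗ d n ∘ₗ (X (n + 1)).subtype) =
      ((X (n + 1)).map (d n) ⊔ A n).map (A n).mkQ := by
    rw [LinearMap.range_comp, LinearMap.range_comp, Submodule.range_subtype, Submodule.map_sup,
      Submodule.mkQ_map_self, sup_bot_eq]
  have hle : relCycles d X A n ≤ X (n + 1) := inf_le_left
  have hker : LinearMap.ker ((A n).mkQ ∘ₗ d n ∘ₗ (X (n + 1)).subtype) =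
      (relCycles d X A n).submoduleOf (X (n + 1)) := by
    rw [LinearMap.ker_comp, Submodule.ker_mkQ]
    ext x
    exact ⟨fun h => ⟨x.2, h⟩, fun h => h.2⟩
  rw [hr, hker, (Submodule.submoduleOfEquivOfLe hle).finrank_eq] at hk
  rw [← hk, ← finrank_map_mkQ_add (le_sup_right : A n ≤ (X (n + 1)).map (d n) ⊔ A n)]
  ring

end Dimension

variable {V : Type} [Fintype V] [LinearOrder V] {K : AbstractSimplicialComplex V} {a : V → ℝ}
  {v : V}

theorem IsLowFace.subset {s t : Finset V} (ht : IsLowFace K a v t) (hst : s ⊆ t) :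
    IsLowFace K a v s :=
  ⟨fun hs => (K.isRelLowerSet_faces (ht.1 (hs.mono hst))).2 hst hs, fun u hu => ht.2 u (hst hu)⟩

theorem lowChainsAway_le (n : ℕ) : lowChainsAway F K a v n ≤ lowChains F K a v n :=
  Finsupp.supported_mono fun _ h => ⟨h.1.1, h.2⟩

theorem faceBoundary_mem_lowChains {n : ℕ} {c : Finset V →₀ F}
    (hc : c ∈ lowChains F K a v (n + 1)) : faceBoundary F c ∈ lowChains F K a v n :=
  faceBoundary_mem (fun s hs x hx => ⟨hs.1.subset (Finset.erase_subset x s), by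
    rw [Finset.card_erase_of_mem hx, hs.2, Nat.add_sub_cancel]⟩) hc

theorem mem_lowChainsAway_iff {n : ℕ} {c : Finset V →₀ F} :
    c ∈ lowChainsAway F K a v n ↔ c ∈ lowChains F K a v n ∧ ∀ s, v ∈ s → c s = 0 := by
  simp only [lowChainsAway, lowChains, mem_facesWith]
  constructor
  · intro h
    refine ⟨fun s hs => ⟨(h s hs).1.1, (h s hs).2⟩, fun s hv => ?_⟩
    by_contra hs
    exact (h s hs).1.2 hv
  · intro h s hs
    exact ⟨⟨(h.1 s hs).1, fun hv => hs (h.2 s hv)⟩, (h.1 s hs).2⟩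

variable (F K a v) in
/-- The homology of the complex of low faces modulo those avoiding `v`. -/
abbrev LowHomology (n : ℕ) :=
  RelHomology (fun _ => faceBoundary F) (lowChains F K a v) (lowChainsAway F K a v) n

theorem mem_low_relCycles {n : ℕ} {c : Finset V →₀ F} :
    c ∈ relCycles (fun _ => faceBoundary F) (lowChains F K a v) (lowChainsAway F K a v) n ↔
      c ∈ lowChains F K a v (n + 1) ∧ ∀ r, v ∈ r → faceBoundary F c r = 0 := by
  rw [relCycles, Submodule.mem_inf, Submodule.mem_comap, mem_lowChainsAway_iff]
  exact and_congr_right fun h => and_iff_right (faceBoundary_mem_lowChains h)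

theorem mem_low_relBoundaries {n : ℕ} {c : Finset V →₀ F} (hc : c ∈ lowChains F K a v (n + 1)) :
    c ∈ relBoundaries (fun _ => faceBoundary F) (lowChains F K a v) (lowChainsAway F K a v) n ↔
      ∃ y ∈ lowChains F K a v (n + 2), ∀ r, v ∈ r → faceBoundary F y r = c r := by
  rw [mem_relBoundaries]
  refine exists_congr fun y => and_congr_right fun hy => ?_
  rw [mem_lowChainsAway_iff, and_iff_right (Submodule.sub_mem _ hc (faceBoundary_mem_lowChains hy))]
  refine forall₂_congr fun r _ => ?_
  rw [Finsupp.sub_apply, sub_eq_zero, eq_comm]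

theorem finrank_lowHomology_eq_zero {n : ℕ}
    (h : ∀ c ∈ lowChains F K a v (n + 1), (∀ r, v ∈ r → faceBoundary F c r = 0) →
      ∃ y ∈ lowChains F K a v (n + 2), ∀ r, v ∈ r → faceBoundary F y r = c r) :
    Module.finrank F (LowHomology F K a v n) = 0 := by
  have : Subsingleton (LowHomology F K a v n) := by
    refine Submodule.Quotient.subsingleton_iff.mpr ?_
    refine Submodule.comap_subtype_eq_top.mpr fun c hc => ?_
    rw [mem_low_relCycles] at hc
    exact (mem_low_relBoundaries hc.1).mpr (h c hc.1 hc.2)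
  exact Module.finrank_zero_of_subsingleton

theorem finrank_lowHomology_eq_one {n : ℕ} {e : Finset V →₀ F} (he : e ∈ lowChains F K a v (n + 1))
    (hcycle : ∀ r, v ∈ r → faceBoundary F e r = 0) (hne : ∃ t, v ∈ t ∧ e t ≠ 0)
    (hzero : ∀ y ∈ lowChains F K a v (n + 2), ∀ r, v ∈ r → faceBoundary F y r = 0)
    (h : ∀ c ∈ lowChains F K a v (n + 1), (∀ r, v ∈ r → faceBoundary F c r = 0) →
      ∃ μ : F, ∀ t, v ∈ t → c t = μ * e t) :
    Module.finrank F (LowHomology F K a v n) = 1 := by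
  refine finrank_eq_one (Submodule.Quotient.mk ⟨e, mem_low_relCycles.mpr ⟨he, hcycle⟩⟩) ?_ ?_
  · intro h0
    rw [Submodule.Quotient.mk_eq_zero] at h0
    obtain ⟨y, hy, hye⟩ := (mem_low_relBoundaries he).mp h0
    obtain ⟨t, hvt, ht⟩ := hne
    exact ht ((hye t hvt).symm.trans (hzero y hy t hvt))
  · intro q
    obtain ⟨⟨c, hc⟩, rfl⟩ := Submodule.Quotient.mk_surjective _ q
    rw [mem_low_relCycles] at hc
    obtain ⟨μ, hμ⟩ := h c hc.1 hc.2
    refine ⟨μ, ?_⟩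
    rw [← Submodule.Quotient.mk_smul, Submodule.Quotient.eq]
    refine (mem_low_relBoundaries (Submodule.sub_mem _ (Submodule.smul_mem _ μ he) hc.1)).mpr
      ⟨0, Submodule.zero_mem _, fun r hr => ?_⟩
    simp [hμ r hr]

theorem eq_singleton_of_lowest (ha : Function.Injective a) (hv : ∀ u, a v ≤ a u) {t : Finset V}
    (ht : IsLowFace K a v t) (hvt : v ∈ t) : t = {v} :=
  Finset.eq_singleton_iff_unique_mem.mpr
    ⟨hvt, fun u hu => ha (le_antisymm (ht.2 u hu) (hv u))⟩

theorem finrank_lowHomology_of_lowest (ha : Function.Injective a) (hv : ∀ u, a v ≤ a u) {n : ℕ}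
    (hn : n ≠ 0) : Module.finrank F (LowHomology F K a v n) = 0 := by
  refine finrank_lowHomology_eq_zero fun c hc _ => ⟨0, Submodule.zero_mem _, fun r hr => ?_⟩
  by_contra hne
  rw [map_zero, Finsupp.zero_apply] at hne
  obtain ⟨hlow, hcard⟩ := mem_facesWith.mp hc r (Ne.symm hne)
  rw [eq_singleton_of_lowest ha hv hlow hr, Finset.card_singleton] at hcard
  omega

theorem finrank_lowHomology_zero_of_lowest (ha : Function.Injective a) (hv : ∀ u, a v ≤ a u) :
    Module.finrank F (LowHomology F K a v 0) = 1 := by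
  refine finrank_lowHomology_eq_one (e := Finsupp.single {v} 1) ?_ ?_ ⟨{v}, by simp⟩ ?_ ?_
  · refine single_mem_facesWith ⟨⟨fun _ => K.singleton_mem v, fun u hu => ?_⟩, by simp⟩ 1
    rw [Finset.mem_singleton.mp hu]
  · intro r hr
    rw [faceBoundary_apply]
    refine Finset.sum_eq_zero fun x hx => ?_
    rw [Finsupp.single_eq_of_ne, mul_zero]
    intro heq
    have hxv : x = v := Finset.mem_singleton.mp (heq ▸ Finset.mem_insert_self x r)
    exact Finset.mem_compl.mp hx (hxv ▸ hr)
  · intro y hy r hr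
    rw [faceBoundary_apply]
    refine Finset.sum_eq_zero fun x hx => ?_
    by_contra hne
    obtain ⟨hlow, hcard⟩ := mem_facesWith.mp hy _ (right_ne_zero_of_mul hne)
    rw [eq_singleton_of_lowest ha hv hlow (Finset.mem_insert_of_mem hr),
      Finset.card_singleton] at hcard
    omega
  · intro c hc _
    refine ⟨c {v}, fun t hvt => ?_⟩
    by_cases ht : t = {v}
    · rw [ht, Finsupp.single_eq_same, mul_one]
    · rw [Finsupp.single_eq_of_ne ht, mul_zero]
      by_contra hne
      exact ht (eq_singleton_of_lowest ha hv (mem_facesWith.mp hc t hne).1 hvt)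

open Classical in
/-- The number of low faces with `n` vertices that contain `v`. -/
noncomputable def lowStarCount (K : AbstractSimplicialComplex V) (a : V → ℝ) (v : V) (n : ℕ) : ℕ :=
  (Finset.univ.filter fun t : Finset V => (IsLowFace K a v t ∧ v ∈ t) ∧ t.card = n).card

theorem finrank_facesWith {V : Type*} [Fintype V] (Q : Finset V → Prop) [DecidablePred Q] :
    Module.finrank F (facesWith F Q) = (Finset.univ.filter Q).card := by
  rw [facesWith, (Finsupp.supportedEquivFinsupp (R := F) (M := F) {s | Q s}).finrank_eq,
    Module.finrank_finsupp_self]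
  exact Fintype.card_subtype Q

theorem finrank_lowChains (n : ℕ) : Module.finrank F (lowChains F K a v n) =
    lowStarCount K a v n + Module.finrank F (lowChainsAway F K a v n) := by
  classical
  rw [lowChains, lowChainsAway, finrank_facesWith, finrank_facesWith, lowStarCount,
    ← Finset.card_union_of_disjoint]
  · congr 1
    ext t
    simp only [Finset.mem_filter, Finset.mem_union, Finset.mem_univ, true_and]
    tauto
  · rw [Finset.disjoint_filter]
    tauto

/-- The Euler–Poincaré formula for a complex of dimension at most four. -/
theorem euler_lowHomology (hK : ∀ t ∈ K.faces, t.card ≤ 5) :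
    (Module.finrank F (LowHomology F K a v 0) : ℤ) - Module.finrank F (LowHomology F K a v 1) +
        Module.finrank F (LowHomology F K a v 2) - Module.finrank F (LowHomology F K a v 3) +
        Module.finrank F (LowHomology F K a v 4) =
      lowStarCount K a v 1 - lowStarCount K a v 2 + lowStarCount K a v 3 - lowStarCount K a v 4 +
        lowStarCount K a v 5 := by
  let d : ∀ n : ℕ, (Finset V →₀ F) →ₗ[F] (Finset V →₀ F) := fun _ => faceBoundary F
  let X := lowChains F K a v
  let A := lowChainsAway F K a v
  let b (n : ℕ) : ℕ :=
    Module.finrank F ((X (n + 1)).map (d n) ⊔ A n : Submodule F (Finset V →₀ F))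
  have hX (n : ℕ) : Module.finrank F (X n) = lowStarCount K a v n + Module.finrank F (A n) :=
    finrank_lowChains n
  have hz (n : ℕ) : Module.finrank F (relCycles d X A n) + b n =
      Module.finrank F (X (n + 1)) + Module.finrank F (A n) :=
    finrank_relCycles_add (M := fun _ => Finset V →₀ F) (d := d) (X := X) (A := A) n
  have hh (n : ℕ) : Module.finrank F (LowHomology F K a v n) + b (n + 1) =
      Module.finrank F (relCycles d X A n) := by
    refine finrank_relHomology_add n (sup_le ?_ ?_)
    · rintro _ ⟨y, hy, rfl⟩
      exact mem_low_relCycles.mpr ⟨faceBoundary_mem_lowChains hy, fun r _ => by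
        change faceBoundary F (faceBoundary F y) r = 0
        rw [faceBoundary_faceBoundary, Finsupp.zero_apply]⟩
    · intro c hc
      refine ⟨lowChainsAway_le _ hc, ?_⟩
      exact faceBoundary_mem (fun s hs x hx => ⟨⟨hs.1.1.subset (Finset.erase_subset x s),
        fun h => hs.1.2 (Finset.mem_of_mem_erase h)⟩, by
        rw [Finset.card_erase_of_mem hx, hs.2, Nat.add_sub_cancel]⟩) hc
  -- There are no chains without vertices relative to the chains away from `v`
  have hb0 : b 0 = Module.finrank F (A 0) := by
    have : (X 1).map (d 0) ≤ A 0 := by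
      rintro _ ⟨y, hy, rfl⟩
      refine mem_lowChainsAway_iff.mpr ⟨faceBoundary_mem_lowChains hy, fun s hv => ?_⟩
      by_contra h
      have := (mem_facesWith.mp (faceBoundary_mem_lowChains hy) s h).2
      rw [Finset.card_eq_zero] at this
      simp [this] at hv
    change Module.finrank F ((X 1).map (d 0) ⊔ A 0 : Submodule F _) = _
    rw [sup_eq_right.mpr this]
  have hb5 : b 5 = Module.finrank F (A 5) := by
    have : X 6 = ⊥ := by
      rw [eq_bot_iff]
      intro y hy
      ext s
      by_contra h
      obtain ⟨h1, h2⟩ := mem_facesWith.mp hy s h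
      have := hK s (h1.1 (Finset.card_pos.mp (by omega)))
      omega
    change Module.finrank F ((X 6).map (d 5) ⊔ A 5 : Submodule F _) = _
    rw [this, Submodule.map_bot, bot_sup_eq]
  have e0 := hh 0; have e1 := hh 1; have e2 := hh 2; have e3 := hh 3; have e4 := hh 4
  have z0 := hz 0; have z1 := hz 1; have z2 := hz 2; have z3 := hz 3; have z4 := hz 4
  have x1 := hX 1; have x2 := hX 2; have x3 := hX 3; have x4 := hX 4; have x5 := hX 5
  simp only [Nat.reduceAdd] at e0 e1 e2 e3 e4 z0 z1 z2 z3 z4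
  omega

open Classical in
/-- Every face is counted at its highest vertex. -/
theorem sum_lowStarCount (ha : Function.Injective a) {n : ℕ} (hn : n ≠ 0) :
    ∑ v, lowStarCount K a v n =
      (Finset.univ.filter fun t : Finset V => t ∈ K.faces ∧ t.card = n).card := by
  simp only [lowStarCount, Finset.card_filter]
  rw [Finset.sum_comm]
  refine Finset.sum_congr rfl fun t _ => ?_
  rw [← Finset.card_filter]
  by_cases ht : t ∈ K.faces ∧ t.card = n
  · obtain ⟨ht, hcard⟩ := ht
    have hne : t.Nonempty := Finset.card_pos.mp (by omega)
    obtain ⟨w, hw, hmax⟩ := t.exists_max_image a hne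
    rw [if_pos ⟨ht, hcard⟩, Finset.card_eq_one]
    refine ⟨w, Finset.eq_singleton_iff_unique_mem.mpr ⟨?_, fun u hu => ?_⟩⟩
    · simpa [hw, hcard] using ⟨fun _ => ht, hmax⟩
    · obtain ⟨⟨hlow, hut⟩, -⟩ := (Finset.mem_filter.mp hu).2
      exact ha (le_antisymm (hmax u hut) (hlow.2 w hw))
  · rw [if_neg ht, Finset.card_eq_zero, Finset.filter_eq_empty_iff]
    rintro u - ⟨⟨hlow, hut⟩, hcard⟩
    exact ht ⟨hlow.1 ⟨u, hut⟩, hcard⟩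

end LowHomology

/-! ### Neighborly triangulated four-manifolds with collapsible links -/

section TightManifold

set_option linter.unusedSectionVars false

variable {V : Type} [Fintype V] [LinearOrder V]

/-- A collapse of the link of `v` without one of its facets, given by the pairs of a free face and
the simplex that is removed with it. Simplices of the link are represented by their joins with `v`:
the pairs of `L₃` consist of a 3-simplex and a facet, those of `L₂` of a triangle and a 3-simplex.
The collapse stops when all 3-simplices at `v` are used up, as a free face in `L₃` or as a removed
simplex in `L₂`. -/
structure IsLinkCollapse (facet : Finset V → Prop) (v : V)
    (L₃ L₂ : List (Finset V × Finset V)) : Prop where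
  mem₃ : ∀ p ∈ L₃, facet p.2 ∧ p.1 ⊆ p.2 ∧ p.1.card = 4 ∧ v ∈ p.1
  mem₂ : ∀ p ∈ L₂, p.1 ⊆ p.2 ∧ p.1.card = 3 ∧ p.2.card = 4 ∧ v ∈ p.1
  free₃ : L₃.Pairwise fun p q => ¬p.1 ⊆ q.2
  free₂ : L₂.Pairwise fun p q => ¬p.1 ⊆ q.2
  cover : ∀ t, facet t → ∀ r ⊆ t, r.card = 4 → v ∈ r → (∃ p ∈ L₃, p.1 = r) ∨ ∃ p ∈ L₂, p.2 = r

/-- The combinatorial properties of a family of 5-element sets that determine the critical points of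
simplexwise linear functions: every three vertices span a face, the facets carry signs for which the
signed sum of the facets is a cycle, links of edges are strongly connected, and links of vertices
collapse after the removal of a facet. -/
structure IsNeighborlyManifold (facet : Finset V → Prop) (orientation : Finset V → ℤ) : Prop where
  card_eq : ∀ t, facet t → t.card = 5
  neighborly : ∀ u v w, ∃ t, facet t ∧ u ∈ t ∧ v ∈ t ∧ w ∈ t
  isUnit : ∀ t, facet t → IsUnit (orientation t)
  eq_zero : ∀ t, ¬facet t → orientation t = 0
  ridge : ∀ r : Finset V, r.card = 4 → (∃ t, facet t ∧ r ⊆ t) → ∃ x y, x ∉ r ∧ y ∉ r ∧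
    facet (insert x r) ∧ facet (insert y r) ∧ (∀ w, w ∉ r → facet (insert w r) → w = x ∨ w = y) ∧
    (-1) ^ (r.filter (· < x)).card * orientation (insert x r) +
      (-1) ^ (r.filter (· < y)).card * orientation (insert y r) = 0
  connected : ∀ u v, u ≠ v → ∀ P : Finset V → Prop,
    (∀ t t', facet t → facet t' → u ∈ t → v ∈ t → u ∈ t' → v ∈ t' → (t ∩ t').card = 4 →
      P t → P t') →
    ∀ t t', facet t → facet t' → u ∈ t → v ∈ t → u ∈ t' → v ∈ t' → P t → P t'
  collapse : ∀ v, ∃ L₃ L₂, IsLinkCollapse facet v L₃ L₂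

namespace IsNeighborlyManifold

variable (F : Type*) [Field F] {facet : Finset V → Prop} {orientation : Finset V → ℤ}

/-- The signed sum of all facets. -/
noncomputable def fundamentalCycle (orientation : Finset V → ℤ) : Finset V →₀ F :=
  Finsupp.equivFunOnFinite.symm fun t => (orientation t : F)

variable {F}

theorem fundamentalCycle_apply (t : Finset V) :
    fundamentalCycle F orientation t = (orientation t : F) := rfl

variable (h : IsNeighborlyManifold facet orientation)
include h

theorem fundamentalCycle_ne_zero {t : Finset V} (ht : facet t) :
    fundamentalCycle F orientation t ≠ 0 :=
  ((h.isUnit t ht).map (Int.castRingHom F)).ne_zero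

theorem facet_of_fundamentalCycle_ne_zero {t : Finset V} (ht : fundamentalCycle F orientation t ≠ 0) :
    facet t := by
  by_contra hn
  rw [fundamentalCycle_apply, h.eq_zero t hn, Int.cast_zero] at ht
  exact ht rfl

/-- A face of codimension one lies in exactly two facets, with cancelling orientations. -/
theorem exists_two_facets {r : Finset V} (hr : r.card = 4) (hrt : ∃ t, facet t ∧ r ⊆ t) :
    ∃ x y, x ∉ r ∧ y ∉ r ∧ insert x r ≠ insert y r ∧ facet (insert x r) ∧ facet (insert y r) ∧
      (∀ t, facet t → r ⊆ t → t = insert x r ∨ t = insert y r) ∧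
      (-1) ^ (r.filter (· < x)).card * orientation (insert x r) +
        (-1) ^ (r.filter (· < y)).card * orientation (insert y r) = 0 := by
  obtain ⟨x, y, hx, hy, hxt, hyt, honly, hsign⟩ := h.ridge r hr hrt
  refine ⟨x, y, hx, hy, fun heq => ?_, hxt, hyt, fun t ht hrt => ?_, hsign⟩
  · -- Otherwise `x = y`, and the orientation of a facet would be zero
    have hxy : x ∈ insert y r := heq ▸ Finset.mem_insert_self x r
    obtain rfl := (Finset.mem_insert.mp hxy).resolve_right hx
    have h2 : (-1 : ℤ) ^ (r.filter (· < x)).card * orientation (insert x r) = 0 := by linarith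
    exact mul_ne_zero (pow_ne_zero _ (by norm_num)) (h.isUnit _ hxt).ne_zero h2
  · obtain ⟨w, hw⟩ : (t \ r).Nonempty := by
      rw [← Finset.card_pos, Finset.card_sdiff_of_subset hrt, h.card_eq t ht, hr]
      norm_num
    obtain ⟨hwt, hwr⟩ := Finset.mem_sdiff.mp hw
    have heq : insert w r = t := by
      refine Finset.eq_of_subset_of_card_le (Finset.insert_subset hwt hrt) ?_
      rw [Finset.card_insert_of_notMem hwr, hr, h.card_eq t ht]
    rcases honly w hwr (heq ▸ ht) with rfl | rfl
    exacts [Or.inl heq.symm, Or.inr heq.symm]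

/-- The boundary of a chain of facets at a face of codimension one has two terms, and these cancel
for the fundamental cycle. -/
theorem exists_boundary_eq {r : Finset V} (hr : r.card = 4) (hrt : ∃ t, facet t ∧ r ⊆ t) :
    ∃ x y, (∀ t, facet t → r ⊆ t → t = insert x r ∨ t = insert y r) ∧
      (∀ c : Finset V →₀ F, (∀ t, c t ≠ 0 → facet t) → faceBoundary F c r =
        positionSign F x r * c (insert x r) + positionSign F y r * c (insert y r)) ∧
      positionSign F x r * fundamentalCycle F orientation (insert x r) +
        positionSign F y r * fundamentalCycle F orientation (insert y r) = 0 := by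
  obtain ⟨x, y, hx, hy, hxy, -, -, honly, hsign⟩ := h.exists_two_facets hr hrt
  have hne : x ≠ y := fun heq => hxy (heq ▸ rfl)
  refine ⟨x, y, honly, fun c hc => ?_, ?_⟩
  · rw [faceBoundary_apply,
      ← Finset.sum_pair (f := fun x => positionSign F x r * c (insert x r)) hne]
    refine (Finset.sum_subset ?_ fun w hw hwxy => ?_).symm
    · intro w hw
      rcases Finset.mem_insert.mp hw with rfl | hw
      · exact Finset.mem_compl.mpr hx
      · rw [Finset.mem_singleton] at hw
        exact Finset.mem_compl.mpr (hw ▸ hy)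
    · by_contra h0
      refine hwxy ?_
      rw [Finset.mem_insert, Finset.mem_singleton]
      have hw' (z) (hz : insert w r = insert z r) : w = z :=
        (Finset.mem_insert.mp (hz ▸ Finset.mem_insert_self w r)).resolve_right
          (Finset.mem_compl.mp hw)
      exact (honly _ (hc _ (right_ne_zero_of_mul h0)) (Finset.subset_insert w r)).imp
        (hw' x) (hw' y)
  · have := congrArg (Int.cast : ℤ → F) hsign
    push_cast at this
    exact this

theorem faceBoundary_fundamentalCycle :
    faceBoundary F (fundamentalCycle F orientation) = 0 := by
  ext r
  rw [Finsupp.zero_apply]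
  by_cases hr : r.card = 4 ∧ ∃ t, facet t ∧ r ⊆ t
  · obtain ⟨x, y, -, hbd, hz⟩ := h.exists_boundary_eq (F := F) hr.1 hr.2
    rw [hbd _ fun _ => h.facet_of_fundamentalCycle_ne_zero, hz]
  · rw [faceBoundary_apply]
    refine Finset.sum_eq_zero fun w hw => ?_
    by_contra hne
    have hf := h.facet_of_fundamentalCycle_ne_zero (right_ne_zero_of_mul hne)
    refine hr ⟨?_, _, hf, Finset.subset_insert w r⟩
    have := h.card_eq _ hf
    rw [Finset.card_insert_of_notMem (Finset.mem_compl.mp hw)] at this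
    omega

/-- A chain that is a cycle in the link of an edge is a multiple of the fundamental cycle there. -/
theorem exists_eq_mul_of_edge {c : Finset V →₀ F} (hc : ∀ t, c t ≠ 0 → facet t) {u v : V}
    (huv : u ≠ v) (hcycle : ∀ r, u ∈ r → v ∈ r → faceBoundary F c r = 0) :
    ∃ μ : F, ∀ t, facet t → u ∈ t → v ∈ t → c t = μ * fundamentalCycle F orientation t := by
  set z := fundamentalCycle F orientation with hz
  obtain ⟨t₀, ht₀, hu₀, hv₀, -⟩ := h.neighborly u v v
  refine ⟨c t₀ / z t₀, fun t ht hut hvt => ?_⟩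
  refine h.connected u v huv (fun t => c t = c t₀ / z t₀ * z t) ?_ t₀ t ht₀ ht hu₀ hv₀ hut hvt
    (div_mul_cancel₀ _ (h.fundamentalCycle_ne_zero ht₀)).symm
  intro s t hs ht hus hvs hut hvt hcard hcs
  obtain ⟨x, y, honly, hbd, hz0⟩ :=
    h.exists_boundary_eq (F := F) hcard ⟨s, hs, Finset.inter_subset_left⟩
  have hc0 := hbd c hc
  rw [hcycle _ (Finset.mem_inter.mpr ⟨hus, hut⟩) (Finset.mem_inter.mpr ⟨hvs, hvt⟩)] at hc0
  have hst : s ≠ t := by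
    rintro rfl
    rw [Finset.inter_self, h.card_eq s hs] at hcard
    omega
  have key (X Y : Finset V) (α β μ : F) (hβ : β ≠ 0) (h1 : 0 = α * c X + β * c Y)
      (h2 : α * z X + β * z Y = 0) (h3 : c X = μ * z X) : c Y = μ * z Y := by
    refine mul_left_cancel₀ hβ ?_
    linear_combination -μ * h2 - h1 - α * h3
  rcases honly s hs Finset.inter_subset_left with hs' | hs' <;>
    rcases honly t ht Finset.inter_subset_right with ht' | ht'
  · exact absurd (hs'.trans ht'.symm) hst
  · rw [← hs', ← ht'] at hc0 hz0
    exact key s t _ _ _ (positionSign_ne_zero _ _) hc0 hz0 hcs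
  · rw [← hs', ← ht', add_comm] at hc0 hz0
    exact key s t _ _ _ (positionSign_ne_zero _ _) hc0 hz0 hcs
  · exact absurd (hs'.trans ht'.symm) hst

/-- The multiples of the fundamental cycle in the links of several edges at `v` agree, since any two
edges at `v` lie in a common facet. -/
theorem exists_eq_mul_of_edges {c : Finset V →₀ F} (hc : ∀ t, c t ≠ 0 → facet t) {v : V}
    (S : Set V) (hv : v ∉ S)
    (hcycle : ∀ u ∈ S, ∀ r, u ∈ r → v ∈ r → faceBoundary F c r = 0) :
    ∃ μ : F, ∀ t, facet t → v ∈ t → (∃ u ∈ t, u ∈ S) →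
      c t = μ * fundamentalCycle F orientation t := by
  rcases S.eq_empty_or_nonempty with rfl | ⟨u₀, hu₀⟩
  · exact ⟨0, fun t _ _ ⟨u, _, hu⟩ => hu.elim⟩
  obtain ⟨μ, hμ⟩ := h.exists_eq_mul_of_edge hc (ne_of_mem_of_not_mem hu₀ hv) (hcycle u₀ hu₀)
  refine ⟨μ, fun t ht hvt ⟨u, hut, hu⟩ => ?_⟩
  obtain ⟨ν, hν⟩ := h.exists_eq_mul_of_edge hc (ne_of_mem_of_not_mem hu hv) (hcycle u hu)
  obtain ⟨t', ht', hu₀', hu', hv'⟩ := h.neighborly u₀ u v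
  have heq := (hμ t' ht' hu₀' hv').symm.trans (hν t' ht' hu' hv')
  rw [hν t ht hut hvt, mul_right_cancel₀ (h.fundamentalCycle_ne_zero ht') heq]

omit h in
/-- A chain can be made to vanish on the free faces of a collapse by subtracting a boundary. -/
theorem exists_sub_boundary_eq_zero {n : ℕ} (L : List (Finset V × Finset V))
    (hL : ∀ p ∈ L, p.1 ⊆ p.2 ∧ p.1.card = n ∧ p.2.card = n + 1)
    (hfree : L.Pairwise fun p q => ¬p.1 ⊆ q.2) (c : Finset V →₀ F) :
    ∃ y : Finset V →₀ F, (∀ t, y t ≠ 0 → ∃ p ∈ L, p.2 = t) ∧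
      ∀ p ∈ L, c p.1 - faceBoundary F y p.1 = 0 := by
  induction L generalizing c with
  | nil => exact ⟨0, fun t ht => absurd rfl ht, by simp⟩
  | cons p L ih =>
    obtain ⟨hp, hfree⟩ := List.pairwise_cons.mp hfree
    obtain ⟨hsub, hcard, hcard'⟩ := hL p List.mem_cons_self
    obtain ⟨x, hx⟩ : (p.2 \ p.1).Nonempty := by
      rw [← Finset.card_pos, Finset.card_sdiff_of_subset hsub]
      omega
    obtain ⟨hx2, hx1⟩ := Finset.mem_sdiff.mp hx
    have heq : insert x p.1 = p.2 := by
      refine Finset.eq_of_subset_of_card_le (Finset.insert_subset hx2 hsub) ?_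
      rw [Finset.card_insert_of_notMem hx1, hcard, hcard']
    let y₀ : Finset V →₀ F := Finsupp.single p.2 (positionSign F x p.1 * c p.1)
    have hy₀ : faceBoundary F y₀ p.1 = c p.1 := by
      rw [faceBoundary_apply, Finset.sum_eq_single_of_mem x (Finset.mem_compl.mpr hx1)]
      · rw [heq, Finsupp.single_eq_same, ← mul_assoc, positionSign_mul_self, one_mul]
      · intro w hw hwx
        rw [Finsupp.single_eq_of_ne, mul_zero]
        intro hw'
        have : w ∈ insert x p.1 := by
          rw [heq, ← hw']
          exact Finset.mem_insert_self w _
        rcases Finset.mem_insert.mp this with h | h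
        exacts [hwx h, Finset.mem_compl.mp hw h]
    obtain ⟨y, hy, hyL⟩ := ih (fun q hq => hL q (List.mem_cons_of_mem p hq)) hfree
      (c - faceBoundary F y₀)
    refine ⟨y₀ + y, fun t ht => ?_, fun q hq => ?_⟩
    · by_cases hyt : y t = 0
      · refine ⟨p, List.mem_cons_self, ?_⟩
        by_contra hne
        rw [Finsupp.add_apply, hyt, Finsupp.single_eq_of_ne (Ne.symm hne), add_zero] at ht
        exact ht rfl
      · obtain ⟨q, hq, h⟩ := hy t hyt
        exact ⟨q, List.mem_cons_of_mem p hq, h⟩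
    · rw [map_add, Finsupp.add_apply]
      rcases List.mem_cons.mp hq with rfl | hq
      · rw [hy₀, faceBoundary_apply y, Finset.sum_eq_zero, add_zero, sub_self]
        intro w _
        by_contra hne
        obtain ⟨q', hq', h⟩ := hy _ (right_ne_zero_of_mul hne)
        exact hp q' hq' (h ▸ Finset.subset_insert w _)
      · have := hyL q hq
        rw [Finsupp.sub_apply] at this
        rw [← this]
        ring

omit h in
/-- A chain that is supported on the simplices of a collapse vanishes, if its boundary vanishes on
the free faces. -/
theorem eq_zero_of_boundary_eq_zero {n : ℕ} (L : List (Finset V × Finset V))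
    (hL : ∀ p ∈ L, p.1 ⊆ p.2 ∧ p.1.card = n ∧ p.2.card = n + 1)
    (hfree : L.Pairwise fun p q => ¬p.1 ⊆ q.2) (c : Finset V →₀ F)
    (hc : ∀ p ∈ L, ∀ w ∉ p.1, c (insert w p.1) ≠ 0 → ∃ q ∈ L, q.2 = insert w p.1)
    (hbd : ∀ p ∈ L, faceBoundary F c p.1 = 0) : ∀ p ∈ L, c p.2 = 0 := by
  induction L with
  | nil => simp
  | cons p L ih =>
    obtain ⟨hp, hfree⟩ := List.pairwise_cons.mp hfree
    obtain ⟨hsub, hcard, hcard'⟩ := hL p List.mem_cons_self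
    obtain ⟨x, hx⟩ : (p.2 \ p.1).Nonempty := by
      rw [← Finset.card_pos, Finset.card_sdiff_of_subset hsub]
      omega
    obtain ⟨hx2, hx1⟩ := Finset.mem_sdiff.mp hx
    have heq : insert x p.1 = p.2 := by
      refine Finset.eq_of_subset_of_card_le (Finset.insert_subset hx2 hsub) ?_
      rw [Finset.card_insert_of_notMem hx1, hcard, hcard']
    have hp2 : c p.2 = 0 := by
      have h0 := hbd p List.mem_cons_self
      rw [faceBoundary_apply, Finset.sum_eq_single_of_mem x (Finset.mem_compl.mpr hx1)] at h0
      · rw [← heq]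
        exact (mul_eq_zero.mp h0).resolve_left (positionSign_ne_zero _ _)
      · intro w hw hwx
        by_contra hne
        obtain ⟨q, hq, h⟩ :=
          hc p List.mem_cons_self w (Finset.mem_compl.mp hw) (right_ne_zero_of_mul hne)
        rcases List.mem_cons.mp hq with rfl | hq
        · have : w ∈ insert x q.1 := by
            rw [heq, h]
            exact Finset.mem_insert_self w _
          rcases Finset.mem_insert.mp this with h | h
          exacts [hwx h, Finset.mem_compl.mp hw h]
        · exact hp q hq (h ▸ Finset.subset_insert w _)
    intro q hq
    rcases List.mem_cons.mp hq with rfl | hq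
    · exact hp2
    · refine ih (fun q hq => hL q (List.mem_cons_of_mem p hq)) hfree ?_
        (fun q hq => hbd q (List.mem_cons_of_mem p hq)) q hq
      intro q hq w hw hne
      obtain ⟨q', hq', h'⟩ := hc q (List.mem_cons_of_mem p hq) w hw hne
      rcases List.mem_cons.mp hq' with rfl | hq'
      · exact absurd (h' ▸ hp2) hne
      · exact ⟨q', hq', h'⟩

/-- The second homology group of the link of a vertex vanishes: a chain of 3-simplices whose
boundary avoids `v` is a boundary up to a chain avoiding `v`. -/
theorem exists_boundary_eq_of_link_cycle {v : V} {c : Finset V →₀ F}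
    (hc : ∀ s, c s ≠ 0 → s.card = 4 ∧ ∃ t, facet t ∧ s ⊆ t)
    (hcycle : ∀ q, v ∈ q → faceBoundary F c q = 0) :
    ∃ y : Finset V →₀ F, (∀ t, y t ≠ 0 → facet t) ∧ ∀ r, v ∈ r → faceBoundary F y r = c r := by
  obtain ⟨L₃, L₂, hL⟩ := h.collapse v
  obtain ⟨y, hy, hyL⟩ := exists_sub_boundary_eq_zero (n := 4) L₃
    (fun p hp => ⟨(hL.mem₃ p hp).2.1, (hL.mem₃ p hp).2.2.1, h.card_eq _ (hL.mem₃ p hp).1⟩)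
    hL.free₃ c
  have hyf (t) (ht : y t ≠ 0) : facet t := by
    obtain ⟨p, hp, rfl⟩ := hy t ht
    exact (hL.mem₃ p hp).1
  refine ⟨y, hyf, ?_⟩
  set w := c - faceBoundary F y with hw
  have hwf (s) (hs : w s ≠ 0) : s.card = 4 ∧ ∃ t, facet t ∧ s ⊆ t := by
    by_cases hcs : c s = 0
    · rw [hw, Finsupp.sub_apply, hcs, zero_sub, neg_ne_zero, faceBoundary_apply] at hs
      obtain ⟨x, hx, hne⟩ := Finset.exists_ne_zero_of_sum_ne_zero hs
      have hf := hyf _ (right_ne_zero_of_mul hne)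
      refine ⟨?_, _, hf, Finset.subset_insert x s⟩
      have := h.card_eq _ hf
      rw [Finset.card_insert_of_notMem (Finset.mem_compl.mp hx)] at this
      omega
    · exact hc s hcs
  have hcover (r) (hvr : v ∈ r) (hr : w r ≠ 0) : ∃ q ∈ L₂, q.2 = r := by
    obtain ⟨hcard, t, ht, hrt⟩ := hwf r hr
    rcases hL.cover t ht r hrt hcard hvr with ⟨p, hp, rfl⟩ | hq
    · exact absurd (hyL p hp) hr
    · exact hq
  have hzero := eq_zero_of_boundary_eq_zero (n := 3) L₂
    (fun p hp => ⟨(hL.mem₂ p hp).1, (hL.mem₂ p hp).2.1, (hL.mem₂ p hp).2.2.1⟩) hL.free₂ w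
    (fun p hp x _ hne => hcover _ (Finset.mem_insert_of_mem (hL.mem₂ p hp).2.2.2) hne)
    (fun p hp => by
      rw [hw, map_sub, faceBoundary_faceBoundary, sub_zero]
      exact hcycle _ (hL.mem₂ p hp).2.2.2)
  intro r hvr
  by_contra hne
  have hr : w r ≠ 0 := fun h0 => hne (sub_eq_zero.mp h0).symm
  obtain ⟨q, hq, rfl⟩ := hcover r hvr hr
  exact hr (hzero q hq)

end IsNeighborlyManifold

end TightManifold

/-! ### Multiplicities in neighborly manifolds -/

section TightManifold

set_option linter.unusedSectionVars false

variable {V : Type} [Fintype V] [LinearOrder V]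

namespace IsNeighborlyManifold

variable {F : Type*} [Field F] {facet : Finset V → Prop} {orientation : Finset V → ℤ}
  (h : IsNeighborlyManifold facet orientation) {K : AbstractSimplicialComplex V}
  (hK : ∀ s, s ∈ K.faces ↔ s.Nonempty ∧ ∃ t, facet t ∧ s ⊆ t) {a : V → ℝ} {v : V}
include h hK

theorem mem_faces_of_card_le {s : Finset V} (hne : s.Nonempty) (hs : s.card ≤ 3) : s ∈ K.faces := by
  refine (hK s).mpr ⟨hne, ?_⟩
  obtain ⟨w, hw⟩ := hne
  have hmem (n : ℕ) : ∀ s : Finset V, s.card ≤ n → ∃ l : List V, l.length = n ∧ ∀ u ∈ s, u ∈ l := by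
    intro s hs
    refine ⟨s.toList ++ List.replicate (n - s.card) w, ?_, fun u hu => ?_⟩
    · rw [List.length_append, Finset.length_toList, List.length_replicate]
      omega
    · exact List.mem_append_left _ (Finset.mem_toList.mpr hu)
  obtain ⟨l, hl, hsl⟩ := hmem 3 s hs
  obtain ⟨x, y, z, rfl⟩ := List.length_eq_three.mp hl
  obtain ⟨t, ht, hx, hy, hz⟩ := h.neighborly x y z
  refine ⟨t, ht, fun u hu => ?_⟩
  have := hsl u hu
  simp only [List.mem_cons, List.not_mem_nil, or_false] at this
  rcases this with rfl | rfl | rfl <;> assumption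

theorem card_le_of_mem_faces {s : Finset V} (hs : s ∈ K.faces) : s.card ≤ 5 := by
  obtain ⟨-, t, ht, hst⟩ := (hK s).mp hs
  exact (Finset.card_le_card hst).trans_eq (h.card_eq t ht)

theorem mem_faces_of_facet {t : Finset V} (ht : facet t) : t ∈ K.faces :=
  (hK t).mpr ⟨Finset.card_pos.mp (by rw [h.card_eq t ht]; norm_num), t, ht, subset_rfl⟩

theorem facet_of_mem_faces {t : Finset V} (ht : t ∈ K.faces) (hcard : t.card = 5) : facet t := by
  obtain ⟨-, t', ht', hsub⟩ := (hK t).mp ht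
  rwa [Finset.eq_of_subset_of_card_le hsub (by rw [hcard, h.card_eq t' ht'])]

/-- If `v` is not the lowest vertex, then the low link of `v` is connected and its 1-cycles bound
cones with apex a low vertex. -/
theorem finrank_lowHomology_of_lt {u₀ : V} (hu₀ : a u₀ < a v) {n : ℕ} (hn : n ≤ 1) :
    Module.finrank F (LowHomology F K a v n) = 0 := by
  refine finrank_lowHomology_eq_zero fun c hc hcycle => ?_
  refine ⟨wedge F u₀ c, ?_, fun r hr => ?_⟩
  · refine wedge_mem (fun s hs hus => ⟨⟨fun hne => ?_, fun u hu => ?_⟩, ?_⟩) hc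
    · refine h.mem_faces_of_card_le hK hne ?_
      rw [Finset.card_insert_of_notMem hus, hs.2]
      omega
    · rcases Finset.mem_insert.mp hu with rfl | hu
      exacts [hu₀.le, hs.1.2 u hu]
    · rw [Finset.card_insert_of_notMem hus, hs.2]
  · have haway : wedge F u₀ (faceBoundary F c) ∈ facesWith F fun s => v ∉ s := by
      refine wedge_mem (Q := fun s => v ∉ s) (fun s hs _ hv => ?_) (mem_facesWith.mpr fun s hs hv =>
        hs (hcycle s hv))
      rcases Finset.mem_insert.mp hv with rfl | hv
      exacts [lt_irrefl _ hu₀, hs hv]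
    have h0 : wedge F u₀ (faceBoundary F c) r = 0 := by
      by_contra hne
      exact mem_facesWith.mp haway r hne hr
    rw [faceBoundary_wedge, Finsupp.sub_apply, h0, sub_zero]

/-- The 3-cycles of the low star bound in the full star; the bounding chain can be moved to the low
star by a multiple of the fundamental cycle. -/
theorem finrank_lowHomology_three : Module.finrank F (LowHomology F K a v 3) = 0 := by
  refine finrank_lowHomology_eq_zero fun c hc hcycle => ?_
  have hcf (s) (hs : c s ≠ 0) : s.card = 4 ∧ ∃ t, facet t ∧ s ⊆ t := by
    obtain ⟨hlow, hcard⟩ := mem_facesWith.mp hc s hs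
    exact ⟨hcard, ((hK s).mp (hlow.1 (Finset.card_pos.mp (by omega)))).2⟩
  obtain ⟨y, hy, hyc⟩ := h.exists_boundary_eq_of_link_cycle hcf hcycle
  obtain ⟨μ, hμ⟩ := h.exists_eq_mul_of_edges hy (v := v) {u | a v < a u} (lt_irrefl (a v)) (by
    intro u hu r hur hvr
    rw [hyc r hvr]
    by_contra hne
    exact not_lt_of_ge ((mem_facesWith.mp hc r hne).1.2 u hur) hu)
  let y' := (y - μ • fundamentalCycle F orientation).filter fun t => v ∈ t
  refine ⟨y', mem_facesWith.mpr fun t ht => ?_, fun r hr => ?_⟩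
  · have hvt : v ∈ t := by
      by_contra hvt
      exact ht (Finsupp.filter_apply_neg _ _ hvt)
    rw [Finsupp.filter_apply_pos (fun t => v ∈ t) _ hvt, Finsupp.sub_apply, Finsupp.smul_apply,
      smul_eq_mul] at ht
    have hft : facet t := by
      by_contra hft
      have h1 : y t = 0 := by
        by_contra hne
        exact hft (hy t hne)
      have h2 : fundamentalCycle F orientation t = 0 := by
        by_contra hne
        exact hft (h.facet_of_fundamentalCycle_ne_zero hne)
      rw [h1, h2, mul_zero, sub_zero] at ht
      exact ht rfl
    refine ⟨⟨fun _ => h.mem_faces_of_facet hK hft, fun u hu => ?_⟩, h.card_eq t hft⟩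
    by_contra! hlt
    exact ht (sub_eq_zero.mpr (hμ t hft hvt ⟨u, hu, hlt⟩))
  · have hfilter : faceBoundary F y' r =
        faceBoundary F (y - μ • fundamentalCycle F orientation) r := by
      rw [faceBoundary_apply, faceBoundary_apply]
      refine Finset.sum_congr rfl fun x _ => ?_
      rw [Finsupp.filter_apply_pos (fun t => v ∈ t) _ (Finset.mem_insert_of_mem hr)]
    rw [hfilter, map_sub, map_smul, h.faceBoundary_fundamentalCycle, smul_zero, sub_zero, hyc r hr]

theorem exists_eq_mul_of_low_cycle {c : Finset V →₀ F} (hc : c ∈ lowChains F K a v 5)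
    (hcycle : ∀ r, v ∈ r → faceBoundary F c r = 0) :
    ∃ μ : F, ∀ t, v ∈ t → c t = μ * fundamentalCycle F orientation t := by
  have hcf (t) (ht : c t ≠ 0) : facet t := by
    obtain ⟨hlow, hcard⟩ := mem_facesWith.mp hc t ht
    exact h.facet_of_mem_faces hK (hlow.1 (Finset.card_pos.mp (by omega))) hcard
  obtain ⟨μ, hμ⟩ := h.exists_eq_mul_of_edges hcf (v := v) {u | u ≠ v} (fun h => h rfl)
    fun u _ r _ hvr => hcycle r hvr
  refine ⟨μ, fun t hvt => ?_⟩
  by_cases ht : facet t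
  · obtain ⟨u, hu, huv⟩ := t.exists_mem_ne (by rw [h.card_eq t ht]; norm_num) v
    exact hμ t ht hvt ⟨u, hu, huv⟩
  · have h1 : c t = 0 := by
      by_contra hne
      exact ht (hcf t hne)
    rw [h1, fundamentalCycle_apply, h.eq_zero t ht, Int.cast_zero, mul_zero]

theorem finrank_lowHomology_four_of_lt {u₀ : V} (hu₀ : a v < a u₀) :
    Module.finrank F (LowHomology F K a v 4) = 0 := by
  refine finrank_lowHomology_eq_zero fun c hc hcycle => ⟨0, Submodule.zero_mem _, fun r hr => ?_⟩
  obtain ⟨μ, hμ⟩ := h.exists_eq_mul_of_low_cycle hK hc hcycle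
  obtain ⟨t, ht, hut, hvt, -⟩ := h.neighborly u₀ v v
  have hct : c t = 0 := by
    by_contra hne
    exact not_lt_of_ge ((mem_facesWith.mp hc t hne).1.2 u₀ hut) hu₀
  rw [hμ t hvt] at hct
  rw [hμ r hr, (mul_eq_zero.mp hct).resolve_right (h.fundamentalCycle_ne_zero ht), map_zero,
    Finsupp.zero_apply, zero_mul]

theorem finrank_lowHomology_four_of_highest (hv : ∀ u, a u ≤ a v) :
    Module.finrank F (LowHomology F K a v 4) = 1 := by
  obtain ⟨t, ht, hvt, -⟩ := h.neighborly v v v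
  refine finrank_lowHomology_eq_one (e := fundamentalCycle F orientation) ?_ ?_
    ⟨t, hvt, h.fundamentalCycle_ne_zero ht⟩ ?_ fun c hc hcycle =>
      h.exists_eq_mul_of_low_cycle hK hc hcycle
  · refine mem_facesWith.mpr fun s hs => ?_
    have hf := h.facet_of_fundamentalCycle_ne_zero hs
    exact ⟨⟨fun _ => h.mem_faces_of_facet hK hf, fun u _ => hv u⟩, h.card_eq s hf⟩
  · intro r _
    rw [h.faceBoundary_fundamentalCycle, Finsupp.zero_apply]
  · intro y hy r _
    have : y = 0 := by
      ext s
      by_contra hne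
      obtain ⟨hlow, hcard⟩ := mem_facesWith.mp hy s hne
      have := h.card_le_of_mem_faces hK (hlow.1 (Finset.card_pos.mp (by omega)))
      omega
    rw [this, map_zero, Finsupp.zero_apply]

/-- Double counting of the pairs of a facet and a 4-element subset of it. -/
theorem two_mul_card_ridges [DecidablePred facet] [DecidablePred (· ∈ K.faces)] :
    2 * (Finset.univ.filter fun s : Finset V => s ∈ K.faces ∧ s.card = 4).card =
      5 * (Finset.univ.filter facet).card := by
  have hcount := Finset.sum_card_bipartiteAbove_eq_sum_card_bipartiteBelow
    (s := Finset.univ.filter fun s : Finset V => s ∈ K.faces ∧ s.card = 4)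
    (t := Finset.univ.filter facet) (fun r t => r ⊆ t)
  rw [Finset.sum_const_nat (m := 2), Finset.sum_const_nat (m := 5)] at hcount
  · linarith
  · intro t ht
    have ht := (Finset.mem_filter.mp ht).2
    have hset : Finset.bipartiteBelow (fun r t => r ⊆ t)
        (Finset.univ.filter fun s : Finset V => s ∈ K.faces ∧ s.card = 4) t =
        t.powersetCard 4 := by
      ext s
      simp only [Finset.mem_bipartiteBelow, Finset.mem_filter, Finset.mem_univ, true_and,
        Finset.mem_powersetCard]
      refine ⟨fun hs => ⟨hs.2, hs.1.2⟩, fun hs => ⟨⟨(hK s).mpr ⟨?_, t, ht, hs.1⟩, hs.2⟩, hs.1⟩⟩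
      exact Finset.card_pos.mp (by omega)
    rw [hset, Finset.card_powersetCard, h.card_eq t ht]
    rfl
  · intro r hr
    obtain ⟨hrK, hcard⟩ := (Finset.mem_filter.mp hr).2
    obtain ⟨x, y, -, -, hxy, hxt, hyt, honly, -⟩ := h.exists_two_facets hcard ((hK r).mp hrK).2
    have hset : Finset.bipartiteAbove (fun r t => r ⊆ t) (Finset.univ.filter facet) r =
        {insert x r, insert y r} := by
      ext t
      simp only [Finset.mem_bipartiteAbove, Finset.mem_filter, Finset.mem_univ, true_and,
        Finset.mem_insert, Finset.mem_singleton]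
      constructor
      · rintro ⟨ht, hrt⟩
        exact honly t ht hrt
      · rintro (rfl | rfl)
        exacts [⟨hxt, Finset.subset_insert x r⟩, ⟨hyt, Finset.subset_insert y r⟩]
    rw [hset, Finset.card_pair hxy]

theorem card_small_faces [DecidablePred (· ∈ K.faces)] {n : ℕ} (hn : n ≠ 0) (hn' : n ≤ 3) :
    (Finset.univ.filter fun s : Finset V => s ∈ K.faces ∧ s.card = n).card =
      (Fintype.card V).choose n := by
  rw [← Finset.card_univ, ← Finset.card_powersetCard]
  congr 1
  ext s
  simp only [Finset.mem_filter, Finset.mem_univ, true_and, Finset.mem_powersetCard,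
    Finset.subset_univ, and_iff_right_iff_imp]
  intro hs
  exact h.mem_faces_of_card_le hK (Finset.card_pos.mp (by omega)) (by omega)

theorem sum_finrank_lowHomology_zero [Nonempty V] (ha : Function.Injective a) :
    ∑ v, Module.finrank F (LowHomology F K a v 0) = 1 := by
  obtain ⟨v, hv⟩ := Finite.exists_min a
  rw [Finset.sum_eq_single_of_mem v (Finset.mem_univ v),
    finrank_lowHomology_zero_of_lowest ha hv]
  intro w _ hw
  exact h.finrank_lowHomology_of_lt hK ((hv w).lt_of_ne fun h => hw (ha h).symm) zero_le_one

theorem finrank_lowHomology_one (ha : Function.Injective a) :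
    Module.finrank F (LowHomology F K a v 1) = 0 := by
  by_cases hv : ∀ u, a v ≤ a u
  · exact finrank_lowHomology_of_lowest ha hv one_ne_zero
  · push Not at hv
    obtain ⟨u, hu⟩ := hv
    exact h.finrank_lowHomology_of_lt hK hu le_rfl

theorem sum_finrank_lowHomology_four [Nonempty V] (ha : Function.Injective a) :
    ∑ v, Module.finrank F (LowHomology F K a v 4) = 1 := by
  obtain ⟨v, hv⟩ := Finite.exists_max a
  rw [Finset.sum_eq_single_of_mem v (Finset.mem_univ v),
    h.finrank_lowHomology_four_of_highest hK hv]
  intro w _ hw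
  exact h.finrank_lowHomology_four_of_lt hK ((hv w).lt_of_ne fun h => hw (ha h))

/-- The alternating sum of all multiplicities is the Euler characteristic, so that the remaining
multiplicities are determined by the numbers of faces. -/
theorem sum_finrank_lowHomology_two [Nonempty V] (ha : Function.Injective a)
    [DecidablePred facet] :
    2 * (∑ v, Module.finrank F (LowHomology F K a v 2)) + 4 + 2 * (Fintype.card V).choose 2 +
        3 * (Finset.univ.filter facet).card =
      2 * Fintype.card V + 2 * (Fintype.card V).choose 3 := by
  classical
  have heuler := Finset.sum_congr (s₁ := Finset.univ) rfl fun v _ =>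
    euler_lowHomology (F := F) (K := K) (a := a) (v := v) fun t ht => h.card_le_of_mem_faces hK ht
  simp only [Finset.sum_add_distrib, Finset.sum_sub_distrib, h.finrank_lowHomology_one hK ha,
    h.finrank_lowHomology_three hK, Finset.sum_const_zero, Nat.cast_zero] at heuler
  have e0 := h.sum_finrank_lowHomology_zero (F := F) hK ha
  have e4 := h.sum_finrank_lowHomology_four (F := F) hK ha
  have s1 := sum_lowStarCount (K := K) ha one_ne_zero
  have s2 := sum_lowStarCount (K := K) ha two_ne_zero
  have s3 := sum_lowStarCount (K := K) ha three_ne_zero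
  have s4 := sum_lowStarCount (K := K) ha four_ne_zero
  have s5 := sum_lowStarCount (K := K) ha (n := 5) (by norm_num)
  rw [h.card_small_faces hK (by norm_num) (by norm_num)] at s1 s2 s3
  have h5 : (Finset.univ.filter fun t : Finset V => t ∈ K.faces ∧ t.card = 5) =
      Finset.univ.filter facet := Finset.filter_congr fun t _ =>
    ⟨fun ht => h.facet_of_mem_faces hK ht.1 ht.2,
      fun ht => ⟨h.mem_faces_of_facet hK ht, h.card_eq t ht⟩⟩
  rw [h5] at s5
  have h4 := h.two_mul_card_ridges hK
  rw [Nat.choose_one_right] at s1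
  zify at *
  linarith

end IsNeighborlyManifold

end TightManifold

/-! ### Binary codes of sets of vertices -/

namespace K3

/-- The number whose binary digits are the indicator function of `t`. -/
def code (t : Finset (Fin 16)) : ℕ := Nat.ofBits fun i : Fin 16 => decide (i ∈ t)

/-- The number of binary digits `1` among the last 16 digits. -/
def bitCount (m : ℕ) : ℕ := ((List.range 16).filter m.testBit).length

theorem testBit_code (t : Finset (Fin 16)) (i : Fin 16) :
    (code t).testBit i = decide (i ∈ t) := Nat.testBit_ofBits_lt _ _ i.2

theorem testBit_code_of_le (t : Finset (Fin 16)) {i : ℕ} (hi : 16 ≤ i) :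
    (code t).testBit i = false := Nat.testBit_ofBits_ge _ _ hi

theorem eq_code_iff {m : ℕ} (t : Finset (Fin 16)) (hm : m < 2 ^ 16) :
    m = code t ↔ ∀ i : Fin 16, m.testBit i = decide (i ∈ t) := by
  constructor
  · rintro rfl
    exact testBit_code t
  · intro h
    refine Nat.eq_of_testBit_eq fun i => ?_
    by_cases hi : i < 16
    · exact (h ⟨i, hi⟩).trans (testBit_code t ⟨i, hi⟩).symm
    · rw [testBit_code_of_le t (not_lt.mp hi)]
      exact Nat.testBit_lt_two_pow (hm.trans_le (Nat.pow_le_pow_right two_pos (not_lt.mp hi)))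

theorem code_lt (t : Finset (Fin 16)) : code t < 2 ^ 16 := Nat.ofBits_lt_two_pow _

theorem code_injective : Function.Injective code := by
  intro s t h
  ext i
  have := (testBit_code s i).symm.trans ((congrArg (Nat.testBit · i) h).trans (testBit_code t i))
  simpa using this

/-- The set with a given code. -/
def decode (m : ℕ) : Finset (Fin 16) := Finset.univ.filter fun i : Fin 16 => m.testBit i

theorem code_decode {m : ℕ} (hm : m < 2 ^ 16) : code (decode m) = m :=
  ((eq_code_iff _ hm).mpr fun i => by simp [decode]).symm

theorem decode_code (t : Finset (Fin 16)) : decode (code t) = t :=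
  code_injective (code_decode (code_lt t))

theorem code_inter (s t : Finset (Fin 16)) : code s &&& code t = code (s ∩ t) := by
  refine (eq_code_iff _ (Nat.and_lt_two_pow _ (code_lt t))).mpr fun i => ?_
  rw [Nat.testBit_and, testBit_code, testBit_code]
  simp

theorem land_code_eq_iff (s t : Finset (Fin 16)) : code s &&& code t = code s ↔ s ⊆ t := by
  rw [code_inter, code_injective.eq_iff, Finset.inter_eq_left]

theorem code_xor_two_pow {t : Finset (Fin 16)} {x : Fin 16} (hx : x ∈ t) :
    code t ^^^ 2 ^ (x : ℕ) = code (t.erase x) := by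
  refine (eq_code_iff _ (Nat.xor_lt_two_pow (code_lt t)
    (Nat.pow_lt_pow_right one_lt_two x.2))).mpr fun i => ?_
  rw [Nat.testBit_xor, testBit_code, Nat.testBit_two_pow]
  by_cases h : i = x
  · subst h
    simp [hx]
  · simp [h, Fin.val_inj, Ne.symm h]

theorem code_eq_xor_of_insert {r : Finset (Fin 16)} {x : Fin 16} (hx : x ∉ r) :
    code (insert x r) ^^^ 2 ^ (x : ℕ) = code r := by
  rw [code_xor_two_pow (Finset.mem_insert_self x r), Finset.erase_insert hx]

theorem code_xor_code_insert {r : Finset (Fin 16)} {x : Fin 16} (hx : x ∉ r) :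
    code (insert x r) ^^^ code r = 2 ^ (x : ℕ) := by
  rw [← code_eq_xor_of_insert hx, ← Nat.xor_assoc, Nat.xor_self, Nat.zero_xor]

theorem code_land_two_pow_sub_one (r : Finset (Fin 16)) (x : Fin 16) :
    code r &&& (2 ^ (x : ℕ) - 1) = code (r.filter (· < x)) := by
  refine (eq_code_iff _ ((Nat.and_le_left).trans_lt (code_lt r))).mpr fun i => ?_
  rw [Nat.testBit_and, testBit_code, Nat.testBit_two_pow_sub_one]
  simp

theorem bitCount_code (t : Finset (Fin 16)) : bitCount (code t) = t.card := by
  have h : t.map Fin.valEmbedding = (Finset.range 16).filter fun i => (code t).testBit i := by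
    ext i
    simp only [Finset.mem_map, Finset.mem_filter, Finset.mem_range, Fin.valEmbedding_apply]
    constructor
    · rintro ⟨i, hi, rfl⟩
      exact ⟨i.2, by rw [testBit_code]; simpa using hi⟩
    · rintro ⟨hi, h⟩
      exact ⟨⟨i, hi⟩, by simpa [hi] using (testBit_code t ⟨i, hi⟩).symm.trans h, rfl⟩
  rw [← Finset.card_map Fin.valEmbedding, h]
  simp only [Finset.card, Finset.filter, Finset.range, Multiset.range, Multiset.filter_coe,
    Multiset.coe_card, bitCount]
  congr 2
  funext i
  simp

theorem code_lt_two_pow {t : Finset (Fin 16)} {x : Fin 16} (h : ∀ y ∈ t, y ≤ x) :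
    code t < 2 ^ ((x : ℕ) + 1) := by
  refine Nat.lt_pow_two_of_testBit _ fun i hi => ?_
  by_cases hi' : i < 16
  · rw [testBit_code t ⟨i, hi'⟩, decide_eq_false_iff_not]
    intro hmem
    have := Fin.le_def.mp (h _ hmem)
    simp only at this
    omega
  · exact testBit_code_of_le t (not_lt.mp hi')

/-- The code of the image of a set under a permutation with inverse `h`. -/
def permCode (h : Fin 16 → Fin 16) (m : ℕ) : ℕ := Nat.ofBits fun i : Fin 16 => m.testBit (h i)

theorem code_image (g : Equiv.Perm (Fin 16)) (t : Finset (Fin 16)) :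
    code (t.image g) = permCode g.symm (code t) := by
  refine ((eq_code_iff _ (Nat.ofBits_lt_two_pow _)).mpr fun i => ?_).symm
  refine (Nat.testBit_ofBits_lt _ _ i.2).trans ((testBit_code t _).trans (decide_eq_decide.mpr ?_))
  rw [Finset.mem_image]
  exact ⟨fun h => ⟨_, h, g.apply_symm_apply i⟩, fun ⟨j, hj, h⟩ => by rwa [← h, g.symm_apply_apply]⟩

end K3

/-! ### The facets of the triangulation -/

namespace K3

/-- The codes of the facets whose orientation by the order of the vertices agrees with the
orientation of the surface. -/
def positiveCodes : List ℕ :=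
  [217, 241, 271, 572, 620, 962, 1063, 1077, 1140, 1318, 1353, 1428, 1812, 2154, 2198, 2360, 2408,
   2442, 2579, 2694, 2756, 2864, 3146, 3172, 3220, 3464, 3841, 4321, 4492, 4649, 4660, 4708, 4769,
   4874, 5000, 5127, 5208, 5320, 5410, 5768, 6186, 7202, 8263, 8345, 8369, 8390, 8515, 8725, 8732,
   8785, 9733, 9988, 10340, 10436, 10514, 10776, 12299, 13120, 13330, 13572, 14345, 15362, 16435,
   16474, 16498, 16525, 16710, 16728, 16773, 16804, 17185, 17824, 17985, 18112, 18208, 18625,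
   18693, 18956, 19074, 19616, 20577, 20620, 20632, 20770, 22548, 22593, 23104, 24912, 25612,
   25618, 25640, 26633, 26784, 27144, 27650, 29248, 29700, 32931, 32934, 32952, 33170, 33354,
   33456, 33680, 34113, 34314, 34829, 34835, 34838, 35337, 35857, 35920, 36160, 36995, 37505,
   37893, 37900, 38408, 38992, 39104, 39200, 41029, 41036, 41064, 41234, 41856, 42049, 42176,
   42624, 45186, 45344, 47232, 49222, 49304, 49316, 49480, 49667, 50186, 50216, 50720, 51220,
   55552, 57616, 61696]

/-- The codes of the facets whose orientation by the order of the vertices is opposite to the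
orientation of the surface. -/
def negativeCodes : List ℕ :=
  [327, 345, 397, 618, 710, 906, 1075, 1114, 1138, 1225, 1417, 1444, 1557, 1674, 2450, 2601, 2616,
   2849, 3156, 3170, 3210, 3236, 3400, 3472, 3601, 3856, 4111, 4212, 4312, 4336, 4366, 4500, 4650,
   4706, 4784, 4884, 4930, 5008, 5139, 5382, 6185, 6228, 6337, 6433, 6724, 8231, 8245, 8252, 8300,
   8355, 8358, 8376, 8459, 8473, 8529, 8642, 9152, 9793, 9920, 10016, 10404, 10506, 10520, 10770,
   12419, 13060, 13600, 14346, 14465, 15392, 16497, 16678, 16915, 16977, 17434, 17601, 17793,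
   18050, 18177, 18445, 19136, 19586, 20578, 20628, 20769, 20802, 21516, 21528, 22785, 23044,
   24713, 24744, 25100, 25106, 25168, 26753, 27138, 27680, 28992, 29188, 29712, 32918, 33080,
   33093, 33128, 33350, 33356, 33441, 33584, 35077, 35168, 35331, 35334, 35340, 36097, 36877,
   36883, 37385, 37905, 37968, 38080, 38528, 41346, 41760, 41989, 41996, 42024, 42528, 43104,
   43200, 45074, 47136, 49187, 49190, 49226, 49300, 49320, 49432, 49476, 49697, 50690, 51460,
   55312, 61456]

/-- The codes of all facets. -/
def facetCodes : List ℕ := positiveCodes ++ negativeCodes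

/-- The facets, described by their codes. -/
def IsFacet (t : Finset (Fin 16)) : Prop := code t ∈ facetCodes

instance : DecidablePred IsFacet := fun t => inferInstanceAs (Decidable (code t ∈ facetCodes))

/-- The sign of a facet in the fundamental cycle. -/
def orientation (t : Finset (Fin 16)) : ℤ :=
  if code t ∈ positiveCodes then 1 else if code t ∈ negativeCodes then -1 else 0

/-- The inverse of the first generator, as a table of values. -/
def tableA : Fin 16 → Fin 16 := ![9, 10, 15, 1, 8, 13, 12, 6, 3, 4, 5, 11, 14, 7, 2, 0]

/-- The inverse of the second generator, as a table of values. -/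
def tableB : Fin 16 → Fin 16 := ![11, 0, 14, 13, 15, 8, 6, 5, 7, 4, 2, 1, 3, 12, 10, 9]

theorem genA_symm : (genA.symm : Fin 16 → Fin 16) = tableA := by
  funext i
  rw [Equiv.symm_apply_eq]
  revert i
  decide +kernel

theorem genB_symm : (genB.symm : Fin 16 → Fin 16) = tableB := by
  funext i
  rw [Equiv.symm_apply_eq]
  revert i
  decide +kernel

theorem code_image_genA (t : Finset (Fin 16)) :
    code (t.image genA) = permCode tableA (code t) := by
  rw [code_image, genA_symm]

theorem code_image_genB (t : Finset (Fin 16)) :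
    code (t.image genB) = permCode tableB (code t) := by
  rw [code_image, genB_symm]

/-- The codes of the images of the two given facets under the powers of the first generator. -/
def orbitCodes : List ℕ :=
  List.iterate (permCode tableA) (code {1, 2, 3, 8, 12}) 15 ++
    List.iterate (permCode tableA) (code {1, 2, 5, 8, 14}) 15

/-- The codes of the images of the two given facets under products of the second generator with
powers of the first one. -/
def orbitCodes' : List ℕ :=
  orbitCodes.flatMap fun m => List.iterate (permCode tableA) (permCode tableB m) 15

theorem facetCodes_subset_orbitCodes :
    (facetCodes.all fun m => (orbitCodes ++ orbitCodes').any (Nat.beq m)) = true := by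
  decide +kernel

theorem facetCodes_invariant : (facetCodes.all fun m =>
    facetCodes.any (Nat.beq (permCode tableA m)) && facetCodes.any (Nat.beq (permCode tableB m))) =
      true := by
  decide +kernel

theorem facetCodes_card : (facetCodes.all fun m => m < 2 ^ 16 && bitCount m == 5) = true := by
  decide +kernel

theorem positive_negative_disjoint :
    (positiveCodes.all fun m => negativeCodes.all fun k => !Nat.beq m k) = true := by
  decide +kernel

theorem facetCodes_sorted : positiveCodes.IsChain (· < ·) ∧ negativeCodes.IsChain (· < ·) := by
  decide +kernel

end K3

namespace K3

theorem image_mem_facets {g : Equiv.Perm (Fin 16)} (hg : g ∈ symGroup) {t : Finset (Fin 16)}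
    (ht : t ∈ facets) : t.image g ∈ facets := by
  obtain ⟨h, hh, rfl | rfl⟩ := ht
  · exact ⟨g * h, mul_mem hg hh, Or.inl (by rw [Finset.image_image]; rfl)⟩
  · exact ⟨g * h, mul_mem hg hh, Or.inr (by rw [Finset.image_image]; rfl)⟩

theorem genA_mem : genA ∈ symGroup := Subgroup.subset_closure (by simp)

theorem genB_mem : genB ∈ symGroup := Subgroup.subset_closure (by simp)

theorem mem_facets_of_isFacet {t : Finset (Fin 16)} (ht : IsFacet t) : t ∈ facets := by
  let S : Set ℕ := {m | ∃ t ∈ facets, code t = m}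
  have hA {m} (hm : m ∈ S) : permCode tableA m ∈ S := by
    obtain ⟨t, ht, rfl⟩ := hm
    exact ⟨_, image_mem_facets genA_mem ht, code_image_genA t⟩
  have hB {m} (hm : m ∈ S) : permCode tableB m ∈ S := by
    obtain ⟨t, ht, rfl⟩ := hm
    exact ⟨_, image_mem_facets genB_mem ht, code_image_genB t⟩
  have hiter {m k n} (hm : m ∈ S) (hk : k ∈ List.iterate (permCode tableA) m n) : k ∈ S := by
    induction n generalizing m with
    | zero => simp at hk
    | succ n ih =>
      rcases List.mem_cons.mp hk with rfl | hk
      exacts [hm, ih (hA hm) hk]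
  have horbit {m} (hm : m ∈ orbitCodes) : m ∈ S := by
    rcases List.mem_append.mp hm with hm | hm
    · exact hiter ⟨_, ⟨1, one_mem _, Or.inl rfl⟩, by simp⟩ hm
    · exact hiter ⟨_, ⟨1, one_mem _, Or.inr rfl⟩, by simp⟩ hm
  have hmem : code t ∈ S := by
    obtain ⟨m, hm, heq⟩ :=
      List.any_eq_true.mp (List.all_eq_true.mp facetCodes_subset_orbitCodes _ ht)
    rw [Nat.eq_of_beq_eq_true heq]
    rcases List.mem_append.mp hm with hm | hm
    · exact horbit hm
    · obtain ⟨k, hk, hm⟩ := List.mem_flatMap.mp hm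
      exact hiter (hB (horbit hk)) hm
  obtain ⟨t', ht', heq⟩ := hmem
  rwa [← code_injective heq]

theorem IsFacet.image_gen {t : Finset (Fin 16)} (ht : IsFacet t) :
    IsFacet (t.image genA) ∧ IsFacet (t.image genB) := by
  obtain ⟨h1, h2⟩ := Bool.and_eq_true_iff.mp (List.all_eq_true.mp facetCodes_invariant _ ht)
  obtain ⟨m, hm, hm'⟩ := List.any_eq_true.mp h1
  obtain ⟨k, hk, hk'⟩ := List.any_eq_true.mp h2
  constructor
  · rw [IsFacet, code_image_genA, Nat.eq_of_beq_eq_true hm']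
    exact hm
  · rw [IsFacet, code_image_genB, Nat.eq_of_beq_eq_true hk']
    exact hk

theorem IsFacet.image {t : Finset (Fin 16)} (ht : IsFacet t) {g : Equiv.Perm (Fin 16)}
    (hg : g ∈ symGroup) : IsFacet (t.image g) := by
  -- An injective map of the finite set of facets to itself is surjective.
  have hsurj (g : Equiv.Perm (Fin 16)) (h : ∀ t, IsFacet t → IsFacet (t.image g)) (t)
      (ht : IsFacet t) : IsFacet (t.image g.symm) := by
    let φ : {t // IsFacet t} → {t // IsFacet t} := fun t => ⟨t.1.image g, h t.1 t.2⟩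
    have hφ : Function.Injective φ := fun s t hst =>
      Subtype.ext (Finset.image_injective g.injective (congrArg Subtype.val hst))
    obtain ⟨s, hs⟩ := Finite.surjective_of_injective hφ ⟨t, ht⟩
    have hs' : s.1.image g = t := congrArg Subtype.val hs
    rw [← hs', Finset.image_image, Equiv.symm_comp_self, Finset.image_id]
    exact s.2
  revert t
  refine Subgroup.closure_induction 
    (p := fun (g : Equiv.Perm (Fin 16)) _ => ∀ {t}, IsFacet t → IsFacet (t.image g))
    ?_ ?_ ?_ ?_ hg
  · rintro g (rfl | rfl) t ht
    exacts [ht.image_gen.1, ht.image_gen.2]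
  · intro t ht
    simpa using ht
  · intro g h _ _ hg hh t ht
    have := hg (hh ht)
    rwa [Finset.image_image] at this
  · intro g _ hg t ht
    exact hsurj g (fun t ht => hg ht) t ht

theorem mem_facets_iff {t : Finset (Fin 16)} : t ∈ facets ↔ IsFacet t := by
  refine ⟨?_, mem_facets_of_isFacet⟩
  have h1 : IsFacet {1, 2, 3, 8, 12} ∧ IsFacet {1, 2, 5, 8, 14} := by decide +kernel
  rintro ⟨g, hg, rfl | rfl⟩
  exacts [h1.1.image hg, h1.2.image hg]

theorem card_of_isFacet {t : Finset (Fin 16)} (ht : IsFacet t) : t.card = 5 := by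
  have := (Bool.and_eq_true_iff.mp (List.all_eq_true.mp facetCodes_card _ ht)).2
  rw [← bitCount_code]
  exact eq_of_beq this

theorem card_facets : (Finset.univ.filter IsFacet).card = 288 := by
  have hnodup : facetCodes.Nodup := by
    refine List.nodup_append.mpr ⟨?_, ?_, fun m hm k hk heq => ?_⟩
    · exact (List.isChain_iff_pairwise.mp facetCodes_sorted.1).imp fun h => h.ne
    · exact (List.isChain_iff_pairwise.mp facetCodes_sorted.2).imp fun h => h.ne
    · have := List.all_eq_true.mp (List.all_eq_true.mp positive_negative_disjoint _ hm) _ hk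
      simp [heq] at this
  have himage : (Finset.univ.filter IsFacet).image code = facetCodes.toFinset := by
    ext m
    simp only [Finset.mem_image, Finset.mem_filter, Finset.mem_univ, true_and, List.mem_toFinset]
    constructor
    · rintro ⟨t, ht, rfl⟩
      exact ht
    · intro hm
      have := (Bool.and_eq_true_iff.mp (List.all_eq_true.mp facetCodes_card _ hm)).1
      have h := code_decode (of_decide_eq_true this)
      exact ⟨decode m, by rwa [IsFacet, h], h⟩
  rw [← Finset.card_image_of_injective _ code_injective, himage,
    List.toFinset_card_of_nodup hnodup]
  decide +kernel

theorem mem_faces_iff (s : Finset (Fin 16)) :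
    s ∈ complex.faces ↔ s.Nonempty ∧ ∃ t, IsFacet t ∧ s ⊆ t := by
  simp only [← mem_facets_iff]
  rfl

theorem exists_mem_symGroup_apply_eq (v w : Fin 16) : ∃ g ∈ symGroup, g v = w := by
  obtain ⟨g, hg, hgv⟩ := exists_mem_symGroup v
  obtain ⟨h, hh, hhw⟩ := exists_mem_symGroup w
  exact ⟨h * g⁻¹, mul_mem hh (inv_mem hg), by simp [← hgv, hhw]⟩

end K3

/-! ### The orientation -/

namespace K3

/-- The codes of the facets, with their signs in the fundamental cycle. -/
def signedCodes : List (ℕ × Bool) :=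
  (positiveCodes.map fun m => (m, true)) ++ negativeCodes.map fun m => (m, false)

/-- The codes of the facets at the vertex `a`. -/
def starCodes (a : ℕ) : List (ℕ × Bool) := signedCodes.filter fun p => p.1.testBit a

/-- Whether the only vertex of `m` outside `r` is preceded by an odd number of vertices. -/
def oddPosition (r m : ℕ) : Bool := bitCount (r &&& ((m ^^^ r) - 1)) % 2 == 1

/-- Whether exactly two of the given facets contain `r`, and whether the signs of `r` in their
boundaries cancel. -/
def ridgeCheck (l : List (ℕ × Bool)) (r : ℕ) : Bool :=
  match l.filter fun p => Nat.beq (Nat.land r p.1) r with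
  | [p, q] => (p.2 ^^ oddPosition r p.1) != (q.2 ^^ oddPosition r q.1)
  | _ => false

-- To keep the computation short, every 3-simplex is tested in the star of its highest vertex only.
theorem ridgeCheck_all : ((List.range 16).all fun a => (starCodes a).all fun p =>
    (List.range 16).all fun x => !p.1.testBit x || Nat.beq x a ||
      Nat.ble (2 ^ (a + 1)) (p.1 ^^^ 2 ^ x) || ridgeCheck (starCodes a) (p.1 ^^^ 2 ^ x)) = true := by
  decide +kernel

theorem exists_mem_signedCodes {t : Finset (Fin 16)} (ht : IsFacet t) :
    ∃ b, (code t, b) ∈ signedCodes := by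
  rcases List.mem_append.mp ht with h | h
  · exact ⟨true, List.mem_append_left _ (List.mem_map.mpr ⟨_, h, rfl⟩)⟩
  · exact ⟨false, List.mem_append_right _ (List.mem_map.mpr ⟨_, h, rfl⟩)⟩

theorem exists_of_mem_signedCodes {p : ℕ × Bool} (hp : p ∈ signedCodes) :
    ∃ t, code t = p.1 ∧ IsFacet t ∧ orientation t = if p.2 then 1 else -1 := by
  have hmem : p.1 ∈ facetCodes := by
    rcases List.mem_append.mp hp with h | h <;> obtain ⟨m, hm, rfl⟩ := List.mem_map.mp h
    exacts [List.mem_append_left _ hm, List.mem_append_right _ hm]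
  have hcode := code_decode
    (of_decide_eq_true (Bool.and_eq_true_iff.mp (List.all_eq_true.mp facetCodes_card _ hmem)).1)
  refine ⟨decode p.1, hcode, by rwa [IsFacet, hcode], ?_⟩
  rw [orientation, hcode]
  rcases List.mem_append.mp hp with h | h <;> obtain ⟨m, hm, rfl⟩ := List.mem_map.mp h
  · rw [if_pos hm]
    rfl
  · rw [if_neg fun h => ?_, if_pos hm]
    · rfl
    · have := List.all_eq_true.mp (List.all_eq_true.mp positive_negative_disjoint _ h) _ hm
      simp at this

theorem isUnit_orientation {t : Finset (Fin 16)} (ht : IsFacet t) : IsUnit (orientation t) := by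
  obtain ⟨b, hb⟩ := exists_mem_signedCodes ht
  obtain ⟨t', ht', -, h⟩ := exists_of_mem_signedCodes hb
  rw [← code_injective ht', h]
  cases b <;> simp

theorem orientation_eq_zero {t : Finset (Fin 16)} (ht : ¬IsFacet t) : orientation t = 0 := by
  rw [IsFacet, facetCodes, List.mem_append, not_or] at ht
  rw [orientation, if_neg ht.1, if_neg ht.2]

theorem exists_eq_insert {r t : Finset (Fin 16)} (ht : IsFacet t) (hr : r.card = 4) (hrt : r ⊆ t) :
    ∃ x ∉ r, insert x r = t := by
  obtain ⟨x, hx⟩ : (t \ r).Nonempty := by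
    rw [← Finset.card_pos, Finset.card_sdiff_of_subset hrt, card_of_isFacet ht, hr]
    norm_num
  obtain ⟨hxt, hxr⟩ := Finset.mem_sdiff.mp hx
  refine ⟨x, hxr, Finset.eq_of_subset_of_card_le (Finset.insert_subset hxt hrt) ?_⟩
  rw [Finset.card_insert_of_notMem hxr, hr, card_of_isFacet ht]

theorem oddPosition_insert {r : Finset (Fin 16)} {x : Fin 16} (hx : x ∉ r) :
    (-1 : ℤ) ^ (r.filter (· < x)).card =
      if oddPosition (code r) (code (insert x r)) then -1 else 1 := by
  rw [oddPosition, code_xor_code_insert hx, code_land_two_pow_sub_one, bitCount_code]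
  rcases Nat.even_or_odd (r.filter (· < x)).card with h | h
  · simp [h.neg_one_pow, Nat.even_iff.mp h]
  · simp [h.neg_one_pow, Nat.odd_iff.mp h]

theorem exists_ridgeCheck {r t : Finset (Fin 16)} (ht : IsFacet t) (hr : r.card = 4)
    (hrt : r ⊆ t) : ∃ a ∈ r, ridgeCheck (starCodes a) (code r) = true := by
  have hne : r.Nonempty := Finset.card_pos.mp (by omega)
  obtain ⟨x, hx, rfl⟩ := exists_eq_insert ht hr hrt
  obtain ⟨a, ha, hmax⟩ := r.exists_max_image id hne
  obtain ⟨b, hb⟩ := exists_mem_signedCodes ht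
  have hstar : (code (insert x r), b) ∈ starCodes a := by
    refine List.mem_filter.mpr ⟨hb, ?_⟩
    rw [testBit_code]
    exact decide_eq_true (Finset.mem_insert_of_mem ha)
  have h := List.all_eq_true.mp (List.all_eq_true.mp (List.all_eq_true.mp ridgeCheck_all a
    (List.mem_range.mpr a.2)) _ hstar) x (List.mem_range.mpr x.2)
  rw [code_eq_xor_of_insert hx, testBit_code, decide_eq_true (Finset.mem_insert_self x r)] at h
  have h1 : Nat.beq x a = false := by
    rw [← Bool.not_eq_true, Nat.beq_eq]
    exact fun h => hx (Fin.val_injective h ▸ ha)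
  have h2 : Nat.ble (2 ^ ((a : ℕ) + 1)) (code r) = false := by
    have := code_lt_two_pow hmax
    rw [← Bool.not_eq_true, Nat.ble_eq]
    exact not_le.mpr this
  rw [h1, h2] at h
  exact ⟨a, ha, by simpa using h⟩

theorem ridge {r : Finset (Fin 16)} (hr : r.card = 4) (hrt : ∃ t, IsFacet t ∧ r ⊆ t) :
    ∃ x y, x ∉ r ∧ y ∉ r ∧ IsFacet (insert x r) ∧ IsFacet (insert y r) ∧
      (∀ w, w ∉ r → IsFacet (insert w r) → w = x ∨ w = y) ∧
      (-1) ^ (r.filter (· < x)).card * orientation (insert x r) +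
        (-1) ^ (r.filter (· < y)).card * orientation (insert y r) = 0 := by
  obtain ⟨t, ht, hrt⟩ := hrt
  obtain ⟨a, ha, h⟩ := exists_ridgeCheck ht hr hrt
  rw [ridgeCheck] at h
  split at h
  next p q hpq =>
    have hmem (p' : ℕ × Bool) (hp : p' ∈ [p, q]) :
        ∃ x ∉ r, IsFacet (insert x r) ∧ p'.1 = code (insert x r) ∧
          orientation (insert x r) = if p'.2 then 1 else -1 := by
      rw [← hpq, List.mem_filter, starCodes, List.mem_filter] at hp
      obtain ⟨s, hs, hfs, ho⟩ := exists_of_mem_signedCodes hp.1.1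
      have hsub : r ⊆ s := by
        rw [← land_code_eq_iff, hs]
        exact Nat.eq_of_beq_eq_true hp.2
      obtain ⟨x, hx, rfl⟩ := exists_eq_insert hfs hr hsub
      exact ⟨x, hx, hfs, hs.symm, ho⟩
    obtain ⟨x, hx, hfx, hpx, hox⟩ := hmem p (by simp)
    obtain ⟨y, hy, hfy, hqy, hoy⟩ := hmem q (by simp)
    refine ⟨x, y, hx, hy, hfx, hfy, fun w hw hfw => ?_, ?_⟩
    · obtain ⟨b, hb⟩ := exists_mem_signedCodes hfw
      have hw' : (code (insert w r), b) ∈ [p, q] := by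
        rw [← hpq, List.mem_filter, starCodes, List.mem_filter]
        refine ⟨⟨hb, ?_⟩, ?_⟩
        · rw [testBit_code]
          exact decide_eq_true (Finset.mem_insert_of_mem ha)
        · rw [Nat.beq_eq]
          exact (land_code_eq_iff _ _).mpr (Finset.subset_insert w r)
      have heq (z) (hz : code (insert w r) = code (insert z r)) : w = z :=
        (Finset.mem_insert.mp (code_injective hz ▸ Finset.mem_insert_self w r)).resolve_right hw
      simp only [List.mem_cons, List.not_mem_nil, or_false] at hw'
      rcases hw' with hw' | hw'
      · exact Or.inl (heq x ((congrArg Prod.fst hw').trans hpx))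
      · exact Or.inr (heq y ((congrArg Prod.fst hw').trans hqy))
    · rw [oddPosition_insert hx, oddPosition_insert hy, hox, hoy, ← hpx, ← hqy]
      have key : ∀ b b' c c' : Bool, ((c ^^ b) != (c' ^^ b')) = true →
          ((if b then -1 else 1) * (if c then 1 else -1) +
            (if b' then -1 else 1) * (if c' then 1 else -1) : ℤ) = 0 := by decide
      exact key _ _ _ _ h
  next => simp at h

end K3

/-! ### The star of the vertex 11 -/

namespace K3

/-- Codes of pairs of a 3-simplex and a facet containing it, in the order of a collapse of the link
of the vertex `11` without one facet. -/
def collapseCodes₃ : List (ℕ × ℕ) :=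
  [(2608, 2864), (2104, 2360), (2600, 2601), (2584, 10776), (10264, 10520), (2089, 6185), (10760,
   27144), (2593, 2849), (6153, 14345), (10768, 10770), (18952, 18956), (2578, 2579), (2563,
   35331), (2832, 3856), (14344, 14346), (6154, 6186), (10754, 27138), (26632, 26633), (2817,
   3841), (2577, 3601), (18444, 18445), (6177, 6433), (2344, 2408), (18948, 23044), (26626,
   27650), (6178, 7202), (2569, 35337), (2572, 35340), (34825, 34829), (3089, 35857), (35332,
   35334), (7200, 15392), (6401, 22785), (23040, 23104), (2566, 2694), (10512, 10514), (14337,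
   14465), (22784, 55552), (10498, 10506), (2067, 34835), (26625, 26753), (34821, 35077), (2090,
   2154), (18946, 19074), (35073, 36097), (3344, 3472), (18561, 18625), (2241, 6337), (35856,
   35920), (2182, 2198), (18624, 19136), (26752, 26784), (22529, 22593), (3216, 3220), (3106,
   3170), (2692, 2756), (2244, 10436), (2194, 2450), (2434, 2442), (14464, 47232), (3204, 3236),
   (26656, 27680), (6432, 39200), (7170, 15362), (19488, 19616), (2309, 18693), (39040, 39104),
   (6660, 6724), (19584, 19586), (3092, 3156), (3108, 3172), (34834, 34838), (2132, 6228), (10372,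
   10404), (55296, 55312), (51216, 51220), (51456, 51460), (10276, 10340), (36096, 36160), (35008,
   43200), (10336, 43104), (34896, 38992), (22544, 22548), (2440, 3464), (2400, 35168), (2186,
   3210), (2376, 3400), (3138, 3146), (47104, 47136)]

/-- Codes of pairs of a triangle and a 3-simplex containing it, in the order of the rest of the
collapse. -/
def collapseCodes₂ : List (ℕ × ℕ) :=
  [(10752, 27136), (6146, 14338), (2051, 34819), (7168, 15360), (18440, 18441), (2568, 35336),
   (2576, 3600), (2065, 34833), (10256, 10258), (18448, 18452), (6152, 6184), (2564, 2628), (3076,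
   3140), (6656, 6720), (10244, 10308), (51200, 51204), (2082, 2146), (34944, 43136), (2184,
   3208), (18464, 18592), (6400, 39168), (10496, 10504), (2072, 2328), (2592, 2848), (2081, 2337),
   (2096, 2352), (26624, 27648), (34824, 34828), (14336, 14368), (2114, 2122), (3088, 3152),
   (2088, 2152), (2816, 3840), (2336, 35104), (3584, 3585), (2060, 2061), (6176, 38944), (2120,
   3144), (2128, 6224), (19456, 19458), (2053, 18437), (2057, 10249), (2561, 35329), (18434,
   18562), (10248, 10250), (35328, 35330), (34817, 35841), (18560, 19072), (10241, 10369), (34818,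
   34822), (18944, 19008), (2177, 6273), (2562, 2690), (3073, 3329), (10242, 11266), (35840,
   35904), (2054, 2070), (11264, 11296), (6145, 6209), (2178, 3202), (2688, 2752), (6272, 6336),
   (2305, 18689), (3074, 3082), (18433, 18497), (2240, 10432), (18688, 18692), (2066, 2322),
   (18436, 22532), (18496, 22592), (10304, 43072), (10368, 10400), (2308, 35076), (3080, 3336),
   (2306, 2314), (2320, 2448), (34820, 34836), (43008, 43040), (2192, 2196), (35072, 35136),
   (2432, 3456), (34832, 38928), (2068, 6164), (34848, 34912), (3200, 3232), (2180, 2212), (3328,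
   3392), (38912, 38976), (6148, 6212), (3136, 3168), (2084, 2148)]

/-- The codes of the facets at the vertex `11`. -/
def baseCodes : List ℕ := facetCodes.filter fun m => m.testBit 11

/-- Whether all members of `rest` can be reached from `front` in `n` steps between sets that differ
in one vertex. -/
def connects : ℕ → List ℕ → List ℕ → Bool
  | 0, _, rest => rest.isEmpty
  | n + 1, front, rest =>
    connects n (rest.filter fun m => front.any fun k => bitCount (m &&& k) == 4)
      (rest.filter fun m => !front.any fun k => bitCount (m &&& k) == 4)

/-- Whether the first member of each pair is not contained in the second members of later pairs. -/
def freePairs : List (ℕ × ℕ) → Bool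
  | [] => true
  | p :: l => (l.all fun q => p.1 &&& q.2 != p.1) && freePairs l

theorem baseCodes_neighborly : ((List.range 16).all fun a => (List.range 16).all fun b =>
    baseCodes.any fun m => m.testBit a && m.testBit b) = true := by
  decide +kernel

-- Every edge lies in 24 facets, so that 24 steps suffice.
theorem baseCodes_connected : ((List.range 16).all fun a => Nat.beq a 11 ||
    match baseCodes.filter fun m => m.testBit a with
    | [] => true
    | m :: l => connects 24 [m] l) = true := by
  decide +kernel

theorem collapseCodes₃_spec : (collapseCodes₃.all fun p => p.1 < 2 ^ 16 && baseCodes.any (Nat.beq p.2) &&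
    p.1 &&& p.2 == p.1 && bitCount p.1 == 4 && p.1.testBit 11) = true := by
  decide +kernel

theorem collapseCodes₂_spec : (collapseCodes₂.all fun p => p.1 < 2 ^ 16 && p.2 < 2 ^ 16 &&
    p.1 &&& p.2 == p.1 && bitCount p.1 == 3 && bitCount p.2 == 4 && p.1.testBit 11) = true := by
  decide +kernel

theorem freePairs_collapseCodes₃ : freePairs collapseCodes₃ = true := by
  decide +kernel

theorem freePairs_collapseCodes₂ : freePairs collapseCodes₂ = true := by
  decide +kernel

theorem collapseCodes_cover : (baseCodes.all fun m => (List.range 16).all fun x =>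
    !m.testBit x || Nat.beq x 11 || (collapseCodes₃.any fun p => Nat.beq p.1 (m ^^^ 2 ^ x)) ||
      collapseCodes₂.any fun p => Nat.beq p.2 (m ^^^ 2 ^ x)) = true := by
  decide +kernel

theorem mem_baseCodes {t : Finset (Fin 16)} : code t ∈ baseCodes ↔ IsFacet t ∧ 11 ∈ t := by
  rw [baseCodes, List.mem_filter]
  refine and_congr_right fun _ => ?_
  have := testBit_code t 11
  rw [show ((11 : Fin 16) : ℕ) = 11 from rfl] at this
  rw [this, decide_eq_true_iff]

theorem neighborly_base (a b : Fin 16) : ∃ t, IsFacet t ∧ 11 ∈ t ∧ a ∈ t ∧ b ∈ t := by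
  obtain ⟨m, hm, h⟩ := List.any_eq_true.mp (List.all_eq_true.mp (List.all_eq_true.mp
    baseCodes_neighborly a (List.mem_range.mpr a.2)) b (List.mem_range.mpr b.2))
  have hcode := code_decode (of_decide_eq_true (Bool.and_eq_true_iff.mp
    (List.all_eq_true.mp facetCodes_card _ (List.mem_filter.mp hm).1)).1)
  rw [← hcode] at hm h
  obtain ⟨ht, h11⟩ := mem_baseCodes.mp hm
  rw [testBit_code, testBit_code, Bool.and_eq_true, decide_eq_true_iff, decide_eq_true_iff] at h
  exact ⟨_, ht, h11, h.1, h.2⟩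

/-- The facets containing `u` and `v` are connected by steps that exchange one vertex. -/
def LinkConnected (u v : Fin 16) : Prop := ∀ P : Finset (Fin 16) → Prop,
  (∀ t t', IsFacet t → IsFacet t' → u ∈ t → v ∈ t → u ∈ t' → v ∈ t' → (t ∩ t').card = 4 →
    P t → P t') →
  ∀ t t', IsFacet t → IsFacet t' → u ∈ t → v ∈ t → u ∈ t' → v ∈ t' → P t → P t'

theorem forall_of_connects {S P : ℕ → Prop}
    (hP : ∀ m k, S m → S k → bitCount (m &&& k) = 4 → P k → P m) (n : ℕ) {front rest : List ℕ}
    (h : connects n front rest = true) (hfront : ∀ m ∈ front, S m ∧ P m)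
    (hrest : ∀ m ∈ rest, S m) : ∀ m ∈ rest, P m := by
  induction n generalizing front rest with
  | zero =>
    rw [connects, List.isEmpty_iff] at h
    simp [h]
  | succ n ih =>
    intro m hm
    have hstep (m) (hm : m ∈ rest) (hb : (front.any fun k => bitCount (m &&& k) == 4) = true) :
        P m := by
      obtain ⟨k, hk, hkm⟩ := List.any_eq_true.mp hb
      exact hP m k (hrest m hm) (hfront k hk).1 (eq_of_beq hkm) (hfront k hk).2
    by_cases hb : (front.any fun k => bitCount (m &&& k) == 4) = true
    · exact hstep m hm hb
    · refine ih h (fun k hk => ?_) (fun k hk => hrest k (List.mem_filter.mp hk).1) m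
        (List.mem_filter.mpr ⟨hm, by simpa using hb⟩)
      obtain ⟨hk, hkb⟩ := List.mem_filter.mp hk
      exact ⟨hrest k hk, hstep k hk hkb⟩

theorem linkConnected_base {u : Fin 16} (hu : u ≠ 11) : LinkConnected u 11 := by
  intro P hP t t' ht ht' hut hvt hut' hvt' hPt
  have h := List.all_eq_true.mp baseCodes_connected u (List.mem_range.mpr u.2)
  have hu' : Nat.beq u 11 = false := by
    rw [← Bool.not_eq_true, Nat.beq_eq]
    exact fun h => hu (Fin.val_injective h)
  rw [hu', Bool.false_or] at h
  have hmem {t} (ht : IsFacet t) (hut : u ∈ t) (hvt : 11 ∈ t) :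
      code t ∈ baseCodes.filter fun m => m.testBit u :=
    List.mem_filter.mpr ⟨mem_baseCodes.mpr ⟨ht, hvt⟩, by
      rw [testBit_code]
      exact decide_eq_true hut⟩
  let S (m : ℕ) : Prop := ∃ t, code t = m ∧ IsFacet t ∧ u ∈ t ∧ 11 ∈ t
  have hS (m) (hm : m ∈ baseCodes.filter fun m => m.testBit u) : S m := by
    obtain ⟨hm, hmu⟩ := List.mem_filter.mp hm
    have hcode := code_decode (of_decide_eq_true (Bool.and_eq_true_iff.mp
      (List.all_eq_true.mp facetCodes_card _ (List.mem_filter.mp hm).1)).1)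
    rw [← hcode] at hm hmu
    obtain ⟨hf, h11⟩ := mem_baseCodes.mp hm
    rw [testBit_code, decide_eq_true_iff] at hmu
    exact ⟨_, hcode, hf, hmu, h11⟩
  have h1 := hmem ht hut hvt
  have h2 := hmem ht' hut' hvt'
  split at h
  next heq => simp [heq] at h1
  next m l heq =>
    rw [heq] at h1 h2 hS
    -- Both `P` and its negation are invariant under exchanging a vertex
    have hinv (Q : Finset (Fin 16) → Prop) (hQ : ∀ t t', IsFacet t → IsFacet t' → u ∈ t → 11 ∈ t →
        u ∈ t' → 11 ∈ t' → (t ∩ t').card = 4 → Q t → Q t') (hm : Q (decode m)) :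
        ∀ k ∈ m :: l, Q (decode k) := by
      intro k hk
      rcases List.mem_cons.mp hk with rfl | hk
      · exact hm
      refine forall_of_connects (S := S) (P := fun k => Q (decode k)) ?_ 24 h ?_
        (fun k hk => hS k (List.mem_cons_of_mem m hk)) k hk
      · rintro _ _ ⟨s, rfl, hs⟩ ⟨s', rfl, hs'⟩ hc
        rw [code_inter, bitCount_code, Finset.inter_comm] at hc
        rw [decode_code, decode_code]
        exact hQ s' s hs'.1 hs.1 hs'.2.1 hs'.2.2 hs.2.1 hs.2.2 hc
      · intro k hk
        rw [List.mem_singleton.mp hk]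
        exact ⟨hS m List.mem_cons_self, hm⟩
    by_cases hm : P (decode m)
    · have := hinv P hP hm _ h2
      rwa [decode_code] at this
    · have := hinv (fun t => ¬P t) (fun t t' ht ht' h1 h2 h3 h4 hc hn hp =>
        hn (hP t' t ht' ht h3 h4 h1 h2 (by rwa [Finset.inter_comm]) hp)) hm _ h1
      rw [decode_code] at this
      exact absurd hPt this

theorem pairwise_of_freePairs {l : List (ℕ × ℕ)} (h : freePairs l = true)
    (hl : ∀ p ∈ l, p.1 < 2 ^ 16 ∧ p.2 < 2 ^ 16) :
    (l.map (Prod.map decode decode)).Pairwise fun p q => ¬p.1 ⊆ q.2 := by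
  induction l with
  | nil => exact List.Pairwise.nil
  | cons p l ih =>
    rw [freePairs, Bool.and_eq_true] at h
    rw [List.map_cons, List.pairwise_cons]
    refine ⟨fun q hq hsub => ?_, ih h.2 fun p hp => hl p (List.mem_cons_of_mem _ hp)⟩
    obtain ⟨q', hq', rfl⟩ := List.mem_map.mp hq
    have hne := List.all_eq_true.mp h.1 q' hq'
    have heq := (land_code_eq_iff _ _).mpr hsub
    simp only [Prod.map_fst, Prod.map_snd] at heq
    rw [code_decode (hl p List.mem_cons_self).1,
      code_decode (hl q' (List.mem_cons_of_mem p hq')).2] at heq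
    simp [heq] at hne

theorem mem_decode_eleven {m : ℕ} (h : m.testBit 11 = true) : 11 ∈ decode m :=
  Finset.mem_filter.mpr ⟨Finset.mem_univ _, h⟩

theorem isLinkCollapse_base : IsLinkCollapse IsFacet 11
    (collapseCodes₃.map (Prod.map decode decode)) (collapseCodes₂.map (Prod.map decode decode)) := by
  have h₃ (p) (hp : p ∈ collapseCodes₃) : p.1 < 2 ^ 16 ∧ p.2 ∈ facetCodes ∧ p.2 < 2 ^ 16 ∧
      p.1 &&& p.2 = p.1 ∧ bitCount p.1 = 4 ∧ p.1.testBit 11 = true := by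
    have h := List.all_eq_true.mp collapseCodes₃_spec p hp
    simp only [Bool.and_eq_true, decide_eq_true_iff, beq_iff_eq] at h
    obtain ⟨⟨⟨⟨h1, h2⟩, h3⟩, h4⟩, h5⟩ := h
    obtain ⟨m, hm, heq⟩ := List.any_eq_true.mp h2
    rw [← Nat.eq_of_beq_eq_true heq] at hm
    have hmem := (List.mem_filter.mp hm).1
    exact ⟨h1, hmem, of_decide_eq_true (Bool.and_eq_true_iff.mp
      (List.all_eq_true.mp facetCodes_card _ hmem)).1, h3, h4, h5⟩
  have h₂ (p) (hp : p ∈ collapseCodes₂) : p.1 < 2 ^ 16 ∧ p.2 < 2 ^ 16 ∧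
      p.1 &&& p.2 = p.1 ∧ bitCount p.1 = 3 ∧ bitCount p.2 = 4 ∧ p.1.testBit 11 = true := by
    have h := List.all_eq_true.mp collapseCodes₂_spec p hp
    simpa only [Bool.and_eq_true, decide_eq_true_iff, beq_iff_eq, and_assoc] using h
  have hcard {m n : ℕ} (hm : m < 2 ^ 16) (h : bitCount m = n) : (decode m).card = n := by
    rw [← bitCount_code, code_decode hm, h]
  have hsub {m k : ℕ} (hm : m < 2 ^ 16) (hk : k < 2 ^ 16) (h : m &&& k = m) :
      decode m ⊆ decode k := by
    rw [← land_code_eq_iff, code_decode hm, code_decode hk, h]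
  refine ⟨?_, ?_, ?_, ?_, ?_⟩
  · intro p hp
    obtain ⟨q, hq, rfl⟩ := List.mem_map.mp hp
    obtain ⟨h1, h2, h3, h4, h5, h6⟩ := h₃ q hq
    refine ⟨?_, hsub h1 h3 h4, hcard h1 h5, mem_decode_eleven h6⟩
    rw [IsFacet, Prod.map_snd, code_decode h3]
    exact h2
  · intro p hp
    obtain ⟨q, hq, rfl⟩ := List.mem_map.mp hp
    obtain ⟨h1, h2, h3, h4, h5, h6⟩ := h₂ q hq
    exact ⟨hsub h1 h2 h3, hcard h1 h4, hcard h2 h5, mem_decode_eleven h6⟩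
  · exact pairwise_of_freePairs freePairs_collapseCodes₃ fun p hp => ⟨(h₃ p hp).1, (h₃ p hp).2.2.1⟩
  · exact pairwise_of_freePairs freePairs_collapseCodes₂ fun p hp => ⟨(h₂ p hp).1, (h₂ p hp).2.1⟩
  · intro t ht r hrt hr hvr
    obtain ⟨x, hx, rfl⟩ := exists_eq_insert ht hr hrt
    have h := List.all_eq_true.mp (List.all_eq_true.mp collapseCodes_cover _
      (mem_baseCodes.mpr ⟨ht, hrt hvr⟩)) x (List.mem_range.mpr x.2)
    have hx11 : Nat.beq x 11 = false := by
      rw [← Bool.not_eq_true, Nat.beq_eq]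
      exact fun h => hx ((Fin.val_injective h : x = 11) ▸ hvr)
    rw [code_eq_xor_of_insert hx, testBit_code, decide_eq_true (Finset.mem_insert_self x r), hx11,
      Bool.not_true, Bool.false_or, Bool.false_or, Bool.or_eq_true] at h
    rcases h with h | h <;> obtain ⟨p, hp, heq⟩ := List.any_eq_true.mp h
    · refine Or.inl ⟨_, List.mem_map.mpr ⟨p, hp, rfl⟩, ?_⟩
      rw [Prod.map_fst, Nat.eq_of_beq_eq_true heq, decode_code]
    · refine Or.inr ⟨_, List.mem_map.mpr ⟨p, hp, rfl⟩, ?_⟩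
      rw [Prod.map_snd, Nat.eq_of_beq_eq_true heq, decode_code]

end K3

/-! ### The triangulated K3 surface is a neighborly manifold -/

namespace K3

theorem LinkConnected.image {u v : Fin 16} (h : LinkConnected u v) {g : Equiv.Perm (Fin 16)}
    (hg : g ∈ symGroup) : LinkConnected (g u) (g v) := by
  intro P hP t t' ht ht' hut hvt hut' hvt' hPt
  have hinv (t : Finset (Fin 16)) : (t.image g.symm).image g = t := by
    rw [Finset.image_image, Equiv.self_comp_symm, Finset.image_id]
  have hmem {w} {t : Finset (Fin 16)} (hw : g w ∈ t) : w ∈ t.image g.symm :=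
    Finset.mem_image.mpr ⟨_, hw, g.symm_apply_apply w⟩
  have hfacet {t} (ht : IsFacet t) : IsFacet (t.image g.symm) := ht.image (inv_mem hg)
  have := h (fun t => P (t.image g)) (fun s s' hs hs' hu hv hu' hv' hc hPs => by
    refine hP _ _ (hs.image hg) (hs'.image hg) (Finset.mem_image_of_mem g hu)
      (Finset.mem_image_of_mem g hv) (Finset.mem_image_of_mem g hu')
      (Finset.mem_image_of_mem g hv') ?_ hPs
    rwa [← Finset.image_inter _ _ g.injective, Finset.card_image_of_injective _ g.injective])
    _ _ (hfacet ht) (hfacet ht') (hmem hut) (hmem hvt) (hmem hut') (hmem hvt')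
    (by rwa [hinv])
  rwa [hinv] at this

theorem isLinkCollapse_image {v : Fin 16} {L₃ L₂ : List (Finset (Fin 16) × Finset (Fin 16))}
    (h : IsLinkCollapse IsFacet v L₃ L₂) {g : Equiv.Perm (Fin 16)} (hg : g ∈ symGroup) :
    IsLinkCollapse IsFacet (g v) (L₃.map (Prod.map (Finset.image g) (Finset.image g)))
      (L₂.map (Prod.map (Finset.image g) (Finset.image g))) := by
  have hcard (t : Finset (Fin 16)) : (t.image g).card = t.card :=
    Finset.card_image_of_injective t g.injective
  have hsub {s t : Finset (Fin 16)} : s.image g ⊆ t.image g ↔ s ⊆ t :=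
    Finset.image_subset_image_iff g.injective
  refine ⟨?_, ?_, ?_, ?_, ?_⟩
  · intro p hp
    obtain ⟨q, hq, rfl⟩ := List.mem_map.mp hp
    obtain ⟨h1, h2, h3, h4⟩ := h.mem₃ q hq
    exact ⟨h1.image hg, hsub.mpr h2, (hcard _).trans h3, Finset.mem_image_of_mem g h4⟩
  · intro p hp
    obtain ⟨q, hq, rfl⟩ := List.mem_map.mp hp
    obtain ⟨h1, h2, h3, h4⟩ := h.mem₂ q hq
    exact ⟨hsub.mpr h1, (hcard _).trans h2, (hcard _).trans h3, Finset.mem_image_of_mem g h4⟩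
  · exact List.pairwise_map.mpr (h.free₃.imp fun hn hs => hn (hsub.mp hs))
  · exact List.pairwise_map.mpr (h.free₂.imp fun hn hs => hn (hsub.mp hs))
  · intro t ht r hrt hr hvr
    have hinv (t : Finset (Fin 16)) : (t.image g.symm).image g = t := by
      rw [Finset.image_image, Equiv.self_comp_symm, Finset.image_id]
    rcases h.cover _ (ht.image (inv_mem hg)) (r.image g.symm) (Finset.image_subset_image hrt)
      (by rw [← hr]; exact Finset.card_image_of_injective _ g.symm.injective)
      (Finset.mem_image.mpr ⟨_, hvr, g.symm_apply_apply v⟩) with ⟨p, hp, heq⟩ | ⟨p, hp, heq⟩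
    · refine Or.inl ⟨_, List.mem_map_of_mem hp, ?_⟩
      rw [Prod.map_fst, heq, hinv]
    · refine Or.inr ⟨_, List.mem_map_of_mem hp, ?_⟩
      rw [Prod.map_snd, heq, hinv]

/-- The properties of the star of a vertex hold at the vertex `11`, and the group is transitive on
the vertices. -/
theorem isNeighborlyManifold : IsNeighborlyManifold IsFacet orientation where
  card_eq _ := card_of_isFacet
  neighborly u v w := by
    obtain ⟨g, hg, rfl⟩ := exists_mem_symGroup_apply_eq 11 u
    obtain ⟨t, ht, h11, hv, hw⟩ := neighborly_base (g.symm v) (g.symm w)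
    refine ⟨_, ht.image hg, Finset.mem_image_of_mem g h11, ?_, ?_⟩
    · exact Finset.mem_image.mpr ⟨_, hv, g.apply_symm_apply v⟩
    · exact Finset.mem_image.mpr ⟨_, hw, g.apply_symm_apply w⟩
  isUnit _ := isUnit_orientation
  eq_zero _ := orientation_eq_zero
  ridge _ := ridge
  connected u v huv := by
    obtain ⟨g, hg, rfl⟩ := exists_mem_symGroup_apply_eq 11 v
    have h := (linkConnected_base (u := g.symm u) fun h => huv (by rw [← h, g.apply_symm_apply])).image hg
    rwa [g.apply_symm_apply] at h
  collapse v := by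
    obtain ⟨g, hg, rfl⟩ := exists_mem_symGroup_apply_eq 11 v
    exact ⟨_, _, isLinkCollapse_image isLinkCollapse_base hg⟩

theorem numCritical_eq {F : Type*} [Field F] {f : complex.realization → ℝ} (hf : IsRSL complex f)
    (i : ℕ) : numCritical F complex f i =
      ((∑ v, Module.finrank F (LowHomology F complex (fun u => f (complex.vertexPoint u)) v i) : ℕ) :
        Cardinal) := by
  rw [numCritical, Nat.cast_sum]
  refine Finset.sum_congr rfl fun v _ => ?_
  rw [Module.finrank_eq_rank]
  exact critMultiplicity_eq_rank F hf v i

end K3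

theorem mainTheorem3 (F : Type*) [Field F] (f : K3.complex.realization → ℝ)
    (hf : IsRSL K3.complex f) :
    totalCritical F K3.complex 4 f = 24 ∧
      numCritical F K3.complex f 0 = 1 ∧
      numCritical F K3.complex f 1 = 0 ∧
      numCritical F K3.complex f 2 = 22 ∧
      numCritical F K3.complex f 3 = 0 ∧
      numCritical F K3.complex f 4 = 1 := by
  have ha : Function.Injective fun u => f (K3.complex.vertexPoint u) := fun u v huv => by
    by_contra hne
    exact hf.regular u v hne huv
  have h := K3.isNeighborlyManifold
  have h0 : numCritical F K3.complex f 0 = 1 := by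
    rw [K3.numCritical_eq hf, h.sum_finrank_lowHomology_zero K3.mem_faces_iff ha, Nat.cast_one]
  have h1 : numCritical F K3.complex f 1 = 0 := by
    rw [K3.numCritical_eq hf, Finset.sum_eq_zero fun v _ =>
      h.finrank_lowHomology_one K3.mem_faces_iff ha, Nat.cast_zero]
  have h2 : numCritical F K3.complex f 2 = 22 := by
    have hsum := h.sum_finrank_lowHomology_two (F := F) K3.mem_faces_iff ha
    rw [K3.card_facets, Fintype.card_fin, show Nat.choose 16 2 = 120 from rfl,
      show Nat.choose 16 3 = 560 from rfl] at hsum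
    rw [K3.numCritical_eq hf]
    exact_mod_cast (by omega)
  have h3 : numCritical F K3.complex f 3 = 0 := by
    rw [K3.numCritical_eq hf, Finset.sum_eq_zero fun v _ =>
      h.finrank_lowHomology_three K3.mem_faces_iff, Nat.cast_zero]
  have h4 : numCritical F K3.complex f 4 = 1 := by
    rw [K3.numCritical_eq hf, h.sum_finrank_lowHomology_four K3.mem_faces_iff ha, Nat.cast_one]
  refine ⟨?_, h0, h1, h2, h3, h4⟩
  rw [totalCritical, Finset.sum_range_succ, Finset.sum_range_succ, Finset.sum_range_succ,
    Finset.sum_range_succ, Finset.sum_range_succ, Finset.sum_range_zero, h0, h1, h2, h3, h4]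
  norm_num
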